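/- Let $S$ be a closed connected surface (orientable or not) of genus $g\ge 2$, let $\varphi\colon S\to S$ be a homeomorphism, and let $Y=S\times[0,1]/\big((x,1)\sim(\varphi(x),0)\big)$ be its mapping torus, with the fibre inclusion $\iota\colon S\to Y$, $x\mapsto[(x,0)]$. Fix $x_0\in S$ and suppose that $\pi_1(Y,\iota(x_0))$ has no nontrivial element of finite order. Then for every faithful (i.e. injective) homomorphism $\rho\colon\pi_1(Y,\iota(x_0))\to PSL_2(\mathbb R)$, the restriction $\rho|_S=\rho\circ\iota_*\colon\pi_1(S,x_0)\to PSL_2(\mathbb R)$ is not discrete: its image is not a discrete subgroup of $PSL_2(\mathbb R)$, with the usual Lie group topology. (The nonorientable closed surface of genus $g$ is the connected sum of $g$ projective planes.) -/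

import Mathlib

open scoped unitInterval MatrixGroups

noncomputable section

/-- The closed unit disc, regarded as a polygon whose sides are arcs of its boundary circle. -/
abbrev ClosedDisc : Type := Metric.closedBall (0 : ℂ) 1

/-- The boundary circle of the disc cut into `n` equal sides: for `0 ≤ x ≤ n` this is the point
`exp (2πi x / n)`. The `k`-th side (`0 ≤ k < n`) consists of the points with parameter
`x = k + s`, `0 ≤ s ≤ 1`, and is oriented in the direction of increasing `s`. -/
def boundaryPoint (n : ℕ) (x : ℝ) : ClosedDisc :=
  ⟨Complex.exp (((2 * Real.pi * x / n : ℝ) : ℂ) * Complex.I), by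
    rw [mem_closedBall_zero_iff, Complex.norm_exp_ofReal_mul_I]⟩

/-- Side identifications of the `4g`-gon with boundary word
`a₀ b₀ a₀⁻¹ b₀⁻¹ ⋯ a_{g-1} b_{g-1} a_{g-1}⁻¹ b_{g-1}⁻¹`. -/
inductive OrientableGluing (g : ℕ) : ClosedDisc → ClosedDisc → Prop
  | a (i : Fin g) (s : I) :
      OrientableGluing g (boundaryPoint (4 * g) (4 * (i : ℕ) + s))
        (boundaryPoint (4 * g) (4 * (i : ℕ) + 2 + (1 - s)))
  | b (i : Fin g) (s : I) :
      OrientableGluing g (boundaryPoint (4 * g) (4 * (i : ℕ) + 1 + s))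
        (boundaryPoint (4 * g) (4 * (i : ℕ) + 3 + (1 - s)))

/-- Side identifications of the `2g`-gon with boundary word `c₀ c₀ c₁ c₁ ⋯ c_{g-1} c_{g-1}`. -/
inductive NonorientableGluing (g : ℕ) : ClosedDisc → ClosedDisc → Prop
  | c (i : Fin g) (s : I) :
      NonorientableGluing g (boundaryPoint (2 * g) (2 * (i : ℕ) + s))
        (boundaryPoint (2 * g) (2 * (i : ℕ) + 1 + s))

/-- The standard closed orientable surface of genus `g` (for `g ≥ 1`), with the quotient topology:
`Quot` is the quotient by the equivalence relation generated by the side identifications. -/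
def StandardOrientableSurface (g : ℕ) : Type := Quot (OrientableGluing g)

instance (g : ℕ) : TopologicalSpace (StandardOrientableSurface g) :=
  inferInstanceAs (TopologicalSpace (Quot (OrientableGluing g)))

/-- The standard closed nonorientable surface of genus `g` (for `g ≥ 1`), i.e. the connected sum
of `g` projective planes. -/
def StandardNonorientableSurface (g : ℕ) : Type := Quot (NonorientableGluing g)

instance (g : ℕ) : TopologicalSpace (StandardNonorientableSurface g) :=
  inferInstanceAs (TopologicalSpace (Quot (NonorientableGluing g)))

/-- `S` is a closed (connected) surface of genus `g`, where `g ≥ 1`, orientable or not. -/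
def IsClosedSurfaceOfGenus (g : ℕ) (S : Type*) [TopologicalSpace S] : Prop :=
  Nonempty (S ≃ₜ StandardOrientableSurface g) ∨ Nonempty (S ≃ₜ StandardNonorientableSurface g)

section MappingTorus

variable {S : Type*} [TopologicalSpace S]

/-- The gluing `(x, 1) ∼ (φ x, 0)` on `S × [0, 1]`. -/
inductive MappingTorusGluing (φ : S ≃ₜ S) : S × I → S × I → Prop
  | glue (x : S) : MappingTorusGluing φ (x, 1) (φ x, 0)

/-- The mapping torus `S × [0, 1] / (x, 1) ∼ (φ x, 0)` of a homeomorphism `φ`. -/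
def MappingTorus (φ : S ≃ₜ S) : Type _ := Quot (MappingTorusGluing φ)

instance (φ : S ≃ₜ S) : TopologicalSpace (MappingTorus φ) :=
  inferInstanceAs (TopologicalSpace (Quot (MappingTorusGluing φ)))

/-- The inclusion `x ↦ [(x, 0)]` of the fibre `S` in the mapping torus. -/
def MappingTorus.fiber (φ : S ≃ₜ S) : C(S, MappingTorus φ) where
  toFun x := Quot.mk _ (x, 0)
  continuous_toFun := continuous_quot_mk.comp (by fun_prop)

/-- The restriction `ρ|_S` of a representation of the fundamental group of the mapping torus to
the fundamental group of the fibre. -/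
def MappingTorus.restrictToFiber (φ : S ≃ₜ S) (x₀ : S) {G : Type*} [Group G]
    (ρ : FundamentalGroup (MappingTorus φ) (MappingTorus.fiber φ x₀) →* G) :
    FundamentalGroup S x₀ →* G :=
  ρ.comp (FundamentalGroup.map (MappingTorus.fiber φ) x₀)

end MappingTorus

/-- A homomorphism to a topological group is discrete if its image is a discrete subgroup. -/
def IsDiscreteRep {Γ G : Type*} [Group Γ] [Group G] [TopologicalSpace G] (ρ : Γ →* G) : Prop :=
  DiscreteTopology ρ.range

end

open scoped Topology UpperHalfPlane

/-! Suppose the image Γ of the fibre group is discrete. It is finitely generated, and faithfulness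
makes it torsion-free and nonabelian. An element t of degree one over the circle normalizes Γ, but
no positive power of t lies in Γ, because the fibre group is exactly the kernel of the degree map.
This contradicts a property of Fuchsian groups (`PSL2_exists_pow_mem_of_normalizes`): a finitely
generated, nonabelian, torsion-free discrete group contains a positive power of every element that
normalizes it.

That property is proved with matrices and planar topology. Let H be the preimage of Γ in SL(2, ℝ),
and let T be a neighbourhood of an orbit Hz, thick enough to be path-connected. Both T and tⁿT are
H-invariant, and after conjugation some A ∈ H, A ≠ ±1, fixes ∞ without contracting there.
Translating paths by powers of A produces, in either set, curves that end at any finite point of the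
orbit H∞. Take four such points in increasing order. A curve in T from the first to the third must
cross a curve in tⁿT from the second to the fourth (`exists_eq_of_linked`). Hence tⁿ, corrected by
elements of H on both sides, moves z by a bounded amount, and so conjugates the generators of H into
a fixed finite set. By the pigeonhole principle two corrected elements act identically on the
generators; their quotient centralizes H, is therefore ±1, and a positive power of t lies in H.

The topology is done by hand. The cover S × ℝ of the mapping torus, with deck group ℤ, gives the
degree map and the injectivity of the fibre group. Surfaces are treated as glued polygons: a cover
by three open sets, each deforming to a discrete set, gives finite generation, and a map to the
Klein bottle gives two elements that do not commute. -/

/-! ### Planar topology: linked paths in the closed half plane -/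

/-- To leave `[0, π]` the angle would have to cross `(-π, 0)` or `(π, 2π)`, where the sine is
negative. -/
lemma mem_Icc_zero_pi_of_sin_nonneg {θ : ℝ → ℝ} (hθ : ContinuousOn θ (Set.Icc 0 1))
    (hsin : ∀ s ∈ Set.Icc (0 : ℝ) 1, 0 ≤ Real.sin (θ s)) (h0 : θ 0 ∈ Set.Icc 0 Real.pi) :
    θ 1 ∈ Set.Icc 0 Real.pi := by
  have key : ∀ a b : ℝ, a < b → (∀ x ∈ Set.Ioo a b, Real.sin x < 0) →
      ¬ (θ 0 ≤ a ∧ a < θ 1) ∧ ¬ (b ≤ θ 0 ∧ θ 1 < b) := by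
    intro a b hab hneg
    constructor
    · rintro ⟨h1, h2⟩
      -- This value lies in `(a, b)` and between `θ 0` and `θ 1`, so it is attained.
      have hm : (a + min b (θ 1)) / 2 ∈ Set.Icc (θ 0) (θ 1) := by
        have := min_le_right b (θ 1)
        have : a < min b (θ 1) := lt_min hab h2
        constructor <;> linarith
      obtain ⟨s, hs, hs'⟩ := intermediate_value_Icc zero_le_one hθ hm
      have h3 := hsin s hs
      rw [hs'] at h3
      have := min_le_left b (θ 1)
      have : a < min b (θ 1) := lt_min hab h2
      exact absurd (hneg _ ⟨by linarith, by linarith⟩) (not_lt.2 h3)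
    · rintro ⟨h1, h2⟩
      have hm : (b + max a (θ 1)) / 2 ∈ Set.Icc (θ 1) (θ 0) := by
        have := le_max_right a (θ 1)
        have : max a (θ 1) < b := max_lt hab h2
        constructor <;> linarith
      obtain ⟨s, hs, hs'⟩ := intermediate_value_Icc' zero_le_one hθ hm
      have h3 := hsin s hs
      rw [hs'] at h3
      have := le_max_left a (θ 1)
      have : max a (θ 1) < b := max_lt hab h2
      exact absurd (hneg _ ⟨by linarith, by linarith⟩) (not_lt.2 h3)
  have k1 := (key (-Real.pi) 0 (by linarith [Real.pi_pos])
    (fun x hx => Real.sin_neg_of_neg_of_neg_pi_lt hx.2 hx.1)).2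
  have k2 := (key Real.pi (2 * Real.pi) (by linarith [Real.pi_pos]) (fun x hx => by
    rw [← Real.sin_sub_two_pi]
    exact Real.sin_neg_of_neg_of_neg_pi_lt (by linarith [hx.2]) (by linarith [hx.1]))).1
  constructor
  · by_contra h; exact k1 ⟨h0.1, not_le.1 h⟩
  · by_contra h; exact k2 ⟨h0.2, not_le.1 h⟩

/-- A nowhere vanishing continuous function on the plane has a continuous argument. -/
lemma exists_continuous_exp_eq {f : ℝ × ℝ → ℂ} (hf : Continuous f) (h0 : ∀ x, f x ≠ 0) :
    ∃ g : ℝ × ℝ → ℂ, Continuous g ∧ ∀ x, Complex.exp (g x) = f x := by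
  have hs : IsSimplyConnected (Set.univ : Set (ℝ × ℝ)) := by
    have : SimplyConnectedSpace (ℝ × ℝ) := inferInstance
    exact (Homeomorph.Set.univ (ℝ × ℝ)).toHomotopyEquiv.simplyConnectedSpace
  obtain ⟨g, hg, hg'⟩ := Complex.exists_continuousOn_eqOn_exp_comp hs isOpen_univ hf.continuousOn
    (by simpa using h0)
  exact ⟨g, continuousOn_univ.1 hg, fun x => hg' (Set.mem_univ x)⟩

/-- Two paths in the closed upper half plane with linked endpoints on the real line meet. -/
theorem exists_eq_of_linked {a b c d : ℝ} (hab : a < b) (hbc : b < c) (hcd : c < d)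
    (P : Path (a : ℂ) c) (Q : Path (b : ℂ) d) (hP : ∀ s, 0 ≤ (P s).im) (hQ : ∀ s, 0 ≤ (Q s).im) :
    ∃ s t, P s = Q t := by
  by_contra! hne
  have hPe : ∀ s, 0 ≤ (P.extend s).im := fun s => by
    have := hP (Set.projIcc 0 1 zero_le_one s); simpa [Path.extend, Set.IccExtend] using this
  have hQe : ∀ s, 0 ≤ (Q.extend s).im := fun s => by
    have := hQ (Set.projIcc 0 1 zero_le_one s); simpa [Path.extend, Set.IccExtend] using this
  obtain ⟨g, hg, hgf⟩ := exists_continuous_exp_eq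
    (f := fun x : ℝ × ℝ => P.extend x.1 - Q.extend x.2) (by fun_prop) (fun x => by
      rw [sub_ne_zero]; exact hne _ _)
  -- The argument of `P s - Q t`, shifted to equal `π` at the corner `(0, 0)`, where the difference
  -- is the negative number `a - b`. The shift does not change sine and cosine.
  let θ : ℝ × ℝ → ℝ := fun x => (g x).im - ((g (0, 0)).im - Real.pi)
  have hθ : Continuous θ := by fun_prop
  have hre : ∀ x : ℝ × ℝ, (P.extend x.1 - Q.extend x.2).re
      = Real.exp (g x).re * Real.cos (g x).im := fun x => by rw [← hgf, Complex.exp_re]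
  have him : ∀ x : ℝ × ℝ, (P.extend x.1 - Q.extend x.2).im
      = Real.exp (g x).re * Real.sin (g x).im := fun x => by rw [← hgf, Complex.exp_im]
  have h00r := hre (0, 0)
  have h00i := him (0, 0)
  simp only [Path.extend_zero, Complex.sub_re, Complex.ofReal_re, Complex.sub_im,
    Complex.ofReal_im, sub_zero] at h00r h00i
  have hs0 : Real.sin (g (0, 0)).im = 0 := by
    rcases mul_eq_zero.1 h00i.symm with h | h
    · exact absurd h (Real.exp_ne_zero _)
    · exact h
  have hc0 : Real.cos (g (0, 0)).im = -1 := by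
    have h1 : Real.cos (g (0, 0)).im < 0 := by
      by_contra h
      have := mul_nonneg (Real.exp_nonneg (g (0, 0)).re) (not_lt.1 h)
      linarith
    have h2 := Real.sin_sq_add_cos_sq (g (0, 0)).im
    rw [hs0] at h2
    nlinarith
  have hsin : ∀ x, Real.sin (θ x) = Real.sin (g x).im := fun x => by
    simp only [θ]; rw [Real.sin_sub, Real.sin_sub, Real.cos_sub]; simp [hs0, hc0]
  have hcos : ∀ x, Real.cos (θ x) = Real.cos (g x).im := fun x => by
    simp only [θ]; rw [Real.cos_sub, Real.sin_sub, Real.cos_sub]; simp [hs0, hc0]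
  have hsn : ∀ x : ℝ × ℝ, 0 ≤ (P.extend x.1 - Q.extend x.2).im → 0 ≤ Real.sin (θ x) := fun x h => by
    rw [hsin]; rw [him] at h; exact nonneg_of_mul_nonneg_right h (Real.exp_pos _)
  have hsp : ∀ x : ℝ × ℝ, (P.extend x.1 - Q.extend x.2).im ≤ 0 → Real.sin (θ x) ≤ 0 := fun x h => by
    rw [hsin]; rw [him] at h; exact nonpos_of_mul_nonpos_right h (Real.exp_pos _)
  have hcn : ∀ x : ℝ × ℝ, 0 < (P.extend x.1 - Q.extend x.2).re → 0 < Real.cos (θ x) := fun x h => by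
    rw [hcos]; rw [hre] at h; exact pos_of_mul_pos_right h (Real.exp_nonneg _)
  have hcp : ∀ x : ℝ × ℝ, (P.extend x.1 - Q.extend x.2).re < 0 → Real.cos (θ x) < 0 := fun x h => by
    rw [hcos]; rw [hre] at h
    by_contra h'
    exact absurd (mul_nonneg (Real.exp_nonneg (g x).re) (not_lt.1 h')) (not_le.2 h)
  have hpi := Real.pi_pos
  -- The angle is followed from `(0, 0)` to `(1, 1)` along both sides of the square. On each edge
  -- one of the two paths stands at a real endpoint, so the imaginary part of the difference has
  -- constant sign. Via `(1, 0)` the angle goes `π`, `0`, then into `[-π, 0)`; via `(0, 1)` it goes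
  -- `π`, `π`, then into `[0, π]`.
  have e00 : θ (0, 0) = Real.pi := by simp [θ]
  have e10 : θ (1, 0) ∈ Set.Icc 0 Real.pi := by
    refine mem_Icc_zero_pi_of_sin_nonneg (θ := fun s => θ (s, 0)) (by fun_prop) (fun s _ => ?_) ?_
    · exact hsn _ (by simpa using hPe s)
    · simp only [e00]; exact ⟨hpi.le, le_rfl⟩
  have e10' : θ (1, 0) = 0 := by
    have h1 : 0 ≤ Real.sin (θ (1, 0)) := hsn _ (by simp)
    have h2 : Real.sin (θ (1, 0)) ≤ 0 := hsp _ (by simp)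
    have h3 : 0 < Real.cos (θ (1, 0)) := hcn _ (by simpa using hbc)
    rcases e10.1.eq_or_lt with h | h
    · exact h.symm
    rcases e10.2.eq_or_lt with h' | h'
    · rw [h', Real.cos_pi] at h3; linarith
    · linarith [Real.sin_pos_of_pos_of_lt_pi h h']
  have e11 : -θ (1, 1) ∈ Set.Icc 0 Real.pi := by
    refine mem_Icc_zero_pi_of_sin_nonneg (θ := fun t => -θ (1, t)) (by fun_prop) (fun t _ => ?_) ?_
    · rw [Real.sin_neg]
      have := hsp (1, t) (by simpa using hQe t)
      linarith
    · simp [e10', hpi.le]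
  have e11' : θ (1, 1) ≠ 0 := fun h => by
    have := hcp (1, 1) (by simpa using hcd)
    rw [h, Real.cos_zero] at this; linarith
  have e01 : 2 * Real.pi - θ (0, 1) ∈ Set.Icc 0 Real.pi := by
    refine mem_Icc_zero_pi_of_sin_nonneg (θ := fun t => 2 * Real.pi - θ (0, t)) (by fun_prop)
      (fun t _ => ?_) ?_
    · rw [Real.sin_two_pi_sub]
      have := hsp (0, t) (by simpa using hQe t)
      linarith
    · simp only [e00]; constructor <;> linarith
  have e01' : θ (0, 1) = Real.pi := by
    have h1 : 0 ≤ Real.sin (θ (0, 1)) := hsn _ (by simp)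
    have h3 : Real.cos (θ (0, 1)) < 0 := hcp _ (by simpa using (hab.trans hbc).trans hcd)
    rcases e01.1.eq_or_lt with h | h
    · have : θ (0, 1) = 2 * Real.pi := by linarith
      rw [this, Real.cos_two_pi] at h3; linarith
    rcases e01.2.eq_or_lt with h' | h'
    · linarith
    · have := Real.sin_pos_of_pos_of_lt_pi h h'
      rw [Real.sin_two_pi_sub] at this; linarith
  have e11'' : θ (1, 1) ∈ Set.Icc 0 Real.pi := by
    refine mem_Icc_zero_pi_of_sin_nonneg (θ := fun s => θ (s, 1)) (by fun_prop) (fun s _ => ?_) ?_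
    · exact hsn _ (by simpa using hPe s)
    · simp only [e01']; exact ⟨hpi.le, le_rfl⟩
  exact e11' (le_antisymm (by linarith [e11.1]) e11''.1)

/-! ### Gluing over slabs, and rays with a limit point -/

/-- Continuous maps on the slabs `n ≤ h x ≤ n + 1` that agree on the overlaps glue. -/
lemma continuous_floor_glue {X Z : Type*} [TopologicalSpace X] [TopologicalSpace Z] {h : X → ℝ}
    (hh : Continuous h) {f : ℤ → X → Z} (hf : ∀ n, Continuous (f n))
    (hglue : ∀ (n : ℤ) x, h x = n + 1 → f n x = f (n + 1) x) :
    Continuous fun x => f ⌊h x⌋ x := by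
  have hloc : LocallyFinite fun n : ℤ => h ⁻¹' Set.Icc (n : ℝ) (n + 1) := by
    refine LocallyFinite.preimage_continuous ?_ hh
    intro x
    refine ⟨Set.Ioo (x - 1) (x + 1), Ioo_mem_nhds (by linarith) (by linarith), ?_⟩
    refine (Set.finite_Icc (⌊x⌋ - 3) (⌊x⌋ + 3)).subset ?_
    rintro n ⟨y, hy1, hy2⟩
    have h1 := Int.floor_le x
    have h2 := Int.lt_floor_add_one x
    simp only [Set.mem_Icc, Set.mem_Ioo] at hy1 hy2 ⊢
    constructor
    · have : ((⌊x⌋ : ℤ) : ℝ) < n + 3 := by linarith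
      have : ⌊x⌋ < n + 3 := by exact_mod_cast this
      omega
    · have : (n : ℝ) < ⌊x⌋ + 3 := by linarith
      have : n < ⌊x⌋ + 3 := by exact_mod_cast this
      omega
  refine hloc.continuous ?_ (fun n => isClosed_Icc.preimage hh) (fun n => ?_)
  · ext x
    simp only [Set.mem_iUnion, Set.mem_preimage, Set.mem_Icc, Set.mem_univ, iff_true]
    exact ⟨⌊h x⌋, Int.floor_le _, (Int.lt_floor_add_one _).le⟩
  · refine (hf n).continuousOn.congr fun x hx => ?_
    rcases hx.2.eq_or_lt with h' | h'
    · have : ⌊h x⌋ = n + 1 := by rw [h']; simp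
      simp only [this, hglue n x h']
    · have : ⌊h x⌋ = n := Int.floor_eq_iff.2 ⟨hx.1, h'⟩
      simp only [this]

/-- A ray together with its limit point is a path. -/
lemma joinedIn_of_tendsto {Z : Type*} [TopologicalSpace Z] {F : Set Z} {r : ℝ → Z} {ξ : Z}
    (hr : Continuous r) (hF : ∀ s, 0 ≤ s → r s ∈ F) (hξ : ξ ∈ F)
    (hlim : Filter.Tendsto r Filter.atTop (𝓝 ξ)) : JoinedIn F (r 0) ξ := by
  -- The substitution `s / (1 - s)` carries `[0, 1)` onto `[0, ∞)`.
  let g : ℝ → Z := fun s => if s < 1 then r (s / (1 - s)) else ξ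
  have hg1 : ∀ s < 1, ContinuousAt g s := fun s hs => by
    have : ContinuousAt (fun s => r (s / (1 - s))) s :=
      hr.continuousAt.comp (continuousAt_id.div (by fun_prop) (by simp; linarith))
    refine this.congr ?_
    filter_upwards [Iio_mem_nhds hs] with x hx
    simp [g, Set.mem_Iio.1 hx]
  have hlim' : Filter.Tendsto (fun s : ℝ => r (s / (1 - s))) (𝓝[<] 1) (𝓝 ξ) := by
    refine hlim.comp ?_
    have h1 : Filter.Tendsto (fun s : ℝ => (1 - s)⁻¹) (𝓝[<] 1) Filter.atTop := by
      refine tendsto_inv_nhdsGT_zero.comp ?_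
      refine tendsto_nhdsWithin_iff.2 ⟨?_, ?_⟩
      · have : Filter.Tendsto (fun s : ℝ => 1 - s) (𝓝 1) (𝓝 (1 - 1)) :=
          (by fun_prop : Continuous fun s : ℝ => 1 - s).tendsto 1
        rw [sub_self] at this
        exact this.mono_left nhdsWithin_le_nhds
      · filter_upwards [self_mem_nhdsWithin] with s hs
        simpa using hs
    have h2 : Filter.Tendsto (fun s : ℝ => s) (𝓝[<] 1) (𝓝 1) := nhdsWithin_le_nhds
    exact h2.pos_mul_atTop one_pos h1
  have hg : ContinuousOn g (Set.Icc 0 1) := by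
    intro s hs
    rcases hs.2.eq_or_lt with h | h
    · subst h
      have h1 : g 1 = ξ := by simp [g]
      have h2 : ContinuousWithinAt g (Set.Iio 1) 1 := by
        rw [ContinuousWithinAt, h1]
        refine hlim'.congr' ?_
        filter_upwards [self_mem_nhdsWithin] with x hx
        simp [g, Set.mem_Iio.1 hx]
      refine (continuousWithinAt_Iio_iff_Iic.1 h2).mono fun x hx => hx.2
    · exact (hg1 s h).continuousWithinAt
  refine JoinedIn.ofLine hg (by simp [g]) (by simp [g]) ?_
  rintro _ ⟨s, hs, rfl⟩
  simp only [g]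
  split_ifs with h
  · exact hF _ (div_nonneg hs.1 (by linarith))
  · exact hξ

/-! ### SL(2, ℝ) acting on the upper half plane -/

lemma SL2_det (A : SL(2, ℝ)) : A 0 0 * A 1 1 - A 0 1 * A 1 0 = 1 := by
  have := A.det_coe
  rwa [Matrix.det_fin_two] at this

lemma SL2_ext {A B : SL(2, ℝ)} (h00 : A 0 0 = B 0 0) (h01 : A 0 1 = B 0 1) (h10 : A 1 0 = B 1 0)
    (h11 : A 1 1 = B 1 1) : A = B := by
  ext i j; fin_cases i <;> fin_cases j <;> assumption

lemma SL2_mul_apply (A B : SL(2, ℝ)) (i j : Fin 2) :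
    (A * B) i j = A i 0 * B 0 j + A i 1 * B 1 j := by
  rw [Matrix.SpecialLinearGroup.coe_mul, Matrix.mul_apply, Fin.sum_univ_two]

lemma SL2_inv_apply (A : SL(2, ℝ)) :
    A⁻¹ 0 0 = A 1 1 ∧ A⁻¹ 0 1 = -A 0 1 ∧ A⁻¹ 1 0 = -A 1 0 ∧ A⁻¹ 1 1 = A 0 0 := by
  rw [Matrix.SpecialLinearGroup.SL2_inv_expl]; simp

lemma SL2_smul_coe (A : SL(2, ℝ)) (z : ℍ) : ((A • z : ℍ) : ℂ) =
    ((A 0 0 : ℂ) * z + A 0 1) / ((A 1 0 : ℂ) * z + A 1 1) := by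
  simpa using UpperHalfPlane.coe_specialLinearGroup_apply A z

lemma SL2_denom_ne_zero (A : SL(2, ℝ)) (z : ℍ) : (A 1 0 : ℂ) * z + A 1 1 ≠ 0 :=
  UpperHalfPlane.denom_ne_zero (A : GL (Fin 2) ℝ) z

/-- The quotient `A 0 0 / A 1 0` is the image of ∞ under `A`; the formula makes visible that `A • z`
tends to it as `z` tends to ∞. -/
lemma SL2_smul_sub (A : SL(2, ℝ)) (hA : A 1 0 ≠ 0) (z : ℍ) :
    ((A • z : ℍ) : ℂ) - ((A 0 0 / A 1 0 : ℝ) : ℂ) =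
      -((A 1 0 : ℂ) * ((A 1 0 : ℂ) * z + A 1 1))⁻¹ := by
  rw [SL2_smul_coe]
  have h1 := SL2_denom_ne_zero A z
  have h2 : (A 1 0 : ℂ) ≠ 0 := by exact_mod_cast hA
  have h3 : (A 0 0 : ℂ) * A 1 1 - A 0 1 * A 1 0 = 1 := by exact_mod_cast SL2_det A
  have key : ∀ a b c d w : ℂ, c * w + d ≠ 0 → c ≠ 0 → a * d - b * c = 1 →
      (a * w + b) / (c * w + d) - a / c = -(c * (c * w + d))⁻¹ := by
    intro a b c d w h1 h2 h3
    rw [div_sub_div _ _ h1 h2, mul_comm c (c * w + d), ← one_div, ← neg_div]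
    congr 1
    linear_combination -h3
  rw [Complex.ofReal_div]
  exact key _ _ _ _ _ h1 h2 h3

/-- An upper triangular matrix acts on the upper half plane as an affine map. -/
lemma SL2_smul_of_lower_eq_zero (A : SL(2, ℝ)) (hA : A 1 0 = 0) (z : ℍ) :
    ((A • z : ℍ) : ℂ) = (A 0 0 : ℂ) ^ 2 * z + A 0 0 * A 0 1 := by
  have h := SL2_det A
  rw [hA, mul_zero, sub_zero] at h
  have h3 : (A 0 0 : ℂ) * A 1 1 = 1 := by exact_mod_cast h
  have h4 : (A 1 1 : ℂ) ≠ 0 := right_ne_zero_of_mul_eq_one h3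
  rw [SL2_smul_coe, hA]
  simp only [Complex.ofReal_zero, zero_mul, zero_add]
  rw [div_eq_iff h4]
  linear_combination (-(A 0 0 : ℂ) * z - A 0 1) * h3

/-- A non-elliptic upper triangular matrix which does not contract at infinity pushes compact
sets to infinity. -/
lemma SL2_pow_smul_unbounded (A : SL(2, ℝ)) (hA : A 1 0 = 0) (hA1 : A ≠ 1) (hA2 : A ≠ -1)
    (ha : 1 ≤ A 0 0 ^ 2) {C : Set ℍ} (hC : IsCompact C) (M : ℝ) :
    ∃ N : ℕ, ∀ n ≥ N, ∀ w ∈ C, M ≤ ‖((A ^ n • w : ℍ) : ℂ)‖ := by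
  rcases C.eq_empty_or_nonempty with rfl | hne
  · simp
  rcases ha.eq_or_lt with h1 | h1
  -- Parabolic case: `A` is a translation by the nonzero number `A 0 0 * A 0 1`.
  · have hdet := SL2_det A
    rw [hA, mul_zero, sub_zero] at hdet
    have hb : A 0 0 * A 0 1 ≠ 0 := by
      refine mul_ne_zero (left_ne_zero_of_mul_eq_one hdet) fun hb => ?_
      rcases mul_self_eq_one_iff.1 ((sq _).symm.trans h1.symm) with h | h
      · exact hA1 (SL2_ext (by simp [h]) (by simp [hb]) (by simp [hA]) (by
          rw [h] at hdet; simp at hdet; simp [hdet]))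
      · exact hA2 (SL2_ext (by simp [h]) (by simp [hb]) (by simp [hA]) (by
          rw [h] at hdet; simp; linarith))
    have hpow : ∀ (n : ℕ) (w : ℍ), ((A ^ n • w : ℍ) : ℂ) = w + n * ((A 0 0 * A 0 1 : ℝ) : ℂ) := by
      intro n w
      induction n with
      | zero => simp
      | succ n ih =>
        rw [pow_succ', mul_smul, SL2_smul_of_lower_eq_zero A hA, ih]
        have : (A 0 0 : ℂ) ^ 2 = 1 := by exact_mod_cast h1.symm
        rw [this]; push_cast; ring
    obtain ⟨K, hK⟩ : ∃ K, ∀ w ∈ C, ‖(w : ℂ)‖ ≤ K :=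
      hC.exists_bound_of_continuousOn (f := fun w : ℍ => (w : ℂ))
        UpperHalfPlane.continuous_coe.continuousOn
    obtain ⟨N, hN⟩ := exists_nat_ge ((M + K) / |A 0 0 * A 0 1|)
    refine ⟨N, fun n hn w hw => ?_⟩
    rw [hpow]
    have h2 : M + K ≤ n * |A 0 0 * A 0 1| := by
      rw [div_le_iff₀ (abs_pos.2 hb)] at hN
      exact hN.trans (by gcongr)
    have h3 : ‖(n : ℂ) * ((A 0 0 * A 0 1 : ℝ) : ℂ)‖ = n * |A 0 0 * A 0 1| := by
      rw [norm_mul, Complex.norm_real, Complex.norm_natCast, Real.norm_eq_abs]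
    have h4 := norm_sub_le ((w : ℂ) + n * ((A 0 0 * A 0 1 : ℝ) : ℂ)) w
    rw [add_sub_cancel_left, h3] at h4
    linarith [hK w hw]
  -- Hyperbolic case: every application of `A` multiplies imaginary parts by `A 0 0 ^ 2 > 1`.
  · have hpow : ∀ (n : ℕ) (w : ℍ), (A ^ n • w).im = (A 0 0 ^ 2) ^ n * w.im := by
      intro n w
      induction n with
      | zero => simp
      | succ n ih =>
        have := congrArg Complex.im (SL2_smul_of_lower_eq_zero A hA (A ^ n • w))
        rw [pow_succ', mul_smul, ← UpperHalfPlane.coe_im, this]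
        have e : (A 0 0 : ℂ) ^ 2 = ((A 0 0 ^ 2 : ℝ) : ℂ) := by push_cast; rfl
        have e' : (A 0 0 : ℂ) * A 0 1 = ((A 0 0 * A 0 1 : ℝ) : ℂ) := by push_cast; rfl
        rw [Complex.add_im, e, e', Complex.im_ofReal_mul, Complex.ofReal_im, UpperHalfPlane.coe_im, ih]
        ring
    obtain ⟨z, hz, hmin⟩ := hC.exists_isMinOn hne UpperHalfPlane.continuous_im.continuousOn
    obtain ⟨N, hN⟩ := pow_unbounded_of_one_lt (M / z.im) h1
    refine ⟨N, fun n hn w hw => ?_⟩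
    have h2 : M ≤ (A 0 0 ^ 2) ^ n * z.im := by
      rw [div_lt_iff₀ z.im_pos] at hN
      exact hN.le.trans (mul_le_mul_of_nonneg_right (pow_le_pow_right₀ h1.le hn) z.im_pos.le)
    have h3 : (A 0 0 ^ 2) ^ n * z.im ≤ (A ^ n • w).im := by
      rw [hpow]; exact mul_le_mul_of_nonneg_left (hmin hw) (by positivity)
    calc M ≤ (A ^ n • w).im := h2.trans h3
      _ = ((A ^ n • w : ℍ) : ℂ).im := rfl
      _ ≤ _ := (le_abs_self _).trans (Complex.abs_im_le_norm _)

/-! ### Crossing of invariant path-connected sets -/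

/-- A path-connected invariant set contains a ray converging to the image under `h` of the
fixed point at infinity of `A`. -/
lemma joinedIn_insert_limit {H : Subgroup SL(2, ℝ)} {T : Set ℍ} {z : ℍ}
    (hT : ∀ h ∈ H, ∀ w ∈ T, h • w ∈ T) (hz : ∀ h ∈ H, JoinedIn T z (h • z))
    {A : SL(2, ℝ)} (hAH : A ∈ H) (hA : A 1 0 = 0) (hA1 : A ≠ 1) (hA2 : A ≠ -1)
    (ha : 1 ≤ A 0 0 ^ 2) {h : SL(2, ℝ)} (hh : h ∈ H) (hc : h 1 0 ≠ 0) :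
    JoinedIn (insert ((h 0 0 / h 1 0 : ℝ) : ℂ) ((↑) '' T)) (z : ℂ) ((h 0 0 / h 1 0 : ℝ) : ℂ) := by
  obtain ⟨c, hcT⟩ := hz A hAH
  -- The path from `z` to `A • z` and its translates by powers of `A` concatenate to a line that
  -- tends to ∞ in the positive direction; `h` then moves this limit to `h 0 0 / h 1 0`.
  let r : ℝ → ℍ := fun s => h • (A ^ ⌊s⌋ • c.extend (s - ⌊s⌋))
  have hr : Continuous r := by
    refine continuous_floor_glue (h := fun s : ℝ => s) continuous_id
      (f := fun n s => h • (A ^ n • c.extend (s - n))) (fun n => ?_) (fun n s hs => ?_)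
    · fun_prop
    · simp only [hs]
      push_cast
      rw [add_sub_cancel_left, sub_self, c.extend_one, c.extend_zero, zpow_add_one, mul_smul]
  have hext : ∀ s, c.extend s ∈ Set.range c := fun s => by
    rw [← c.extend_range]; exact Set.mem_range_self s
  have hrT : ∀ s, r s ∈ T := fun s => by
    refine hT h hh _ (hT _ (H.zpow_mem hAH _) _ ?_)
    obtain ⟨t, ht⟩ := hext (s - ⌊s⌋)
    rw [← ht]; exact hcT t
  have hlim : Filter.Tendsto (fun s => (r s : ℂ)) Filter.atTop (𝓝 ((h 0 0 / h 1 0 : ℝ) : ℂ)) := by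
    have hcC : (h 1 0 : ℂ) ≠ 0 := by exact_mod_cast hc
    let w : ℝ → ℂ := fun s => ((A ^ ⌊s⌋ • c.extend (s - ⌊s⌋) : ℍ) : ℂ)
    have hw : Filter.Tendsto w Filter.atTop (Bornology.cobounded ℂ) := by
      rw [← tendsto_norm_atTop_iff_cobounded, Filter.tendsto_atTop]
      intro M
      obtain ⟨N, hN⟩ := SL2_pow_smul_unbounded A hA hA1 hA2 ha
        (isCompact_range c.continuous) M
      filter_upwards [Filter.eventually_ge_atTop (N : ℝ)] with s hs
      have h0 : (N : ℤ) ≤ ⌊s⌋ := Int.le_floor.2 (by exact_mod_cast hs)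
      obtain ⟨n, hn⟩ := Int.eq_ofNat_of_zero_le (a := ⌊s⌋) (by omega)
      simp only [w]
      have := hN n (by omega) _ (hext (s - ⌊s⌋))
      rwa [← zpow_natCast, ← hn] at this
    have h1 : Filter.Tendsto (fun s => (h 1 0 : ℂ) * (h 1 0 * w s + h 1 1)) Filter.atTop
        (Bornology.cobounded ℂ) := by
      have e : Filter.Tendsto (fun x : ℂ => (h 1 0 : ℂ) * (h 1 0 * x + h 1 1))
          (Bornology.cobounded ℂ) (Bornology.cobounded ℂ) := by
        rw [← tendsto_norm_atTop_iff_cobounded]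
        have h2 : Filter.Tendsto (fun x : ℂ => ‖(h 1 0 : ℂ)‖ ^ 2 * ‖x‖ - ‖(h 1 0 : ℂ) * h 1 1‖)
            (Bornology.cobounded ℂ) Filter.atTop := by
          refine Filter.tendsto_atTop_add_const_right _ _ ?_
          exact tendsto_norm_cobounded_atTop.const_mul_atTop (by positivity)
        refine Filter.tendsto_atTop_mono (fun x => ?_) h2
        have := norm_sub_norm_le ((h 1 0 : ℂ) ^ 2 * x) (-((h 1 0 : ℂ) * h 1 1))
        rw [norm_neg, norm_mul, norm_pow] at this
        refine this.trans (le_of_eq (congrArg _ (by ring)))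
      exact e.comp hw
    have h2 : Filter.Tendsto (fun s => (r s : ℂ) - ((h 0 0 / h 1 0 : ℝ) : ℂ)) Filter.atTop
        (𝓝 0) := by
      have := (Filter.tendsto_inv₀_cobounded.comp h1).neg
      rw [neg_zero] at this
      refine this.congr fun s => ?_
      exact (SL2_smul_sub h hc _).symm
    simpa using h2.add_const ((h 0 0 / h 1 0 : ℝ) : ℂ)
  have h1 : JoinedIn (insert ((h 0 0 / h 1 0 : ℝ) : ℂ) ((↑) '' T)) (r 0 : ℂ)
      ((h 0 0 / h 1 0 : ℝ) : ℂ) :=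
    joinedIn_of_tendsto (r := fun s => (r s : ℂ)) (by fun_prop)
      (fun s _ => Set.mem_insert_of_mem _ ⟨_, hrT s, rfl⟩) (Set.mem_insert _ _) hlim
  have h2 : r 0 = h • z := by simp [r]
  rw [h2] at h1
  refine JoinedIn.trans ?_ h1
  exact ((hz h hh).map UpperHalfPlane.continuous_coe).mono (Set.subset_insert _ _)

/-- Two connected invariant sets meet, because they contain curves with linked endpoints. -/
lemma inter_nonempty_of_linked {H : Subgroup SL(2, ℝ)}
    {T : Set ℍ} {z : ℍ} (hT : ∀ h ∈ H, ∀ w ∈ T, h • w ∈ T) (hz : ∀ h ∈ H, JoinedIn T z (h • z))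
    {T' : Set ℍ} {z' : ℍ} (hT' : ∀ h ∈ H, ∀ w ∈ T', h • w ∈ T')
    (hz' : ∀ h ∈ H, JoinedIn T' z' (h • z'))
    {A : SL(2, ℝ)} (hAH : A ∈ H) (hA : A 1 0 = 0) (hA1 : A ≠ 1) (hA2 : A ≠ -1)
    (ha : 1 ≤ A 0 0 ^ 2) {h : Fin 4 → SL(2, ℝ)} (hh : ∀ k, h k ∈ H) (hc : ∀ k, h k 1 0 ≠ 0)
    (hmono : StrictMono fun k => h k 0 0 / h k 1 0) : (T ∩ T').Nonempty := by
  have J := fun k => joinedIn_insert_limit hT hz hAH hA hA1 hA2 ha (hh k) (hc k)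
  have J' := fun k => joinedIn_insert_limit hT' hz' hAH hA hA1 hA2 ha (hh k) (hc k)
  set ξ : Fin 4 → ℝ := fun k => h k 0 0 / h k 1 0
  have hs : ∀ (F : Set ℍ) (i j : Fin 4), insert ((ξ i : ℝ) : ℂ) ((↑) '' F) ⊆
      insert (ξ i : ℂ) (insert (ξ j : ℂ) ((↑) '' F)) := fun F i j =>
    Set.insert_subset_insert (Set.subset_insert _ _)
  have hs' : ∀ (F : Set ℍ) (i j : Fin 4), insert ((ξ j : ℝ) : ℂ) ((↑) '' F) ⊆
      insert (ξ i : ℂ) (insert (ξ j : ℂ) ((↑) '' F)) := fun F i j => Set.subset_insert _ _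
  -- `P` joins the first boundary point to the third inside `T`, and `Q` the second to the fourth
  -- inside `T'`, endpoints excepted.
  obtain ⟨P, hP⟩ := ((J 0).mono (hs T 0 2)).symm.trans ((J 2).mono (hs' T 0 2))
  obtain ⟨Q, hQ⟩ := ((J' 1).mono (hs T' 1 3)).symm.trans ((J' 3).mono (hs' T' 1 3))
  have him : ∀ (F : Set ℍ) (i j : Fin 4) (x : ℂ),
      x ∈ insert (ξ i : ℂ) (insert (ξ j : ℂ) ((↑) '' F)) → 0 ≤ x.im := by
    rintro F i j x (rfl | rfl | ⟨w, -, rfl⟩)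
    · simp
    · simp
    · exact w.im_pos.le
  obtain ⟨s, t, hst⟩ := exists_eq_of_linked (hmono (by decide : (0 : Fin 4) < 1))
    (hmono (by decide : (1 : Fin 4) < 2)) (hmono (by decide : (2 : Fin 4) < 3)) P Q
    (fun s => him _ _ _ _ (hP s)) (fun s => him _ _ _ _ (hQ s))
  have hreal : ∀ (x : ℝ) (w : ℍ), (x : ℂ) ≠ w := fun x w h => by
    have := congrArg Complex.im h
    rw [Complex.ofReal_im, UpperHalfPlane.coe_im] at this
    exact w.im_pos.ne this
  have hinj : ∀ i j : Fin 4, i ≠ j → (ξ i : ℂ) ≠ ξ j := fun i j hij h =>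
    hij (hmono.injective (by exact_mod_cast h))
  have h1 := hP s
  have h2 := hQ t
  rw [← hst] at h2
  -- The crossing is not at an endpoint: the four boundary points are distinct, and all other points
  -- of the curves have positive imaginary part.
  rcases h1 with h1 | h1 | ⟨w, hw, h1⟩ <;> rcases h2 with h2 | h2 | ⟨w', hw', h2⟩
  · exact absurd (h1.symm.trans h2) (hinj _ _ (by decide))
  · exact absurd (h1.symm.trans h2) (hinj _ _ (by decide))
  · exact absurd (h1.symm.trans h2.symm) (hreal _ _)
  · exact absurd (h1.symm.trans h2) (hinj _ _ (by decide))
  · exact absurd (h1.symm.trans h2) (hinj _ _ (by decide))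
  · exact absurd (h1.symm.trans h2.symm) (hreal _ _)
  · exact absurd (h2.symm.trans h1.symm) (hreal _ _)
  · exact absurd (h2.symm.trans h1.symm) (hreal _ _)
  · have : w = w' := UpperHalfPlane.ext (h1.trans h2.symm)
    exact ⟨w, hw, this ▸ hw'⟩

/-! ### Centralizers, torsion, and groups fixing infinity -/

/-- If `C 1 0` were nonzero, comparing the first columns of `A * C` and `C * A` would make `A`
scalar. Thus whatever commutes with `A` also fixes ∞. -/
lemma SL2_lower_eq_zero_of_commute {A C : SL(2, ℝ)} (hA : A 1 0 = 0) (hA1 : A ≠ 1) (hA2 : A ≠ -1)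
    (h : A * C = C * A) : C 1 0 = 0 := by
  by_contra hC
  have e00 : (A * C) 0 0 = (C * A) 0 0 := by rw [h]
  have e10 : (A * C) 1 0 = (C * A) 1 0 := by rw [h]
  rw [SL2_mul_apply, SL2_mul_apply, hA] at e00 e10
  have hb : A 0 1 = 0 := by
    have : A 0 1 * C 1 0 = 0 := by linarith
    exact (mul_eq_zero.1 this).resolve_right hC
  have had : A 1 1 = A 0 0 := by
    have : (A 1 1 - A 0 0) * C 1 0 = 0 := by linarith
    exact sub_eq_zero.1 ((mul_eq_zero.1 this).resolve_right hC)
  have hdet := SL2_det A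
  rw [had, hA, mul_zero, sub_zero] at hdet
  rcases mul_self_eq_one_iff.1 hdet with h1 | h1
  · exact hA1 (SL2_ext (by simp [h1]) (by simp [hb]) (by simp [hA]) (by simp [had, h1]))
  · exact hA2 (SL2_ext (by simp [h1]) (by simp [hb]) (by simp [hA]) (by simp [had, h1]))

/-- A matrix fixing infinity and two further boundary points is trivial. -/
lemma SL2_eq_one_or_neg_one_of_fixes {C h k : SL(2, ℝ)} (hC : C 1 0 = 0)
    (hh : (h⁻¹ * C * h) 1 0 = 0) (hk : (k⁻¹ * C * k) 1 0 = 0) (hh0 : h 1 0 ≠ 0) (hk0 : k 1 0 ≠ 0)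
    (hne : h 0 0 / h 1 0 ≠ k 0 0 / k 1 0) : C = 1 ∨ C = -1 := by
  have key : ∀ g : SL(2, ℝ), (g⁻¹ * C * g) 1 0 = 0 → g 1 0 ≠ 0 →
      (C 1 1 - C 0 0) * (g 0 0 / g 1 0) = C 0 1 := by
    intro g hg hg0
    obtain ⟨-, -, e1, e2⟩ := SL2_inv_apply g
    simp only [SL2_mul_apply, e1, e2, hC] at hg
    rw [mul_div_assoc', div_eq_iff hg0]
    have : g 1 0 * ((C 1 1 - C 0 0) * g 0 0 - C 0 1 * g 1 0) = 0 := by linarith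
    exact sub_eq_zero.1 ((mul_eq_zero.1 this).resolve_left hg0)
  have k1 := key h hh hh0
  have k2 := key k hk hk0
  have had : C 1 1 = C 0 0 := by
    have : (C 1 1 - C 0 0) * (h 0 0 / h 1 0 - k 0 0 / k 1 0) = 0 := by rw [mul_sub]; linarith
    exact sub_eq_zero.1 ((mul_eq_zero.1 this).resolve_right (sub_ne_zero.2 hne))
  have hb : C 0 1 = 0 := by rw [← k1, had]; ring
  have hdet := SL2_det C
  rw [had, hC, mul_zero, sub_zero] at hdet
  rcases mul_self_eq_one_iff.1 hdet with h1 | h1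
  · exact .inl (SL2_ext (by simp [h1]) (by simp [hb]) (by simp [hC]) (by simp [had, h1]))
  · exact .inr (SL2_ext (by simp [h1]) (by simp [hb]) (by simp [hC]) (by simp [had, h1]))

/-- Powers of an element of a locally finite subgroup which stay in a compact set repeat. -/
lemma exists_pow_eq_one_of_isCompact {H : Subgroup SL(2, ℝ)}
    (hfin : ∀ K : Set SL(2, ℝ), IsCompact K → (K ∩ H).Finite) {A : SL(2, ℝ)} (hA : A ∈ H)
    {K : Set SL(2, ℝ)} (hK : IsCompact K) (hAK : ∀ n : ℕ, A ^ n ∈ K) :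
    ∃ n, 1 ≤ n ∧ A ^ n = 1 := by
  have : IsOfFinOrder A := by
    by_contra h
    have hinj := injective_pow_iff_not_isOfFinOrder.2 h
    refine Set.infinite_range_of_injective hinj ((hfin K hK).subset ?_)
    rintro _ ⟨n, rfl⟩
    exact ⟨hAK n, H.pow_mem hA n⟩
  obtain ⟨n, hn, h1⟩ := isOfFinOrder_iff_pow_eq_one.1 this
  exact ⟨n, hn, h1⟩

/-- The orbit map of `I` is proper, and the triangle inequality transfers this to the base point
`z`. -/
lemma isCompact_setOf_dist_smul_le (z w : ℍ) (R : ℝ) :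
    IsCompact {g : SL(2, ℝ) | dist (g • z) w ≤ R} := by
  have h1 : IsCompact {g : SL(2, ℝ) | dist (g • UpperHalfPlane.I) w ≤
      R + dist z UpperHalfPlane.I} := by
    have := UpperHalfPlane.isProperMap_smul_I.isCompact_preimage
      (isCompact_closedBall w (R + dist z UpperHalfPlane.I))
    exact this
  refine h1.of_isClosed_subset ?_ fun g hg => ?_
  · exact isClosed_le (by fun_prop) continuous_const
  · have h2 := dist_triangle (g • UpperHalfPlane.I) (g • z) w
    rw [dist_smul, dist_comm UpperHalfPlane.I] at h2
    have h3 : dist (g • z) w ≤ R := hg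
    simp only [Set.mem_ofPred_eq]
    linarith

/-- Elements of a locally finite torsion-free subgroup have a fixed point on the boundary. -/
lemma exists_conj_lower_eq_zero {H : Subgroup SL(2, ℝ)}
    (hfin : ∀ K : Set SL(2, ℝ), IsCompact K → (K ∩ H).Finite)
    {A : SL(2, ℝ)} (hA : A ∈ H) (htf : ∀ n, 1 ≤ n → A ^ n ≠ 1) :
    ∃ P : SL(2, ℝ), (P⁻¹ * A * P) 1 0 = 0 := by
  by_cases hc : A 1 0 = 0
  · exact ⟨1, by simpa using hc⟩
  by_cases hdisc : 0 ≤ (A 0 0 + A 1 1) ^ 2 - 4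
  · have hdet := SL2_det A
    -- A real root of the equation for fixed points of `A` on the boundary; the matrix `P` below
    -- sends ∞ to `x`.
    let x : ℝ := ((A 0 0 - A 1 1) + √((A 0 0 + A 1 1) ^ 2 - 4)) / (2 * A 1 0)
    have hx : A 1 0 * x ^ 2 + (A 1 1 - A 0 0) * x - A 0 1 = 0 := by
      have hs := Real.sq_sqrt hdisc
      have e : √((A 0 0 + A 1 1) ^ 2 - 4) = 2 * A 1 0 * x - (A 0 0 - A 1 1) := by
        simp only [x]; field_simp; ring
      rw [e] at hs
      have : 4 * A 1 0 * (A 1 0 * x ^ 2 + (A 1 1 - A 0 0) * x - A 0 1) = 0 := by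
        linear_combination hs + 4 * hdet
      exact (mul_eq_zero.1 this).resolve_left (mul_ne_zero (by norm_num) hc)
    let P : SL(2, ℝ) := ⟨!![x, -1; 1, 0], by simp [Matrix.det_fin_two]⟩
    refine ⟨P, ?_⟩
    obtain ⟨-, -, e1, e2⟩ := SL2_inv_apply P
    simp only [SL2_mul_apply, e1, e2]
    simp only [P, Matrix.of_apply, Matrix.cons_val', Matrix.cons_val_zero, Matrix.cons_val_one,
      Matrix.cons_val_fin_one]
    linear_combination hx
  · exfalso
    -- With negative discriminant `A` fixes a point of the half plane. Its powers stay in the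
    -- compact stabilizer, so it has finite order.
    have hell : (A : GL (Fin 2) ℝ).IsElliptic := by
      change (A : Matrix (Fin 2) (Fin 2) ℝ).discr < 0
      rw [Matrix.discr_fin_two, Matrix.trace_fin_two, A.det_coe]
      linarith
    obtain ⟨z, hz⟩ : ∃ z : ℍ, A • z = z :=
      ⟨_, (UpperHalfPlane.gl_smul_eq_self_iff_eq_fixedPt (by simp) hell).2 rfl⟩
    obtain ⟨n, hn, h1⟩ := exists_pow_eq_one_of_isCompact hfin hA
      (isCompact_setOf_dist_smul_le z z 0) (fun n => by
        have : A ^ n • z = z := by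
          induction n with
          | zero => simp
          | succ n ih => rw [pow_succ, mul_smul, hz, ih]
        simp [this])
    exact htf n hn h1

/-- A locally finite group of upper triangular matrices is commutative up to sign. -/
lemma commute_of_forall_lower_eq_zero {H : Subgroup SL(2, ℝ)}
    (hfin : ∀ K : Set SL(2, ℝ), IsCompact K → (K ∩ H).Finite) (hH : ∀ h ∈ H, h 1 0 = 0)
    {B C : SL(2, ℝ)} (hB : B ∈ H) (hC : C ∈ H) : B * C = C * B := by
  have hdiag : ∀ h ∈ H, h 0 0 * h 1 1 = 1 := fun h hh => by
    have := SL2_det h; rwa [hH h hh, mul_zero, sub_zero] at this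
  by_cases hall : ∀ D ∈ H, D 0 0 ^ 2 = 1
  -- All diagonals are `±(1, 1)`, and such triangular matrices commute.
  · have h11 : ∀ h ∈ H, h 1 1 = h 0 0 := fun h hh => by
      have h1 := hdiag h hh
      have h2 := hall h hh
      have h3 : h 0 0 ≠ 0 := left_ne_zero_of_mul_eq_one h1
      exact mul_left_cancel₀ h3 (h1.trans (h2.symm.trans (sq _)))
    have hBC : ∀ i j, (B * C) i j = (C * B) i j := by
      intro i j
      fin_cases i <;> fin_cases j <;>
        simp [SL2_mul_apply, hH B hB, hH C hC, h11 B hB, h11 C hC] <;> ring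
    exact SL2_ext (hBC _ _) (hBC _ _) (hBC _ _) (hBC _ _)
  push Not at hall
  obtain ⟨D, hD, hD1⟩ : ∃ D ∈ H, D 0 0 ^ 2 < 1 := by
    obtain ⟨D, hD, hD1⟩ := hall
    rcases lt_or_gt_of_ne hD1 with h | h
    · exact ⟨D, hD, h⟩
    · refine ⟨D⁻¹, H.inv_mem hD, ?_⟩
      rw [(SL2_inv_apply D).1]
      have h1 := hdiag D hD
      have h2 : D 0 0 ^ 2 * D 1 1 ^ 2 = 1 := by rw [← mul_pow, h1, one_pow]
      by_contra h3
      nlinarith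
  -- The commutator is unipotent. Conjugating it by powers of the contracting element `D` multiplies
  -- its off-diagonal entry by powers of `D 0 0 ^ 2 < 1`; unless that entry is zero, this yields
  -- infinitely many elements of `H` in a compact set.
  let U := B * C * B⁻¹ * C⁻¹
  have hU : U ∈ H := H.mul_mem (H.mul_mem (H.mul_mem hB hC) (H.inv_mem hB)) (H.inv_mem hC)
  obtain ⟨eB0, eB1, eB2, eB3⟩ := SL2_inv_apply B
  obtain ⟨eC0, eC1, eC2, eC3⟩ := SL2_inv_apply C
  have hU00 : U 0 0 = 1 := by
    simp only [U, SL2_mul_apply, eB0, eB1, eB2, eB3, eC0, eC2, hH B hB, hH C hC]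
    linear_combination C 0 0 * C 1 1 * hdiag B hB + hdiag C hC
  have hU11 : U 1 1 = 1 := by have := hdiag U hU; rwa [hU00, one_mul] at this
  have hpow : ∀ n : ℕ, (D ^ n * U * (D ^ n)⁻¹) 0 0 = 1 ∧ (D ^ n * U * (D ^ n)⁻¹) 1 1 = 1 ∧
      (D ^ n * U * (D ^ n)⁻¹) 1 0 = 0 ∧
      (D ^ n * U * (D ^ n)⁻¹) 0 1 = (D 0 0 ^ 2) ^ n * U 0 1 := by
    intro n
    induction n with
    | zero => simp [hU00, hU11, hH U hU]
    | succ n ih =>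
      have e : D ^ (n + 1) * U * (D ^ (n + 1))⁻¹ = D * (D ^ n * U * (D ^ n)⁻¹) * D⁻¹ := by
        rw [pow_succ']; group
      obtain ⟨i0, i1, i2, i3⟩ := ih
      obtain ⟨eD0, eD1, eD2, eD3⟩ := SL2_inv_apply D
      rw [e]
      generalize D ^ n * U * (D ^ n)⁻¹ = V at i0 i1 i2 i3
      have hd := hdiag D hD
      simp only [SL2_mul_apply, eD0, eD1, eD2, eD3, i0, i1, i2, i3, hH D hD]
      refine ⟨by linear_combination hd, by linear_combination hd, by ring, by ring⟩
  let ψ : ℝ → SL(2, ℝ) := fun v => ⟨!![1, v; 0, 1], by simp [Matrix.det_fin_two]⟩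
  have hψ : Continuous ψ := by
    refine Continuous.subtype_mk ?_ _
    fun_prop
  have hK : IsCompact (ψ '' Set.Icc (-|U 0 1|) |U 0 1|) := isCompact_Icc.image hψ
  have hmem : ∀ n : ℕ, D ^ n * U * (D ^ n)⁻¹ ∈ ψ '' Set.Icc (-|U 0 1|) |U 0 1| ∩ (H : Set _) := by
    intro n
    refine ⟨⟨(D 0 0 ^ 2) ^ n * U 0 1, ?_, ?_⟩, H.mul_mem (H.mul_mem (H.pow_mem hD n) hU)
      (H.inv_mem (H.pow_mem hD n))⟩
    · refine Set.mem_Icc.2 (abs_le.1 ?_)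
      rw [abs_mul]
      refine mul_le_of_le_one_left (abs_nonneg _) ?_
      rw [abs_of_nonneg (by positivity)]
      exact pow_le_one₀ (by positivity) hD1.le
    · obtain ⟨h0, h1, h2, h3⟩ := hpow n
      exact SL2_ext (by simp [ψ, h0]) (by simp [ψ, h3]) (by simp [ψ, h2]) (by simp [ψ, h1])
  have hU01 : U 0 1 = 0 := by
    by_contra hne
    have hinj : Function.Injective fun n : ℕ => D ^ n * U * (D ^ n)⁻¹ := by
      intro n m hnm
      have h1 : (D ^ n * U * (D ^ n)⁻¹) 0 1 = (D ^ m * U * (D ^ m)⁻¹) 0 1 := by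
        simp only at hnm; rw [hnm]
      rw [(hpow n).2.2.2, (hpow m).2.2.2] at h1
      have hpos : 0 < D 0 0 ^ 2 := by
        have := left_ne_zero_of_mul_eq_one (hdiag D hD)
        positivity
      exact (pow_right_strictAnti₀ hpos hD1).injective (mul_right_cancel₀ hne h1)
    refine Set.infinite_range_of_injective hinj ((hfin _ hK).subset ?_)
    rintro _ ⟨n, rfl⟩
    exact hmem n
  have hU1 : U = 1 := SL2_ext (by simp [hU00]) (by simp [hU01]) (by simp [hH U hU]) (by simp [hU11])
  have : B * C * B⁻¹ * C⁻¹ = 1 := hU1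
  calc B * C = (B * C * B⁻¹ * C⁻¹) * (C * B) := by group
    _ = C * B := by rw [this, one_mul]

/-- In a noncommutative torsion-free locally finite group with an element `A` fixing infinity,
the orbit of infinity contains four distinct finite points, in increasing order. -/
lemma exists_strictMono_orbit {H : Subgroup SL(2, ℝ)}
    (hfin : ∀ K : Set SL(2, ℝ), IsCompact K → (K ∩ H).Finite)
    (htf : ∀ h ∈ H, h ^ 2 = -1 → h = 1 ∨ h = -1)
    (hnc : ∃ B ∈ H, ∃ C ∈ H, B * C ≠ C * B)
    {A : SL(2, ℝ)} (hAH : A ∈ H) (hA : A 1 0 = 0) (hA1 : A ≠ 1) (hA2 : A ≠ -1) :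
    ∃ h : Fin 4 → SL(2, ℝ), (∀ k, h k ∈ H) ∧ (∀ k, h k 1 0 ≠ 0) ∧
      StrictMono fun k => h k 0 0 / h k 1 0 := by
  have hdet := SL2_det A
  rw [hA, mul_zero, sub_zero] at hdet
  have ha0 : A 0 0 ≠ 0 := left_ne_zero_of_mul_eq_one hdet
  have hd0 : A 1 1 ≠ 0 := right_ne_zero_of_mul_eq_one hdet
  -- The affine action of `A` on the finite boundary points. As `A ≠ ±1`, it has at most one fixed
  -- point.
  let f : ℝ → ℝ := fun x => A 0 0 ^ 2 * x + A 0 0 * A 0 1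
  have hf2 : ∀ x y, f x = x → f y = y → x = y := by
    intro x y hx hy
    by_contra hne
    simp only [f] at hx hy
    have h1 : (A 0 0 ^ 2 - 1) * (x - y) = 0 := by linear_combination hx - hy
    have h2 : A 0 0 ^ 2 = 1 :=
      sub_eq_zero.1 ((mul_eq_zero.1 h1).resolve_right (sub_ne_zero.2 hne))
    have h3 : A 0 1 = 0 := by
      have : A 0 0 * A 0 1 = 0 := by linear_combination hx - x * h2
      exact (mul_eq_zero.1 this).resolve_left ha0
    rcases mul_self_eq_one_iff.1 ((sq _).symm.trans h2) with h4 | h4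
    · refine hA1 (SL2_ext (by simp [h4]) (by simp [h3]) (by simp [hA]) ?_)
      rw [h4] at hdet; simpa using hdet
    · refine hA2 (SL2_ext (by simp [h4]) (by simp [h3]) (by simp [hA]) ?_)
      rw [h4] at hdet; simp; linarith
  obtain ⟨B, hB, hB0, hBf⟩ : ∃ B ∈ H, B 1 0 ≠ 0 ∧ f (B 0 0 / B 1 0) ≠ B 0 0 / B 1 0 := by
    obtain ⟨B, hB, hB0⟩ : ∃ B ∈ H, B 1 0 ≠ 0 := by
      by_contra! hall
      obtain ⟨B, hB, C, hC, hne⟩ := hnc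
      exact hne (commute_of_forall_lower_eq_zero hfin hall hB hC)
    by_cases hBf : f (B 0 0 / B 1 0) = B 0 0 / B 1 0
    · have hBdet := SL2_det B
      -- If `B` sends ∞ to the fixed point of `f`, then `B * B` is used instead. Nonzero trace keeps
      -- its image of ∞ finite, and that image differs from the one under `B`. Zero trace would give
      -- `B ^ 2 = -1`, which is excluded.
      have htr : B 0 0 + B 1 1 ≠ 0 := by
        intro h
        have h11 : B 1 1 = -B 0 0 := by linarith
        rw [h11] at hBdet
        have hsq : B ^ 2 = -1 := by
          rw [sq]
          refine SL2_ext ?_ ?_ ?_ ?_ <;> rw [SL2_mul_apply] <;> simp [h11] <;>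
            first | ring1 | linear_combination -hBdet
        rcases htf B hB hsq with rfl | rfl <;> simp at hB0
      have e10 : (B * B) 1 0 = B 1 0 * (B 0 0 + B 1 1) := by rw [SL2_mul_apply]; ring
      have e00 : (B * B) 0 0 = B 0 0 * (B 0 0 + B 1 1) - 1 := by
        rw [SL2_mul_apply]; linear_combination -hBdet
      refine ⟨B * B, H.mul_mem hB hB, by rw [e10]; exact mul_ne_zero hB0 htr, fun h => ?_⟩
      have := hf2 _ _ h hBf
      rw [e10, e00, div_eq_div_iff (mul_ne_zero hB0 htr) hB0] at this
      exact hB0 (by linear_combination -this)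
    · exact ⟨B, hB, hB0, hBf⟩
  obtain ⟨h, hh0, hH, hs⟩ : ∃ h : ℕ → SL(2, ℝ), h 0 = B ∧ (∀ k, h k ∈ H) ∧
      ∀ k, h (k + 1) = A * h k :=
    ⟨fun k => A ^ k * B, by simp, fun k => H.mul_mem (H.pow_mem hAH k) hB,
      fun k => by simp only [pow_succ', mul_assoc]⟩
  have hc : ∀ k, h k 1 0 ≠ 0 := by
    intro k
    induction k with
    | zero => rwa [hh0]
    | succ k ih => rw [hs, SL2_mul_apply, hA, zero_mul, zero_add]; exact mul_ne_zero hd0 ih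
  let ξ : ℕ → ℝ := fun k => h k 0 0 / h k 1 0
  have hξ : ∀ k, ξ (k + 1) = f (ξ k) := by
    intro k
    have h1 := hc k
    simp only [ξ, f]
    rw [hs, SL2_mul_apply, SL2_mul_apply, hA, zero_mul, zero_add,
      div_eq_iff (mul_ne_zero hd0 h1)]
    field_simp
    linear_combination (-A 0 0 * (h k) 0 0 - A 0 1 * h k 1 0) * hdet
  have hξ0 : ξ 0 = B 0 0 / B 1 0 := by simp [ξ, hh0]
  -- Successive differences all have the sign of the first one, so the orbit under `A` is strictly
  -- monotone.
  have hdiff : ∀ k, ξ (k + 1) - ξ k = (A 0 0 ^ 2) ^ k * (ξ 1 - ξ 0) := by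
    intro k
    induction k with
    | zero => simp
    | succ k ih =>
      rw [hξ (k + 1), hξ k] at *
      simp only [f] at *
      rw [pow_succ']
      linear_combination A 0 0 ^ 2 * ih
  have hpos : ∀ k, 0 < (A 0 0 ^ 2) ^ k := fun k => by positivity
  rcases lt_or_gt_of_ne (show ξ 1 ≠ ξ 0 by rw [hξ 0, hξ0]; exact hBf) with hlt | hgt
  · have hanti : StrictAnti ξ := strictAnti_nat_of_succ_lt fun k => by
      have := mul_neg_of_pos_of_neg (hpos k) (sub_neg.2 hlt)
      linarith [hdiff k]
    -- A decreasing orbit is listed backwards.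
    refine ⟨fun k => h (Fin.rev k), fun k => hH _, fun k => hc _, fun i j hij => ?_⟩
    exact hanti (Fin.rev_lt_rev.2 hij)
  · have hmono : StrictMono ξ := strictMono_nat_of_lt_succ fun k => by
      have := mul_pos (hpos k) (sub_pos.2 hgt)
      linarith [hdiff k]
    exact ⟨fun k => h k, fun k => hH _, fun k => hc _, fun i j hij => hmono hij⟩

/-! ### Powers of normalizing elements -/

/-- The orbit of a point is path-connected inside a suitable neighbourhood of the orbit. -/
lemma joinedIn_orbit_neighbourhood {H : Subgroup SL(2, ℝ)} {S : Set SL(2, ℝ)}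
    (hS : Subgroup.closure S = H) {z : ℍ} {R : ℝ} (hR : ∀ s ∈ S, dist (s • z) z ≤ R)
    {h : SL(2, ℝ)} (hh : h ∈ H) :
    JoinedIn {w : ℍ | ∃ k ∈ H, dist w (k • z) ≤ R ∨ w = k • z} z (h • z) := by
  subst hS
  set T := {w : ℍ | ∃ k ∈ Subgroup.closure S, dist w (k • z) ≤ R ∨ w = k • z}
  have hT : ∀ k ∈ Subgroup.closure S, ∀ {a b : ℍ}, JoinedIn T a b → JoinedIn T (k • a) (k • b) := by
    intro k hk a b hab
    refine (hab.map (continuous_const_smul k)).mono ?_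
    rintro _ ⟨w, ⟨l, hl, hw⟩, rfl⟩
    refine ⟨k * l, Subgroup.mul_mem _ hk hl, ?_⟩
    simp only [mul_smul, dist_smul]
    exact hw.imp id fun h => by rw [h]
  induction hh using Subgroup.closure_induction with
  | mem s hs =>
    -- A hyperbolic ball is a Euclidean disc, hence convex in `ℂ`.
    have hball : IsPathConnected (Metric.closedBall z R) := by
      rw [UpperHalfPlane.isEmbedding_coe.isInducing.isPathConnected_iff,
        UpperHalfPlane.image_coe_closedBall]
      refine (convex_closedBall _ _).isPathConnected ?_
      rw [← UpperHalfPlane.image_coe_closedBall]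
      exact ⟨_, s • z, hR s hs, rfl⟩
    refine (hball.joinedIn z ?_ (s • z) (hR s hs)).mono fun w hw => ?_
    · exact Metric.mem_closedBall_self (dist_nonneg.trans (hR s hs))
    · exact ⟨1, Subgroup.one_mem _, .inl (by simpa using hw)⟩
  -- For empty `S` nothing makes `R` nonnegative; the alternative `w = k • z` keeps the orbit in the
  -- set all the same.
  | one => rw [one_smul]; exact JoinedIn.refl ⟨1, Subgroup.one_mem _, .inr (one_smul _ _).symm⟩
  | mul x y hx hy ihx ihy => rw [mul_smul]; exact ihx.trans (hT x hx ihy)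
  | inv x hx ih => simpa using (hT x⁻¹ (Subgroup.inv_mem _ hx) ih).symm

/-- The core of the argument, normalized so that `A` fixes ∞ and does not contract there. Linked
curves force the translates `t ^ n • T` to meet `T`, and finiteness of `H` on compact sets turns
this into a coincidence between two powers of `t` modulo `H`. -/
lemma exists_pow_mem_of_normalizes_of_lower_eq_zero {H : Subgroup SL(2, ℝ)}
    (hfin : ∀ K : Set SL(2, ℝ), IsCompact K → (K ∩ H).Finite) (hfg : H.FG) (hneg : -1 ∈ H)
    (htf : ∀ h ∈ H, h ^ 2 = -1 → h = 1 ∨ h = -1)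
    (hnc : ∃ B ∈ H, ∃ C ∈ H, B * C ≠ C * B)
    {A : SL(2, ℝ)} (hAH : A ∈ H) (hA : A 1 0 = 0) (hA1 : A ≠ 1) (hA2 : A ≠ -1)
    (ha : 1 ≤ A 0 0 ^ 2) {t : SL(2, ℝ)} (ht : ∀ h, h ∈ H ↔ t * h * t⁻¹ ∈ H) :
    ∃ n : ℕ, 1 ≤ n ∧ t ^ n ∈ H := by
  obtain ⟨S, hS, hSf⟩ := (Subgroup.fg_iff H).1 hfg
  obtain ⟨h, hh, hc, hmono⟩ := exists_strictMono_orbit hfin htf hnc hAH hA hA1 hA2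
  have htn : ∀ (n : ℕ) h, h ∈ H ↔ t ^ n * h * (t ^ n)⁻¹ ∈ H := by
    intro n
    induction n with
    | zero => simp
    | succ n ih =>
      intro h
      rw [ih h, ht, pow_succ']
      simp only [mul_inv_rev, mul_assoc]
  have htn' : ∀ (n : ℕ) h, h ∈ H → (t ^ n)⁻¹ * h * t ^ n ∈ H := by
    intro n h hh
    rw [htn n]; convert hh using 1; group
  let z : ℍ := UpperHalfPlane.I
  obtain ⟨R, hR0, hR⟩ : ∃ R, 0 ≤ R ∧ ∀ s ∈ S, dist (s • z) z ≤ R := by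
    obtain ⟨R, hR⟩ := (hSf.image fun s => dist (s • z) z).bddAbove
    exact ⟨max R 0, le_max_right _ _, fun s hs => (hR ⟨s, hs, rfl⟩).trans (le_max_left _ _)⟩
  let T : Set ℍ := {w : ℍ | ∃ k ∈ H, dist w (k • z) ≤ R ∨ w = k • z}
  have hTinv : ∀ k ∈ H, ∀ w ∈ T, k • w ∈ T := by
    rintro k hk w ⟨l, hl, hw⟩
    refine ⟨k * l, H.mul_mem hk hl, ?_⟩
    simp only [mul_smul, dist_smul]
    exact hw.imp id fun h => by rw [h]
  have hTj : ∀ k ∈ H, JoinedIn T z (k • z) := fun k hk => joinedIn_orbit_neighbourhood hS hR hk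
  have hTR : ∀ w ∈ T, ∃ k ∈ H, dist w (k • z) ≤ R := by
    rintro w ⟨k, hk, hw | rfl⟩
    · exact ⟨k, hk, hw⟩
    · exact ⟨k, hk, by simpa using hR0⟩
  have hg : ∀ n : ℕ, ∃ k ∈ H, ∃ l ∈ H, dist ((k⁻¹ * t ^ n * l) • z) z ≤ 2 * R := by
    intro n
    -- The translate `t ^ n • T` is again `H`-invariant because `t ^ n` normalizes `H`.
    obtain ⟨w, hw, v, hv, hvw⟩ := inter_nonempty_of_linked hTinv hTj
      (T' := (t ^ n • ·) '' T) (z' := t ^ n • z)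
      (by
        rintro k hk _ ⟨w, hw, rfl⟩
        refine ⟨((t ^ n)⁻¹ * k * t ^ n) • w, hTinv _ (htn' n k hk) w hw, ?_⟩
        simp only [← mul_smul]
        congr 1; group)
      (by
        intro k hk
        have := (hTj _ (htn' n k hk)).map (continuous_const_smul (t ^ n))
        convert this using 1
        simp only [← mul_smul]
        congr 1; group)
      hAH hA hA1 hA2 ha hh hc hmono
    obtain ⟨k, hk, hkw⟩ := hTR w hw
    obtain ⟨l, hl, hlv⟩ := hTR v hv
    refine ⟨k, hk, l, hl, ?_⟩
    have e : (k⁻¹ * t ^ n * l) • z = k⁻¹ • t ^ n • l • z := by simp only [mul_smul]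
    rw [e, ← dist_smul k, smul_inv_smul]
    have h1 : dist (t ^ n • l • z) (t ^ n • v) ≤ R := by rw [dist_smul, dist_comm]; exact hlv
    have hvw' : t ^ n • v = w := hvw
    rw [hvw'] at h1
    linarith [dist_triangle (t ^ n • l • z) w (k • z)]
  choose k hk l hl hkl using hg
  let g : ℕ → SL(2, ℝ) := fun n => (k n)⁻¹ * t ^ n * l n
  have hgH : ∀ n, ∀ s ∈ H, g n * s * (g n)⁻¹ ∈ H := by
    intro n s hs
    have e : g n * s * (g n)⁻¹ = (k n)⁻¹ * (t ^ n * (l n * s * (l n)⁻¹) * (t ^ n)⁻¹) * k n := by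
      simp only [g]; group
    rw [e]
    exact H.mul_mem (H.mul_mem (H.inv_mem (hk n)) ((htn n _).1
      (H.mul_mem (H.mul_mem (hl n) hs) (H.inv_mem (hl n))))) (hk n)
  have hSH : ∀ s ∈ S, s ∈ H := fun s hs => hS ▸ Subgroup.subset_closure hs
  -- The radius is `2R + R + 2R`: both `g n` and its inverse move `z` by at most `2R`, and a
  -- generator by at most `R`.
  have hfinite : {x : SL(2, ℝ) | dist (x • z) z ≤ 5 * R ∧ x ∈ H}.Finite :=
    (hfin _ (isCompact_setOf_dist_smul_le z z (5 * R)))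
  obtain ⟨n, m, hnm, heq⟩ : ∃ n m : ℕ, n < m ∧ ∀ s ∈ S, g n * s * (g n)⁻¹ = g m * s * (g m)⁻¹ := by
    have : Finite S := hSf
    have hpi : (Set.pi Set.univ fun _ : S =>
      {x : SL(2, ℝ) | dist (x • z) z ≤ 5 * R ∧ x ∈ H}).Finite := Set.Finite.pi fun _ => hfinite
    let F : ℕ → S → SL(2, ℝ) := fun n s => g n * s * (g n)⁻¹
    have hF : ¬ Function.Injective F := by
      intro hinj
      refine Set.infinite_range_of_injective hinj (hpi.subset ?_)
      rintro _ ⟨n, rfl⟩ ⟨s, hs⟩ -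
      refine ⟨?_, hgH n s (hSH s hs)⟩
      have h1 := hkl n
      have h2 : dist ((g n)⁻¹ • z) z ≤ 2 * R := by
        rw [← dist_smul (g n), smul_inv_smul, dist_comm]; exact h1
      have h3 : dist ((g n * s * (g n)⁻¹) • z) (g n • s • z) ≤ 2 * R := by
        simp only [mul_smul, dist_smul]; exact h2
      have h4 : dist (g n • s • z) (g n • z) ≤ R := by rw [dist_smul]; exact hR s hs
      have h5 := dist_triangle4 ((g n * s * (g n)⁻¹) • z) (g n • s • z) (g n • z) z
      have h6 : dist (g n • z) z ≤ 2 * R := h1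
      simp only [F]
      linarith
    rw [Function.not_injective_iff] at hF
    obtain ⟨n, m, hFe, hne⟩ := hF
    rcases lt_or_gt_of_ne hne with h | h
    · exact ⟨n, m, h, fun s hs => congrFun hFe ⟨s, hs⟩⟩
    · exact ⟨m, n, h, fun s hs => (congrFun hFe ⟨s, hs⟩).symm⟩
  -- Since `g n` and `g m` conjugate every generator in the same way, `C` centralizes `H`.
  let C : SL(2, ℝ) := (g n)⁻¹ * g m
  have hCS : ∀ s ∈ H, s * C = C * s := by
    have h1 : H ≤ Subgroup.centralizer {C} := by
      rw [← hS, Subgroup.closure_le]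
      intro s hs
      rw [SetLike.mem_coe, Subgroup.mem_centralizer_iff]
      rintro _ rfl
      have := heq s hs
      simp only [C]
      calc (g n)⁻¹ * g m * s = (g n)⁻¹ * (g m * s * (g m)⁻¹) * g m := by group
        _ = (g n)⁻¹ * (g n * s * (g n)⁻¹) * g m := by rw [this]
        _ = s * ((g n)⁻¹ * g m) := by group
    intro s hs
    exact ((Subgroup.mem_centralizer_iff.1 (h1 hs)) C rfl).symm
  -- Commuting with `A` and with its conjugates by `h j`, the matrix `C` fixes ∞ and the points `h
  -- j` sends it to; three of these already force `C = ±1`.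
  have hC10 : C 1 0 = 0 := SL2_lower_eq_zero_of_commute hA hA1 hA2 (hCS A hAH)
  have hCk : ∀ j, ((h j)⁻¹ * C * h j) 1 0 = 0 := by
    intro j
    refine SL2_lower_eq_zero_of_commute hA hA1 hA2 ?_
    have := hCS (h j * A * (h j)⁻¹) (H.mul_mem (H.mul_mem (hh j) hAH) (H.inv_mem (hh j)))
    calc A * ((h j)⁻¹ * C * h j) = (h j)⁻¹ * (h j * A * (h j)⁻¹ * C) * h j := by group
      _ = (h j)⁻¹ * (C * (h j * A * (h j)⁻¹)) * h j := by rw [this]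
      _ = (h j)⁻¹ * C * h j * A := by group
  have hC1 : C ∈ H := by
    rcases SL2_eq_one_or_neg_one_of_fixes hC10 (hCk 0) (hCk 1) (hc 0) (hc 1)
      (hmono (by decide : (0 : Fin 4) < 1)).ne with h | h <;> rw [h]
    · exact H.one_mem
    · exact hneg
  refine ⟨m - n, by omega, ?_⟩
  have e1 : t ^ m = t ^ n * t ^ (m - n) := by rw [← pow_add]; congr 1; omega
  have e2 : t ^ (m - n) =
      ((t ^ n)⁻¹ * (k m * (k n)⁻¹) * t ^ n) * (l n * C * (l m)⁻¹) := by
    have : t ^ (m - n) = (t ^ n)⁻¹ * t ^ m := by rw [e1]; group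
    rw [this]
    simp only [C, g]
    group
  rw [e2]
  exact H.mul_mem (htn' n _ (H.mul_mem (hk m) (H.inv_mem (hk n))))
    (H.mul_mem (H.mul_mem (hl n) hC1) (H.inv_mem (hl m)))

/-- A finitely generated, noncommutative, torsion-free and locally finite subgroup of `SL(2, ℝ)`
contains a positive power of each element of its normalizer. -/
theorem exists_pow_mem_of_normalizes {H : Subgroup SL(2, ℝ)}
    (hfin : ∀ K : Set SL(2, ℝ), IsCompact K → (K ∩ H).Finite) (hfg : H.FG) (hneg : -1 ∈ H)
    (htf : ∀ h ∈ H, ∀ n : ℕ, 1 ≤ n → (h ^ n = 1 ∨ h ^ n = -1) → h = 1 ∨ h = -1)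
    (hnc : ∃ B ∈ H, ∃ C ∈ H, B * C ≠ C * B)
    {t : SL(2, ℝ)} (ht : ∀ h, h ∈ H ↔ t * h * t⁻¹ ∈ H) :
    ∃ n : ℕ, 1 ≤ n ∧ t ^ n ∈ H := by
  obtain ⟨A, hA, hA1, hA2⟩ : ∃ A ∈ H, A ≠ 1 ∧ A ≠ -1 := by
    obtain ⟨B, hB, C, hC, hne⟩ := hnc
    refine ⟨B, hB, ?_, ?_⟩ <;> rintro rfl <;> simp at hne
  obtain ⟨P, hP⟩ := exists_conj_lower_eq_zero hfin hA fun n hn h1 =>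
    (htf A hA n hn (.inl h1)).elim hA1 hA2
  -- Conjugation by `P⁻¹` moves the boundary fixed point of `A` to ∞.
  let e : SL(2, ℝ) ≃* SL(2, ℝ) := MulAut.conj P⁻¹
  have he : ∀ x, e x = P⁻¹ * x * P := fun x => by simp [e]
  have he1 : e (-1) = -1 := by rw [he]; simp
  let H' : Subgroup SL(2, ℝ) := H.map e.toMonoidHom
  have hmem : ∀ x, e x ∈ H' ↔ x ∈ H := fun x => by
    simp only [H']
    exact Subgroup.mem_map_iff_mem (f := e.toMonoidHom) e.injective
  have hmem' : ∀ y ∈ H', ∃ x ∈ H, e x = y := fun y hy => hy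
  have main : ∀ A' ∈ H', A' 1 0 = 0 → A' ≠ 1 → A' ≠ -1 → 1 ≤ A' 0 0 ^ 2 →
      ∃ n : ℕ, 1 ≤ n ∧ t ^ n ∈ H := by
    intro A' hA' h0 h1 h2 h3
    obtain ⟨n, hn, hmemn⟩ := exists_pow_mem_of_normalizes_of_lower_eq_zero (H := H') (t := e t)
      (fun K hK => by
        have hcont : Continuous fun x : SL(2, ℝ) => P * x * P⁻¹ := by fun_prop
        refine ((hfin _ (hK.image hcont)).image e).subset ?_
        rintro y ⟨hyK, hy⟩
        obtain ⟨x, hx, rfl⟩ := hmem' y hy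
        refine ⟨x, ⟨⟨e x, hyK, ?_⟩, hx⟩, rfl⟩
        rw [he]; group)
      (by
        obtain ⟨S, hS, hSf⟩ := (Subgroup.fg_iff H).1 hfg
        refine (Subgroup.fg_iff H').2 ⟨e.toMonoidHom '' S, ?_, hSf.image _⟩
        rw [← MonoidHom.map_closure, hS])
      (by rw [← he1]; exact (hmem _).2 hneg)
      (by
        intro y hy hy2
        obtain ⟨x, hx, rfl⟩ := hmem' y hy
        have : x ^ 2 = -1 := e.injective (by rw [map_pow, hy2, he1])
        refine (htf x hx 2 (by norm_num) (.inr this)).imp ?_ ?_ <;> rintro rfl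
        · exact map_one e
        · exact he1)
      (by
        obtain ⟨B, hB, C, hC, hne⟩ := hnc
        refine ⟨e B, (hmem _).2 hB, e C, (hmem _).2 hC, fun h => hne (e.injective ?_)⟩
        rw [map_mul, map_mul, h])
      hA' h0 h1 h2 h3
      (by
        intro y
        obtain ⟨x, rfl⟩ := e.surjective y
        rw [hmem, ht, ← hmem]; simp only [map_mul, map_inv])
    exact ⟨n, hn, (hmem _).1 (by rwa [map_pow])⟩
  have h0 : e A 1 0 = 0 := by rw [he]; exact hP
  have h1 : e A ≠ 1 := fun h => hA1 (e.injective (by rw [h, map_one]))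
  have h2 : e A ≠ -1 := fun h => hA2 (e.injective (by rw [h, he1]))
  -- The squared diagonal entries are mutually inverse, so `e A` or its inverse does not contract at
  -- ∞.
  by_cases h3 : 1 ≤ e A 0 0 ^ 2
  · exact main (e A) ((hmem _).2 hA) h0 h1 h2 h3
  · obtain ⟨e0, -, e2, -⟩ := SL2_inv_apply (e A)
    refine main (e A)⁻¹ (H'.inv_mem ((hmem _).2 hA)) ?_ ?_ ?_ ?_
    · rw [e2, h0, neg_zero]
    · simpa using h1
    · intro h; apply h2; rw [← inv_inv (e A), h]; simp [inv_neg]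
    · rw [e0]
      have hdet := SL2_det (e A)
      rw [h0, mul_zero, sub_zero] at hdet
      have : e A 0 0 ^ 2 * e A 1 1 ^ 2 = 1 := by rw [← mul_pow, hdet, one_pow]
      by_contra h4
      nlinarith [sq_nonneg (e A 0 0), sq_nonneg (e A 1 1)]

/-! ### Passage to PSL(2, ℝ) -/

lemma SL2_mem_center_iff {A : SL(2, ℝ)} :
    A ∈ Subgroup.center SL(2, ℝ) ↔ A = 1 ∨ A = -1 := by
  constructor
  · intro h
    obtain ⟨r, hr, hA⟩ := Matrix.SpecialLinearGroup.mem_center_iff.1 h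
    rw [Fintype.card_fin] at hr
    rcases mul_self_eq_one_iff.1 ((sq r).symm.trans hr) with rfl | rfl
    · left; ext i j; rw [← hA]; simp
    · right; ext i j; rw [← hA]; simp [Matrix.one_apply, Matrix.diagonal_apply]; split_ifs <;> simp
  · rintro (rfl | rfl)
    · exact Subgroup.one_mem _
    · rw [Subgroup.mem_center_iff]; intro g; simp

lemma SL2_finite_center : (Subgroup.center SL(2, ℝ) : Set SL(2, ℝ)).Finite :=
  (Set.toFinite {1, -1}).subset fun A hA => by
    simpa using SL2_mem_center_iff.1 hA

/-- A finitely generated, discrete, torsion-free and noncommutative subgroup of `PSL(2, ℝ)`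
contains a positive power of each element of its normalizer. -/
theorem PSL2_exists_pow_mem_of_normalizes (Γ : Subgroup PSL(2, ℝ)) [DiscreteTopology Γ]
    (hfg : Γ.FG) (htf : ∀ h ∈ Γ, h ≠ 1 → ¬ IsOfFinOrder h)
    (hnc : ∃ B ∈ Γ, ∃ C ∈ Γ, B * C ≠ C * B) {t : PSL(2, ℝ)}
    (ht : ∀ h, h ∈ Γ ↔ t * h * t⁻¹ ∈ Γ) : ∃ n : ℕ, 1 ≤ n ∧ t ^ n ∈ Γ := by
  let q : SL(2, ℝ) →* PSL(2, ℝ) := QuotientGroup.mk' (Subgroup.center SL(2, ℝ))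
  have hq : Function.Surjective q := QuotientGroup.mk'_surjective _
  have hq1 : ∀ x, q x = 1 ↔ x = 1 ∨ x = -1 := fun x => by
    rw [← SL2_mem_center_iff]; exact QuotientGroup.eq_one_iff x
  have hclosed : IsClosed (Subgroup.center SL(2, ℝ) : Set SL(2, ℝ)) := SL2_finite_center.isClosed
  have hqc : Continuous q := QuotientGroup.continuous_mk
  have hΓ : IsClosed (Γ : Set PSL(2, ℝ)) := Subgroup.isClosed_of_discrete
  -- The full preimage contains `-1`. It meets compact sets in finite sets, since `Γ` is discrete
  -- and closed and the fibres of `q` are pairs `{x, -x}`. Lifts of generators together with `-1`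
  -- generate it.
  let H : Subgroup SL(2, ℝ) := Γ.comap q
  obtain ⟨s, rfl⟩ := hq t
  obtain ⟨n, hn, hmem⟩ := exists_pow_mem_of_normalizes (H := H) (t := s)
    (by
      intro K hK
      have h1 : (q '' K ∩ Γ).Finite := by
        have hcomp : IsCompact (q '' K ∩ Γ) := (hK.image hqc).inter_right hΓ
        refine hcomp.finite ?_
        exact (isDiscrete_iff_discreteTopology.2 ‹DiscreteTopology Γ›).mono Set.inter_subset_right
      have hsub : K ∩ H ⊆ q ⁻¹' (q '' K ∩ Γ) := fun x hx => ⟨⟨x, hx.1, rfl⟩, hx.2⟩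
      refine (h1.preimage' fun b _ => ?_).subset hsub
      obtain ⟨x, rfl⟩ := hq b
      refine (Set.toFinite {x, -x}).subset fun y hy => ?_
      have h2 : q (x⁻¹ * y) = 1 := by
        have : q y = q x := hy
        rw [map_mul, map_inv, this, inv_mul_cancel]
      rcases (hq1 _).1 h2 with h | h
      · left; exact (inv_mul_eq_one.1 h).symm
      · right; rw [inv_mul_eq_iff_eq_mul] at h; simpa using h)
    (by
      obtain ⟨S, hS, hSf⟩ := (Subgroup.fg_iff Γ).1 hfg
      refine (Subgroup.fg_iff H).2 ⟨Function.surjInv hq '' S ∪ {-1}, ?_,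
        (hSf.image _).union (Set.toFinite _)⟩
      have himg : q '' (Function.surjInv hq '' S) = S := by
        rw [← Set.image_comp]
        simp [Function.surjInv_eq hq]
      apply le_antisymm
      · rw [Subgroup.closure_le]
        rintro _ (⟨x, hx, rfl⟩ | rfl)
        · change q _ ∈ Γ
          rw [Function.surjInv_eq hq, ← hS]; exact Subgroup.subset_closure hx
        · change q _ ∈ Γ
          rw [(hq1 _).2 (.inr rfl)]; exact Γ.one_mem
      · intro x hx
        have hx' : q x ∈ Γ := hx
        rw [← hS, ← himg, ← MonoidHom.map_closure] at hx'
        obtain ⟨y, hy, hyx⟩ := hx'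
        have hy' : y ∈ Subgroup.closure (Function.surjInv hq '' S ∪ {-1}) :=
          Subgroup.closure_mono Set.subset_union_left hy
        have h2 : q (y⁻¹ * x) = 1 := by rw [map_mul, map_inv, hyx, inv_mul_cancel]
        have h3 : y⁻¹ * x ∈ Subgroup.closure (Function.surjInv hq '' S ∪ {-1}) := by
          rcases (hq1 _).1 h2 with h | h <;> rw [h]
          · exact Subgroup.one_mem _
          · exact Subgroup.subset_closure (.inr rfl)
        simpa using Subgroup.mul_mem _ hy' h3)
    (by
      change q _ ∈ Γ
      rw [(hq1 _).2 (.inr rfl)]; exact Γ.one_mem)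
    (by
      intro h hh n hn hpow
      rw [← hq1] at hpow ⊢
      by_contra hne
      exact htf (q h) hh hne (isOfFinOrder_iff_pow_eq_one.2 ⟨n, hn, by rw [← map_pow, hpow]⟩))
    (by
      obtain ⟨B, hB, C, hC, hne⟩ := hnc
      obtain ⟨b, rfl⟩ := hq B
      obtain ⟨c, rfl⟩ := hq C
      exact ⟨b, hB, c, hC, fun h => hne (by rw [← map_mul, h, map_mul])⟩)
    (by
      intro h
      change q h ∈ Γ ↔ q _ ∈ Γ
      rw [ht, map_mul, map_mul, map_inv])
  exact ⟨n, hn, by rw [← map_pow]; exact hmem⟩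

/-! ### The infinite cyclic cover of a mapping torus -/

noncomputable section

section MappingTorusCover

variable {S : Type*} [TopologicalSpace S]

/-- The infinite cyclic cover `S × ℝ` of the mapping torus of `φ`. -/
def MappingTorusCover (_φ : S ≃ₜ S) : Type _ := S × ℝ

instance (φ : S ≃ₜ S) : TopologicalSpace (MappingTorusCover φ) :=
  inferInstanceAs (TopologicalSpace (S × ℝ))

/-- The exponent is negative because raising the height by one makes the projection apply one more
power of `φ`, which must be undone. -/
instance (φ : S ≃ₜ S) : MulAction (Multiplicative ℤ) (MappingTorusCover φ) where
  smul n e := ((φ ^ (-n.toAdd)) e.1, e.2 + n.toAdd)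
  one_smul e := by
    change ((φ ^ (-(0 : ℤ))) e.1, e.2 + ((0 : ℤ) : ℝ)) = e
    simp
    rfl
  mul_smul m n e := by
    change ((φ ^ (-(m.toAdd + n.toAdd))) e.1, e.2 + ((m.toAdd + n.toAdd : ℤ) : ℝ)) =
      ((φ ^ (-m.toAdd)) ((φ ^ (-n.toAdd)) e.1), e.2 + n.toAdd + m.toAdd)
    rw [neg_add, zpow_add]
    refine Prod.ext rfl ?_
    push_cast; ring

lemma MappingTorusCover.smul_def (φ : S ≃ₜ S) (n : Multiplicative ℤ) (e : MappingTorusCover φ) :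
    n • e = ((φ ^ (-n.toAdd)) e.1, e.2 + n.toAdd) := rfl

/-- The covering map `(x, r) ↦ [(φ^⌊r⌋ x, r - ⌊r⌋)]`. -/
def MappingTorusCover.proj (φ : S ≃ₜ S) (e : MappingTorusCover φ) : MappingTorus φ :=
  Quot.mk _ ((φ ^ ⌊e.2⌋) e.1, ⟨Int.fract e.2, Int.fract_nonneg _, (Int.fract_lt_one _).le⟩)

/-- Unlike the fractional part, the clamped coordinate is continuous on all of ℝ once the floor is
frozen, as gluing over closed slabs requires. -/
lemma MappingTorusCover.proj_eq (φ : S ≃ₜ S) (e : MappingTorusCover φ) :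
    proj φ e = Quot.mk _ ((φ ^ ⌊e.2⌋) e.1, Set.projIcc 0 1 zero_le_one (e.2 - ⌊e.2⌋)) := by
  rw [proj]
  congr 2
  exact (Set.projIcc_of_mem zero_le_one ⟨Int.fract_nonneg e.2, (Int.fract_lt_one _).le⟩).symm

lemma MappingTorusCover.continuous_proj (φ : S ≃ₜ S) : Continuous (proj φ) := by
  have h2 : Continuous fun e : MappingTorusCover φ => e.2 := continuous_snd
  have h1 : Continuous fun e : MappingTorusCover φ => e.1 := continuous_fst
  rw [show proj φ = fun e => _ from funext (proj_eq φ)]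
  refine continuous_floor_glue h2 (f := fun n e =>
    (Quot.mk _ ((φ ^ n) e.1, Set.projIcc 0 1 zero_le_one (e.2 - n)) : MappingTorus φ))
    (fun n => ?_) (fun n e he => ?_)
  · refine continuous_quot_mk.comp (Continuous.prodMk ((φ ^ n).continuous.comp h1) ?_)
    exact continuous_projIcc.comp (h2.sub continuous_const)
  · have e1 : Set.projIcc (0 : ℝ) 1 zero_le_one (e.2 - n) = 1 := by
      rw [he, add_sub_cancel_left]; exact Set.projIcc_right zero_le_one
    have e2 : Set.projIcc (0 : ℝ) 1 zero_le_one (e.2 - (n + 1 : ℤ)) = 0 := by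
      rw [he]; push_cast; rw [sub_self]; exact Set.projIcc_left zero_le_one
    rw [e1, e2, add_comm, zpow_add, zpow_one]
    exact Quot.sound (MappingTorusGluing.glue _)

/-- The inclusion of the zero level. -/
def MappingTorusCover.zeroSection (φ : S ≃ₜ S) : C(S, MappingTorusCover φ) :=
  ⟨fun x => ((x, 0) : S × ℝ), (by fun_prop : Continuous fun x : S => (x, (0 : ℝ)))⟩

lemma MappingTorusCover.proj_zeroSection (φ : S ≃ₜ S) (x : S) :
    proj φ (zeroSection φ x) = MappingTorus.fiber φ x := by
  have h : (zeroSection φ x).2 = 0 := rfl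
  have h' : (zeroSection φ x).1 = x := rfl
  rw [proj_eq, h, h', Int.floor_zero, Int.cast_zero, sub_zero, zpow_zero,
    Set.projIcc_left zero_le_one]
  rfl

/-- On `S × [0, 1]` the projection is the quotient map defining the mapping torus. -/
lemma MappingTorusCover.isQuotientMap_proj (φ : S ≃ₜ S) :
    Topology.IsQuotientMap (proj φ) := by
  let f : S × I → MappingTorusCover φ := fun x => (x.1, (x.2 : ℝ))
  have hf : Continuous f := by
    have : Continuous fun x : S × I => (x.1, (x.2 : ℝ)) := by fun_prop
    exact this
  refine Topology.IsQuotientMap.of_comp hf (continuous_proj φ) ?_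
  have : proj φ ∘ f = Quot.mk (MappingTorusGluing φ) := by
    ext ⟨x, s⟩
    rcases s.2.2.eq_or_lt with h | h
    · have hs : s = 1 := Subtype.ext h
      subst hs
      rw [Function.comp_apply, proj_eq]
      refine Eq.trans ?_ (Quot.sound (MappingTorusGluing.glue x)).symm
      simp [f]
      rfl
    · have hfl : ⌊(s : ℝ)⌋ = 0 := Int.floor_eq_zero_iff.2 ⟨s.2.1, h⟩
      rw [Function.comp_apply, proj_eq]
      simp [f, hfl]
      rfl
  rw [this]
  exact isQuotientMap_quot_mk

theorem MappingTorusCover.isQuotientCoveringMap_proj (φ : S ≃ₜ S) :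
    IsQuotientCoveringMap (proj φ) (Multiplicative ℤ) where
  toIsQuotientMap := isQuotientMap_proj φ
  continuous_const_smul n := by
    have : Continuous fun e : S × ℝ => ((φ ^ (-n.toAdd)) e.1, e.2 + (n.toAdd : ℝ)) := by
      refine Continuous.prodMk ((φ ^ (-n.toAdd)).continuous.comp continuous_fst) ?_
      fun_prop
    exact this
  apply_eq_iff_mem_orbit := by
    have hsmul : ∀ (n : Multiplicative ℤ) e, proj φ (n • e) = proj φ e := by
      intro n e
      rw [proj, proj, smul_def]
      congr 2
      · simp only [Int.floor_add_intCast]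
        rw [zpow_add]
        change (φ ^ ⌊e.2⌋ * (φ ^ n.toAdd * φ ^ (-n.toAdd))) e.1 = _
        rw [← zpow_add, add_neg_cancel, zpow_zero, mul_one]
      · exact Subtype.ext (Int.fract_add_intCast _ _)
    -- An inverse on orbits: it shows that points with the same projection lie in one orbit.
    let ψ : MappingTorus φ → MulAction.orbitRel.Quotient (Multiplicative ℤ) (MappingTorusCover φ) :=
      Quot.lift (fun x => Quotient.mk _ ((x.1, (x.2 : ℝ)) : S × ℝ)) (by
        rintro _ _ ⟨x⟩
        refine Quotient.sound (MulAction.orbitRel_apply.2 ⟨Multiplicative.ofAdd 1, ?_⟩)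
        change _ • (show MappingTorusCover φ from (φ x, _)) = _
        rw [smul_def]
        refine Prod.ext ?_ ?_
        · change (φ ^ (-1 : ℤ)) (φ x) = x
          rw [zpow_neg_one]; exact φ.symm_apply_apply x
        · change ((0 : I) : ℝ) + ((1 : ℤ) : ℝ) = ((1 : I) : ℝ)
          simp)
    have hψ : ∀ e, ψ (proj φ e) = Quotient.mk _ e := by
      intro e
      refine Quotient.sound (MulAction.orbitRel_apply.2 ⟨Multiplicative.ofAdd (-⌊e.2⌋), ?_⟩)
      change _ • e = _
      rw [smul_def]
      refine Prod.ext ?_ ?_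
      · change (φ ^ (-(-⌊e.2⌋))) e.1 = _
        rw [neg_neg]
      · change e.2 + ((-⌊e.2⌋ : ℤ) : ℝ) = Int.fract e.2
        push_cast; rfl
    intro e₁ e₂
    constructor
    · intro h
      have h1 := congrArg ψ h
      rw [hψ, hψ] at h1
      exact MulAction.orbitRel_apply.1 (Quotient.exact h1)
    · rintro ⟨n, rfl⟩
      exact hsmul n e₂
  disjoint e := by
    have h2 : Continuous fun e : MappingTorusCover φ => e.2 := continuous_snd
    -- An open slab of height one is disjoint from its translates by nonzero integers.
    refine ⟨{e' | e'.2 ∈ Set.Ioo (e.2 - 1 / 2) (e.2 + 1 / 2)},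
      h2.continuousAt.preimage_mem_nhds (Ioo_mem_nhds (by linarith) (by linarith)), ?_⟩
    rintro n ⟨_, ⟨e', he', rfl⟩, he''⟩
    have h3 : e'.2 + (n.toAdd : ℝ) ∈ Set.Ioo (e.2 - 1 / 2) (e.2 + 1 / 2) := he''
    have h4 : e'.2 ∈ Set.Ioo (e.2 - 1 / 2) (e.2 + 1 / 2) := he'
    have h5 : (n.toAdd : ℝ) < 1 := by linarith [h3.2, h4.1]
    have h6 : (-1 : ℝ) < n.toAdd := by linarith [h3.1, h4.2]
    have h7 : n.toAdd < 1 := by exact_mod_cast h5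
    have h8 : -1 < n.toAdd := by exact_mod_cast h6
    exact Multiplicative.toAdd.injective (by change n.toAdd = 0; omega)

/-- The inclusion of the fibre in a mapping torus is injective on fundamental groups. -/
theorem MappingTorus.fiber_map_injective (φ : S ≃ₜ S) (x₀ : S) :
    Function.Injective (FundamentalGroup.map (MappingTorus.fiber φ) x₀) := by
  intro a b hab
  obtain ⟨α, rfl⟩ := Path.Homotopic.Quotient.mk_surjective a
  obtain ⟨β, rfl⟩ := Path.Homotopic.Quotient.mk_surjective b
  have h1 : (α.map (MappingTorus.fiber φ).continuous).Homotopic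
      (β.map (MappingTorus.fiber φ).continuous) := by
    exact Path.Homotopic.Quotient.eq.1 hab
  have cov := (MappingTorusCover.isQuotientCoveringMap_proj φ).isCoveringMap
  let f₀ : C(I, MappingTorusCover φ) := (MappingTorusCover.zeroSection φ).comp α.toContinuousMap
  let f₁ : C(I, MappingTorusCover φ) := (MappingTorusCover.zeroSection φ).comp β.toContinuousMap
  have h2 : f₀.HomotopicRel f₁ {0, 1} := by
    refine (cov.homotopicRel_iff_comp ⟨0, .inl rfl, ?_⟩).2 ?_
    · simp [f₀, f₁]
    · have e₀ : (⟨MappingTorusCover.proj φ, cov.continuous⟩ : C(_, _)).comp f₀ =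
          (α.map (MappingTorus.fiber φ).continuous).toContinuousMap :=
        ContinuousMap.ext fun s => MappingTorusCover.proj_zeroSection φ _
      have e₁ : (⟨MappingTorusCover.proj φ, cov.continuous⟩ : C(_, _)).comp f₁ =
          (β.map (MappingTorus.fiber φ).continuous).toContinuousMap :=
        ContinuousMap.ext fun s => MappingTorusCover.proj_zeroSection φ _
      rw [e₀, e₁]
      exact h1
  -- The homotopy has been lifted to `S × ℝ`; this projection, a left inverse of the zero section,
  -- brings it down to `S`.
  let pr : C(MappingTorusCover φ, S) := ⟨fun e => e.1, continuous_fst⟩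
  have h3 : (pr.comp f₀).HomotopicRel (pr.comp f₁) {0, 1} := h2.comp_continuousMap pr
  exact Path.Homotopic.Quotient.eq.2 h3

/-- The fundamental group of a mapping torus maps onto the integers, and the kernel is the
image of the fundamental group of the fibre. -/
theorem MappingTorus.exists_degree [PathConnectedSpace S] (φ : S ≃ₜ S) (x₀ : S) :
    ∃ δ : FundamentalGroup (MappingTorus φ) (MappingTorus.fiber φ x₀) →* (Multiplicative ℤ)ᵐᵒᵖ,
      Function.Surjective δ ∧
      δ.ker = (FundamentalGroup.map (MappingTorus.fiber φ) x₀).range := by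
  have hp := MappingTorusCover.isQuotientCoveringMap_proj φ
  let e : MappingTorusCover.proj φ ⁻¹' {MappingTorus.fiber φ x₀} :=
    ⟨MappingTorusCover.zeroSection φ x₀, MappingTorusCover.proj_zeroSection φ x₀⟩
  have : PathConnectedSpace (MappingTorusCover φ) := inferInstanceAs (PathConnectedSpace (S × ℝ))
  refine ⟨hp.fundamentalGroupToMulOpposite e, hp.fundamentalGroupToMulOpposite_surjective e, ?_⟩
  -- The kernel is the image of the fundamental group of `S × ℝ`, where any loop deforms into the
  -- zero level because ℝ is simply connected.
  rw [hp.ker_fundamentalGroupToMulOpposite, hp.ker_monodromyPerm e]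
  have key : ∀ α : Path x₀ x₀, FundamentalGroup.mapOfEq ⟨MappingTorusCover.proj φ, hp.continuous⟩
      e.2 (Path.Homotopic.Quotient.mk (α.map (MappingTorusCover.zeroSection φ).continuous)) =
      FundamentalGroup.map (MappingTorus.fiber φ) x₀ (Path.Homotopic.Quotient.mk α) := by
    intro α
    refine (FundamentalGroup.mapOfEq_apply _ _ _).trans ?_
    refine congrArg Path.Homotopic.Quotient.mk (Path.ext (funext fun s => ?_))
    exact MappingTorusCover.proj_zeroSection φ _
  apply le_antisymm
  · rintro _ ⟨γ, rfl⟩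
    obtain ⟨γ, rfl⟩ := Path.Homotopic.Quotient.mk_surjective γ
    let α : Path x₀ x₀ := γ.map (f := fun e : MappingTorusCover φ => e.1) continuous_fst
    refine ⟨Path.Homotopic.Quotient.mk α, ?_⟩
    rw [← key]
    congr 1
    refine Path.Homotopic.Quotient.eq.2 (Path.Homotopic.symm ?_)
    let β : Path (0 : ℝ) 0 := γ.map (f := fun e : MappingTorusCover φ => e.2) continuous_snd
    have hβ : β.Homotopic (Path.refl 0) := SimplyConnectedSpace.paths_homotopic _ _
    exact ⟨Path.Homotopic.prodHomotopy (Path.Homotopy.refl α) hβ.some⟩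
  · rintro _ ⟨γ, rfl⟩
    obtain ⟨α, rfl⟩ := Path.Homotopic.Quotient.mk_surjective γ
    exact ⟨_, key α⟩

end MappingTorusCover

end

/-! ### Finite generation from an open cover -/

noncomputable section

section FundamentalGroupFG

variable {X : Type*} [TopologicalSpace X] [PathConnectedSpace X]

/-- The loop obtained from a path by joining its endpoints to the base point. -/
def loopOfPath (x₀ : X) {x y : X} (γ : Path x y) : FundamentalGroup X x₀ :=
  Path.Homotopic.Quotient.mk
    ((PathConnectedSpace.somePath x₀ x).trans (γ.trans (PathConnectedSpace.somePath x₀ y).symm))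

lemma loopOfPath_congr (x₀ : X) {x y : X} {γ γ' : Path x y} (h : γ.Homotopic γ') :
    loopOfPath x₀ γ = loopOfPath x₀ γ' :=
  Path.Homotopic.Quotient.eq.2
    ((Path.Homotopic.refl _).hcomp (h.hcomp (Path.Homotopic.refl _)))

lemma loopOfPath_eq_comp (x₀ : X) {x y : X} (γ : Path x y) :
    loopOfPath x₀ γ = (CategoryTheory.CategoryStruct.comp
      (X := FundamentalGroupoid.mk x₀) (Y := FundamentalGroupoid.mk x)
      (Z := FundamentalGroupoid.mk x₀)
      (Path.Homotopic.Quotient.mk (PathConnectedSpace.somePath x₀ x))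
      (CategoryTheory.CategoryStruct.comp (X := FundamentalGroupoid.mk x)
        (Y := FundamentalGroupoid.mk y) (Z := FundamentalGroupoid.mk x₀)
        (Path.Homotopic.Quotient.mk γ)
        (CategoryTheory.Groupoid.inv (X := FundamentalGroupoid.mk x₀)
          (Y := FundamentalGroupoid.mk y)
          (Path.Homotopic.Quotient.mk (PathConnectedSpace.somePath x₀ y)))) :) := rfl

/-- The connecting paths at `y` cancel. The order is reversed because multiplication of
endomorphisms is opposite to concatenation. -/
lemma loopOfPath_trans (x₀ : X) {x y z : X} (γ : Path x y) (γ' : Path y z) :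
    loopOfPath x₀ (γ.trans γ') = loopOfPath x₀ γ' * loopOfPath x₀ γ := by
  rw [CategoryTheory.End.mul_def, loopOfPath_eq_comp, loopOfPath_eq_comp, loopOfPath_eq_comp]
  have : (Path.Homotopic.Quotient.mk (γ.trans γ') :) =
    CategoryTheory.CategoryStruct.comp (X := FundamentalGroupoid.mk x)
        (Y := FundamentalGroupoid.mk y) (Z := FundamentalGroupoid.mk z)
        (Path.Homotopic.Quotient.mk γ) (Path.Homotopic.Quotient.mk γ') := rfl
  rw [this]
  simp only [CategoryTheory.Category.assoc]
  congr 2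
  rw [← CategoryTheory.Category.assoc (CategoryTheory.Groupoid.inv _),
    CategoryTheory.Groupoid.inv_comp, CategoryTheory.Category.id_comp]

lemma loopOfPath_of_const (x₀ : X) {x y : X} (γ : Path x y) (h : ∀ s, γ s = x) :
    loopOfPath x₀ γ = 1 := by
  obtain rfl : x = y := by rw [← h 1, γ.target]
  have hγ : γ = Path.refl x := Path.ext (funext h)
  subst hγ
  have h1 := loopOfPath_trans x₀ (Path.refl x) (Path.refl x)
  rw [loopOfPath_congr x₀ ⟨Path.Homotopy.transRefl (Path.refl x)⟩] at h1
  exact left_eq_mul.1 h1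

/-- A path inside an open set which deforms to a discrete set is determined by its endpoints. -/
lemma exists_loopOfPath_eq_of_deformation (x₀ : X) (O : Set X) {f₁ : C(O, X)}
    (H : ContinuousMap.Homotopy (⟨Subtype.val, continuous_subtype_val⟩ : C(O, X)) f₁)
    {ℓ : O → ℤ} (hℓ : Continuous ℓ) (hfac : ∀ x y, ℓ x = ℓ y → f₁ x = f₁ y) :
    ∃ g : X → FundamentalGroup X x₀, ∀ (x y : X) (γ : Path x y), (∀ s, γ s ∈ O) →
      loopOfPath x₀ γ = (g y)⁻¹ * g x := by
  classical
  -- The element attached to `x` is its track under the deformation. The deformed path is constant,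
  -- since `ℓ` is constant along it, so the naturality square of the homotopy gives the formula.
  refine ⟨fun x => if h : x ∈ O then loopOfPath x₀ (H.evalAt ⟨x, h⟩) else 1, ?_⟩
  intro x y γ hγ
  have hx : x ∈ O := by simpa using hγ 0
  have hy : y ∈ O := by simpa using hγ 1
  simp only [hx, hy, dif_pos]
  let p : Path (⟨x, hx⟩ : O) ⟨y, hy⟩ :=
    { toFun := fun s => ⟨γ s, hγ s⟩
      continuous_toFun := by fun_prop
      source' := Subtype.ext γ.source
      target' := Subtype.ext γ.target }
  have h1 := loopOfPath_congr x₀ (Path.Homotopic.map_trans_evalAt H p)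
  rw [loopOfPath_trans, loopOfPath_trans] at h1
  have h2 : loopOfPath x₀ (p.map f₁.continuous) = 1 := by
    refine loopOfPath_of_const x₀ _ fun s => hfac _ _ ?_
    have hc : Continuous fun s => ℓ (p s) := hℓ.comp p.continuous
    have := PreconnectedSpace.constant inferInstance hc (x := s) (y := 0)
    rw [this, p.source]
  rw [h2, one_mul] at h1
  have h3 : p.map (⟨Subtype.val, continuous_subtype_val⟩ : C(O, X)).continuous = γ :=
    Path.ext rfl
  rw [h3] at h1
  exact eq_inv_mul_of_mul_eq h1

/-- The inclusion of `O` is homotopic to a map that factors through a discrete space. -/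
def DeformsToDiscrete (O : Set X) : Prop :=
  ∃ (f₁ : C(O, X)) (ℓ : O → ℤ),
    Nonempty (ContinuousMap.Homotopy (⟨Subtype.val, continuous_subtype_val⟩ : C(O, X)) f₁) ∧
    Continuous ℓ ∧ ∀ x y, ℓ x = ℓ y → f₁ x = f₁ y

/-- In each `O i` a path contributes only through its endpoints, by a potential `g i`. The
transition `g j x * (g i x)⁻¹` does not change along paths in the overlap, so it takes only its
values on the finite set `B`. These values and the `g i x₀` generate. -/
theorem fundamentalGroup_fg_of_cover (x₀ : X) {ι : Type*} [Finite ι] (O : ι → Set X)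
    (hO : ∀ i, IsOpen (O i)) (hcov : ∀ x, ∃ i, x ∈ O i) (hdef : ∀ i, DeformsToDiscrete (O i))
    (B : Set X) (hB : B.Finite)
    (hJ : ∀ i j x, x ∈ O i → x ∈ O j → ∃ b ∈ B, JoinedIn (O i ∩ O j) x b) :
    Group.FG (FundamentalGroup X x₀) := by
  choose f₁ ℓ H hℓ hfac using hdef
  choose g hg using fun i => exists_loopOfPath_eq_of_deformation x₀ (O i) (H i).some (hℓ i) (hfac i)
  have hBf : Finite B := hB
  let G : Set (FundamentalGroup X x₀) := Set.range (fun i => g i x₀) ∪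
    Set.range (fun p : (ι × ι) × B => g p.1.2 p.2 * (g p.1.1 p.2)⁻¹)
  have hG : G.Finite := (Set.finite_range _).union (Set.finite_range _)
  have hloc : ∀ i j x, x ∈ O i → x ∈ O j → g j x * (g i x)⁻¹ ∈ Subgroup.closure G := by
    intro i j x hi hj
    obtain ⟨b, hb, γ, hγ⟩ := hJ i j x hi hj
    have h1 := hg i x b γ fun s => (hγ s).1
    rw [hg j x b γ fun s => (hγ s).2] at h1
    have h2 : g j x * (g i x)⁻¹ = g j b * (g i b)⁻¹ := by
      rw [inv_mul_eq_iff_eq_mul] at h1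
      rw [h1]; group
    rw [h2]
    exact Subgroup.subset_closure (.inr ⟨((i, j), ⟨b, hb⟩), rfl⟩)
  have hloop : ∀ γ : Path x₀ x₀, loopOfPath x₀ γ ∈ Subgroup.closure G := by
    intro γ
    obtain ⟨t, ht0, htm, ⟨N, hN⟩, ht⟩ := exists_monotone_Icc_subset_open_cover_unitInterval
      (c := fun i => γ ⁻¹' O i) (fun i => (hO i).preimage γ.continuous)
      (fun s _ => Set.mem_iUnion.2 (hcov (γ s)))
    -- The invariant carried along a subdivision of the loop into pieces lying in single members of
    -- the cover.
    have key : ∀ n i, γ (t n) ∈ O i →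
        g i (γ (t n)) * loopOfPath x₀ (γ.subpath 0 (t n)) ∈ Subgroup.closure G := by
      intro n
      induction n with
      | zero =>
        intro i _
        have h1 : ∀ u : I, u = 0 → loopOfPath x₀ (γ.subpath 0 u) = 1 := by
          rintro _ rfl
          rw [Path.subpath_self]
          exact loopOfPath_of_const _ _ fun _ => rfl
        rw [h1 _ ht0, mul_one, ht0, γ.source]
        exact Subgroup.subset_closure (.inl ⟨i, rfl⟩)
      | succ n ih =>
        intro i hi
        obtain ⟨k, hk⟩ := ht n
        have hle := htm n.le_succ
        have h1 : loopOfPath x₀ (γ.subpath 0 (t (n + 1))) =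
            loopOfPath x₀ (γ.subpath (t n) (t (n + 1))) * loopOfPath x₀ (γ.subpath 0 (t n)) := by
          rw [← loopOfPath_trans]
          exact (loopOfPath_congr x₀ ⟨Path.Homotopy.subpathTransSubpath γ _ _ _⟩).symm
        have h2 := hg k _ _ (γ.subpath (t n) (t (n + 1))) (fun s => by
          have : γ.subpath (t n) (t (n + 1)) s ∈ γ '' Set.Icc (t n) (t (n + 1)) := by
            rw [← Path.range_subpath_of_le γ _ _ hle]; exact Set.mem_range_self s
          obtain ⟨u, hu, hus⟩ := this
          rw [← hus]; exact hk hu)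
        rw [h1, h2]
        have h3 := hloc k i _ (hk ⟨hle, le_rfl⟩) hi
        have h4 := ih k (hk ⟨le_rfl, hle⟩)
        have := Subgroup.mul_mem _ h3 h4
        simpa only [mul_assoc] using this
    obtain ⟨i, hi⟩ := hcov x₀
    have h1 := key N i (by rw [hN N le_rfl, γ.target]; exact hi)
    have h2 : loopOfPath x₀ (γ.subpath 0 (t N)) = loopOfPath x₀ γ := by
      have h3 : ∀ (u v : I), u = 0 → v = 1 →
          loopOfPath x₀ (γ.subpath u v) = loopOfPath x₀ γ := by
        rintro _ _ rfl rfl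
        rw [Path.subpath_zero_one]
        have : ∀ (a b : X) (ha : a = x₀) (hb : b = x₀),
            loopOfPath x₀ (γ.cast ha hb) = loopOfPath x₀ γ := by
          rintro _ _ rfl rfl; rfl
        exact this _ _ _ _
      exact h3 _ _ rfl (hN N le_rfl)
    rw [h2, hN N le_rfl, γ.target] at h1
    have h3 : g i x₀ ∈ Subgroup.closure G := Subgroup.subset_closure (.inl ⟨i, rfl⟩)
    exact (Subgroup.mul_mem_cancel_left _ h3).1 h1
  refine Group.fg_iff.2 ⟨G, ?_, hG⟩
  rw [eq_top_iff]
  rintro p -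
  -- The chosen path from `x₀` to itself need not be constant, so `loopOfPath` conjugates by its
  -- class; this is undone here.
  let τ : FundamentalGroup X x₀ := Path.Homotopic.Quotient.mk (PathConnectedSpace.somePath x₀ x₀)
  obtain ⟨γ, hγ⟩ := Path.Homotopic.Quotient.mk_surjective (τ * p * τ⁻¹)
  have h1 := hloop γ
  let m : FundamentalGroup X x₀ := Path.Homotopic.Quotient.mk γ
  have h2 : loopOfPath x₀ γ = τ⁻¹ * m * τ := loopOfPath_eq_comp x₀ γ
  rw [h2, show m = τ * p * τ⁻¹ from hγ] at h1
  have h3 : τ⁻¹ * (τ * p * τ⁻¹) * τ = p := by group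
  rwa [h3] at h1

end FundamentalGroupFG

end

/-! ### Polar coordinates on quotients of the disc -/

noncomputable section

section PolarCoordinates

/-- Polar coordinates on the disc, with the angular coordinate scaled so that `n` is a full
turn. -/
def polarPoint (n : ℕ) (p : I × ℝ) : ClosedDisc :=
  ⟨(p.1 : ℝ) * Complex.exp (((2 * Real.pi * p.2 / n : ℝ) : ℂ) * Complex.I), by
    rw [mem_closedBall_zero_iff, norm_mul, Complex.norm_exp_ofReal_mul_I, mul_one,
      Complex.norm_real, Real.norm_eq_abs, abs_of_nonneg p.1.2.1]
    exact p.1.2.2⟩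

lemma polarPoint_one (n : ℕ) (x : ℝ) : polarPoint n (1, x) = boundaryPoint n x := by
  simp [polarPoint, boundaryPoint]

lemma polarPoint_zero (n : ℕ) (x y : ℝ) : polarPoint n (0, x) = polarPoint n (0, y) := by
  simp [polarPoint]

lemma polarPoint_add_int_mul {n : ℕ} (hn : n ≠ 0) (r : I) (x : ℝ) (k : ℤ) :
    polarPoint n (r, x + k * n) = polarPoint n (r, x) := by
  have hn' : (n : ℝ) ≠ 0 := by exact_mod_cast hn
  have h : 2 * Real.pi * (x + k * n) / n = 2 * Real.pi * x / n + k * (2 * Real.pi) := by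
    field_simp
  simp only [polarPoint, h]
  congr 2
  refine Complex.exp_eq_exp_iff_exists_int.2 ⟨k, ?_⟩
  push_cast
  ring

lemma fst_eq_and_of_polarPoint_eq {n : ℕ} (hn : n ≠ 0) {p q : I × ℝ}
    (h : polarPoint n p = polarPoint n q) :
    p.1 = q.1 ∧ (p.1 = 0 ∨ ∃ k : ℤ, p.2 = q.2 + k * n) := by
  have hn' : (n : ℝ) ≠ 0 := by exact_mod_cast hn
  have h1 := congrArg Subtype.val h
  simp only [polarPoint] at h1
  have h2 := congrArg norm h1
  simp only [norm_mul, Complex.norm_exp_ofReal_mul_I, mul_one, Complex.norm_real,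
    Real.norm_eq_abs, abs_of_nonneg p.1.2.1, abs_of_nonneg q.1.2.1] at h2
  have h3 : p.1 = q.1 := Subtype.ext h2
  refine ⟨h3, or_iff_not_imp_left.2 fun h0 => ?_⟩
  rw [← h2] at h1
  have h4 : ((p.1 : ℝ) : ℂ) ≠ 0 := by
    exact_mod_cast fun h => h0 (Subtype.ext h)
  obtain ⟨k, hk⟩ := Complex.exp_eq_exp_iff_exists_int.1 (mul_left_cancel₀ h4 h1)
  refine ⟨k, ?_⟩
  have h5 : ((2 * Real.pi * p.2 / n : ℝ) : ℂ) =
      ((2 * Real.pi * q.2 / n + k * (2 * Real.pi) : ℝ) : ℂ) := by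
    apply mul_right_cancel₀ Complex.I_ne_zero
    rw [hk]
    push_cast
    ring
  have h6 : 2 * Real.pi * p.2 / n = 2 * Real.pi * q.2 / n + k * (2 * Real.pi) := by
    exact_mod_cast h5
  have := Real.pi_pos
  field_simp at h6
  linarith

lemma continuous_polarPoint (n : ℕ) : Continuous (polarPoint n) := by
  unfold polarPoint
  fun_prop

lemma exists_polarPoint_eq {n : ℕ} (hn : n ≠ 0) (z : ClosedDisc) :
    ∃ r : I, ∃ x ∈ Set.Icc (-n : ℝ) n, polarPoint n (r, x) = z := by
  have hn' : (0 : ℝ) < n := by positivity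
  have hz : ‖(z : ℂ)‖ ≤ 1 := mem_closedBall_zero_iff.1 z.2
  have := Real.pi_pos
  refine ⟨⟨‖(z : ℂ)‖, norm_nonneg _, hz⟩, n * (Complex.arg z / (2 * Real.pi)), ?_, ?_⟩
  · have h1 : |Complex.arg z / (2 * Real.pi)| ≤ 1 := by
      rw [abs_div, abs_of_pos (by positivity : 0 < 2 * Real.pi), div_le_one (by positivity)]
      linarith [Complex.abs_arg_le_pi z]
    obtain ⟨h2, h3⟩ := abs_le.1 h1
    constructor <;> nlinarith
  · apply Subtype.ext
    simp only [polarPoint]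
    have : 2 * Real.pi * (n * (Complex.arg z / (2 * Real.pi))) / n = Complex.arg z := by
      field_simp
    rw [this]
    exact Complex.norm_mul_exp_arg_mul_I z

/-- Angles in `[-n, n]` suffice, and a continuous surjection from a compact space onto a Hausdorff
space is a quotient map. -/
lemma isQuotientMap_polarPoint {n : ℕ} (hn : n ≠ 0) : Topology.IsQuotientMap (polarPoint n) := by
  let j : I × Set.Icc (-n : ℝ) n → I × ℝ := fun p => (p.1, p.2)
  have hj : Continuous j := by fun_prop
  refine Topology.IsQuotientMap.of_comp hj (continuous_polarPoint n) ?_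
  refine Topology.IsQuotientMap.of_surjective_continuous (fun z => ?_)
    ((continuous_polarPoint n).comp hj)
  obtain ⟨r, x, hx, h⟩ := exists_polarPoint_eq hn z
  exact ⟨(r, ⟨x, hx⟩), h⟩

/-- Polar coordinates on a quotient of the disc. -/
def polarQuot (n : ℕ) (R : ClosedDisc → ClosedDisc → Prop) (p : I × ℝ) : Quot R :=
  Quot.mk R (polarPoint n p)

variable {n : ℕ} {R : ClosedDisc → ClosedDisc → Prop}

lemma isQuotientMap_polarQuot (hn : n ≠ 0) : Topology.IsQuotientMap (polarQuot n R) :=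
  isQuotientMap_quot_mk.comp (isQuotientMap_polarPoint hn)

lemma polarQuot_zero (x y : ℝ) : polarQuot n R (0, x) = polarQuot n R (0, y) :=
  congrArg (Quot.mk R) (polarPoint_zero n x y)

lemma polarQuot_add_int_mul (hn : n ≠ 0) (r : I) (x : ℝ) (k : ℤ) :
    polarQuot n R (r, x + k * n) = polarQuot n R (r, x) :=
  congrArg (Quot.mk R) (polarPoint_add_int_mul hn r x k)

/-- Checking the centre, the period and the generating gluings is enough to descend to `Quot R`,
with no need to describe the generated equivalence relation. -/
lemma eq_of_polarQuot_eq (hn : n ≠ 0) {Z : Type*} (h : I × ℝ → Z)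
    (h0 : ∀ x y, h (0, x) = h (0, y)) (hper : ∀ r x, h (r, x + n) = h (r, x))
    (hR : ∀ z w, R z w → ∃ x y, z = boundaryPoint n x ∧ w = boundaryPoint n y ∧
      h (1, x) = h (1, y)) {p q : I × ℝ} (hpq : polarQuot n R p = polarQuot n R q) :
    h p = h q := by
  have hper' : ∀ r x (k : ℤ), h (r, x + k * n) = h (r, x) := by
    intro r x k
    have := (show Function.Periodic (fun x => h (r, x)) (n : ℝ) from hper r).int_mul k x
    simpa using this
  have hdisc : ∀ p q, polarPoint n p = polarPoint n q → h p = h q := by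
    rintro ⟨r, x⟩ ⟨r', y⟩ hpq
    obtain ⟨h1, h2⟩ := fst_eq_and_of_polarPoint_eq hn hpq
    obtain rfl : r = r' := h1
    obtain h2 | ⟨k, hk⟩ := h2
    · obtain rfl : r = 0 := h2
      exact h0 _ _
    · obtain rfl : x = y + k * n := hk
      exact hper' _ _ _
  have hsurj := (isQuotientMap_polarPoint hn).surjective
  let H : ClosedDisc → Z := fun z => h (Function.surjInv hsurj z)
  have hH : ∀ p, H (polarPoint n p) = h p := fun p => hdisc _ _ (Function.surjInv_eq hsurj _)
  have hHR : ∀ z w, R z w → H z = H w := by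
    intro z w hzw
    obtain ⟨x, y, rfl, rfl, hxy⟩ := hR z w hzw
    rw [← polarPoint_one, ← polarPoint_one, hH, hH, hxy]
  have : Quot.lift H hHR (polarQuot n R p) = Quot.lift H hHR (polarQuot n R q) := by rw [hpq]
  simpa only [polarQuot, hH] using this

end PolarCoordinates

section Deformation

/-- The homotopy is curried to a map into `C(I, X)`, so that only the restriction of `π` over `O`,
and not its product with `I`, has to be a quotient map. -/
theorem DeformsToDiscrete.of_isQuotientMap {P X : Type*} [TopologicalSpace P]
    [TopologicalSpace X] {π : P → X} (hπ : Topology.IsQuotientMap π) {O : Set X} (hO : IsOpen O)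
    (F : P → I → X) (hF : ContinuousOn (Function.uncurry F) ((π ⁻¹' O) ×ˢ Set.univ))
    (hF0 : ∀ p, π p ∈ O → F p 0 = π p) (ℓ : P → ℤ) (hℓ : ContinuousOn ℓ (π ⁻¹' O))
    (hcompat : ∀ p q, π p ∈ O → π p = π q → F p = F q ∧ ℓ p = ℓ q)
    (hend : ∀ p q, π p ∈ O → π q ∈ O → ℓ p = ℓ q → F p 1 = F q 1) :
    DeformsToDiscrete O := by
  let q : C(π ⁻¹' O, O) := ⟨O.restrictPreimage π, hπ.continuous.restrictPreimage⟩
  have hq : Topology.IsQuotientMap q := hπ.restrictPreimage_isOpen hO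
  let G : C(π ⁻¹' O, C(I, X)) := ContinuousMap.curry
    ⟨fun pu => F pu.1 pu.2, hF.comp_continuous (f := fun pu : (π ⁻¹' O) × I => ((pu.1 : P), pu.2))
      (by fun_prop) (fun pu => ⟨pu.1.2, trivial⟩)⟩
  have hG : Function.FactorsThrough G q := by
    intro a b hab
    ext u
    exact congrFun (hcompat a b a.2 (congrArg Subtype.val hab)).1 u
  let l : C(π ⁻¹' O, ℤ) := ⟨fun p => ℓ p, hℓ.domRestrict⟩
  have hl : Function.FactorsThrough l q := fun a b hab =>
    (hcompat a b a.2 (congrArg Subtype.val hab)).2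
  let G' : C(O, C(I, X)) := hq.lift G hG
  let l' : C(O, ℤ) := hq.lift l hl
  have hG' : ∀ p, G' (q p) = G p := fun p => DFunLike.congr_fun (hq.lift_comp G hG) p
  have hl' : ∀ p, l' (q p) = l p := fun p => DFunLike.congr_fun (hq.lift_comp l hl) p
  refine ⟨⟨fun x => G' x 1, by fun_prop⟩, l', ⟨⟨⟨fun ux => G' ux.2 ux.1, by fun_prop⟩, ?_, ?_⟩⟩,
    l'.continuous, ?_⟩
  · intro x
    obtain ⟨p, rfl⟩ := hq.surjective x
    change G' (q p) 0 = _
    rw [hG']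
    exact hF0 p p.2
  · intro x; rfl
  · intro x y hxy
    obtain ⟨p, rfl⟩ := hq.surjective x
    obtain ⟨p', rfl⟩ := hq.surjective y
    rw [hl', hl'] at hxy
    change G' (q p) 1 = G' (q p') 1
    rw [hG', hG']
    exact hend p p' p.2 p'.2 hxy

end Deformation

section Floor

lemma eventually_floor_eq {x : ℝ} (hx : ∀ m : ℤ, x ≠ m) : ∀ᶠ y in 𝓝 x, ⌊y⌋ = ⌊x⌋ := by
  have h1 : (⌊x⌋ : ℝ) < x := lt_of_le_of_ne (Int.floor_le x) (hx _).symm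
  filter_upwards [Ioo_mem_nhds h1 (Int.lt_floor_add_one x)] with y hy
  exact Int.floor_eq_iff.2 ⟨hy.1.le, hy.2⟩

lemma continuousAt_floor_of_ne {x : ℝ} (hx : ∀ m : ℤ, x ≠ m) :
    ContinuousAt (fun y : ℝ => ⌊y⌋) x :=
  (continuousAt_const (y := ⌊x⌋)).congr ((eventually_floor_eq hx).mono fun _ h => h.symm)

lemma isOpen_forall_ne_intCast : IsOpen {x : ℝ | ∀ m : ℤ, x ≠ m} := by
  have : {x : ℝ | ∀ m : ℤ, x ≠ m} = (Set.range ((↑) : ℤ → ℝ))ᶜ := by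
    ext x; simp [eq_comm]
  rw [this]
  exact Int.isClosedEmbedding_coe_real.isClosed_range.isOpen_compl

end Floor

end

/-! ### Open subsets of a glued polygon that deform to discrete sets -/

noncomputable section

section PolygonGluing

variable {n : ℕ} {R : ClosedDisc → ClosedDisc → Prop}

theorem deformsToDiscrete_image_polarQuot (hn : n ≠ 0) {A : Set (I × ℝ)} (hA : IsOpen A)
    (F : I × ℝ → I → Quot R) (hF : ContinuousOn (Function.uncurry F) (A ×ˢ Set.univ))
    (hF0 : ∀ p ∈ A, F p 0 = polarQuot n R p) (ℓ : I × ℝ → ℤ) (hℓ : ContinuousOn ℓ A)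
    (h0 : ∀ x y, ((0, x) ∈ A ↔ (0, y) ∈ A) ∧
      ((0, x) ∈ A → F (0, x) = F (0, y) ∧ ℓ (0, x) = ℓ (0, y)))
    (hper : ∀ (r : I) (x : ℝ), ((r, x + n) ∈ A ↔ (r, x) ∈ A) ∧
      ((r, x + n) ∈ A → F (r, x + n) = F (r, x) ∧ ℓ (r, x + n) = ℓ (r, x)))
    (hR : ∀ z w, R z w → ∃ x y, z = boundaryPoint n x ∧ w = boundaryPoint n y ∧
      ((1, x) ∈ A ↔ (1, y) ∈ A) ∧ ((1, x) ∈ A → F (1, x) = F (1, y) ∧ ℓ (1, x) = ℓ (1, y)))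
    (hend : ∀ p ∈ A, ∀ q ∈ A, ℓ p = ℓ q → F p 1 = F q 1) :
    IsOpen (polarQuot n R '' A) ∧ (∀ p, polarQuot n R p ∈ polarQuot n R '' A ↔ p ∈ A) ∧
      DeformsToDiscrete (polarQuot n R '' A) := by
  have hπ := isQuotientMap_polarQuot (R := R) hn
  -- Being empty outside `A`, this one function encodes membership in `A` along with `F` and `ℓ`;
  -- its invariance proves saturation and compatibility together.
  let h : I × ℝ → Set ((I → Quot R) × ℤ) := fun p => {z | p ∈ A ∧ z = (F p, ℓ p)}
  have hext : ∀ p q, (p ∈ A ↔ q ∈ A) → (p ∈ A → F p = F q ∧ ℓ p = ℓ q) → h p = h q := by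
    intro p q h1 h2
    ext z
    change (p ∈ A ∧ z = (F p, ℓ p)) ↔ (q ∈ A ∧ z = (F q, ℓ q))
    by_cases hp : p ∈ A
    · rw [(h2 hp).1, (h2 hp).2, h1]
    · simp only [hp, mt h1.2 hp, false_and]
  have key : ∀ p q, polarQuot n R p = polarQuot n R q → h p = h q := fun p q hpq =>
    eq_of_polarQuot_eq hn h (fun x y => hext _ _ (h0 x y).1 (h0 x y).2)
      (fun r x => hext _ _ (hper r x).1 (hper r x).2) (fun z w hzw => by
        obtain ⟨x, y, hz, hw, h1, h2⟩ := hR z w hzw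
        exact ⟨x, y, hz, hw, hext _ _ h1 h2⟩) hpq
  have key' : ∀ p q, p ∈ A → polarQuot n R p = polarQuot n R q →
      q ∈ A ∧ F p = F q ∧ ℓ p = ℓ q := by
    intro p q hp hpq
    have h1 : (F p, ℓ p) ∈ h p := ⟨hp, rfl⟩
    rw [key p q hpq] at h1
    exact ⟨h1.1, Prod.mk.inj h1.2⟩
  have hsat : ∀ p, polarQuot n R p ∈ polarQuot n R '' A ↔ p ∈ A :=
    fun p => ⟨fun ⟨q, hq, hqp⟩ => (key' q p hq hqp).1, fun hp => ⟨p, hp, rfl⟩⟩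
  have hpre : polarQuot n R ⁻¹' (polarQuot n R '' A) = A := Set.ext hsat
  have hopen : IsOpen (polarQuot n R '' A) := by
    rw [← hπ.isOpen_preimage, hpre]; exact hA
  refine ⟨hopen, hsat, ?_⟩
  refine DeformsToDiscrete.of_isQuotientMap hπ hopen F (by rwa [hpre])
    (fun p hp => hF0 p ((hsat p).1 hp)) ℓ (by rwa [hpre])
    (fun p q hp hpq => (key' p q ((hsat p).1 hp) hpq).2)
    (fun p q hp hq => hend p ((hsat p).1 hp) q ((hsat q).1 hq))

/-- `R` glues together those sides of the `n`-gon which have the same label, and identifies all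
vertices. -/
structure IsPolygonGluing (n : ℕ) (R : ClosedDisc → ClosedDisc → Prop) (L : ℤ → ℤ) : Prop where
  rel : ∀ z w, R z w → ∃ k k' : ℤ, L k = L k' ∧ ∃ τ : I → I, (τ = id ∨ τ = σ) ∧
    (∃ s : I, z = boundaryPoint n (k + s) ∧ w = boundaryPoint n (k' + τ s)) ∧
    ∀ s : I, R (boundaryPoint n (k + s)) (boundaryPoint n (k' + τ s))
  periodic : ∀ k, L (k + n) = L k
  midpoint : ∀ k k', L k = L k' →
    Quot.mk R (boundaryPoint n (k + 1 / 2)) = Quot.mk R (boundaryPoint n (k' + 1 / 2))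
  vertex : ∀ k : ℤ, Quot.mk R (boundaryPoint n k) = Quot.mk R (boundaryPoint n 0)

lemma polarQuot_one (x : ℝ) : polarQuot n R (1, x) = Quot.mk R (boundaryPoint n x) := by
  rw [polarQuot, polarPoint_one]

lemma polarQuot_add_natCast (hn : n ≠ 0) (r : I) (x : ℝ) :
    polarQuot n R (r, x + n) = polarQuot n R (r, x) := by
  simpa using polarQuot_add_int_mul (R := R) hn r x 1

/-- Radial shrinking contracts the open disc to its centre. -/
theorem deformsToDiscrete_openDisc (hn : n ≠ 0) {L : ℤ → ℤ} (hL : IsPolygonGluing n R L) :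
    let A : Set (I × ℝ) := {p | p.1 < 1}
    IsOpen (polarQuot n R '' A) ∧ (∀ p, polarQuot n R p ∈ polarQuot n R '' A ↔ p ∈ A) ∧
      DeformsToDiscrete (polarQuot n R '' A) := by
  have hπ := (isQuotientMap_polarQuot (R := R) hn).continuous
  refine deformsToDiscrete_image_polarQuot hn (isOpen_lt (by fun_prop) (by fun_prop))
    (fun p u => polarQuot n R (min p.1 (σ u), p.2)) ?_ ?_ (fun _ => 0) continuousOn_const ?_ ?_
    ?_ ?_
  · exact (hπ.comp (by fun_prop)).continuousOn
  · rintro ⟨r, x⟩ -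
    simp [min_eq_left (unitInterval.le_one' : r ≤ 1)]
  · intro x y
    refine ⟨Iff.rfl, fun _ => ⟨?_, rfl⟩⟩
    ext u
    simp only [min_eq_left (unitInterval.nonneg' : 0 ≤ σ u)]
    exact polarQuot_zero x y
  · intro r x
    exact ⟨Iff.rfl, fun _ => ⟨funext fun u => polarQuot_add_natCast hn _ x, rfl⟩⟩
  · intro z w hzw
    obtain ⟨k, k', -, τ, -, ⟨s, hz, hw⟩, -⟩ := hL.rel z w hzw
    exact ⟨_, _, hz, hw, Iff.rfl, fun h => absurd (show (1 : I) < 1 from h) (lt_irrefl _)⟩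
  · rintro ⟨r, x⟩ - ⟨r', x'⟩ - -
    simp only [unitInterval.symm_one, min_eq_right (unitInterval.nonneg' : 0 ≤ r),
      min_eq_right (unitInterval.nonneg' : 0 ≤ r')]
    exact polarQuot_zero x x'

lemma polarQuot_one_glue {L : ℤ → ℤ} (hL : IsPolygonGluing n R L) {z w : ClosedDisc}
    (hzw : R z w) : ∃ k k' : ℤ, L k = L k' ∧ ∃ τ : ℝ → ℝ, (τ = id ∨ τ = fun s => 1 - s) ∧
    (∃ s ∈ Set.Icc (0 : ℝ) 1, z = boundaryPoint n (k + s) ∧ w = boundaryPoint n (k' + τ s)) ∧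
    ∀ s ∈ Set.Icc (0 : ℝ) 1, polarQuot n R (1, k + s) = polarQuot n R (1, k' + τ s) := by
  obtain ⟨k, k', hk, τ, hτ, ⟨s, hz, hw⟩, hall⟩ := hL.rel z w hzw
  obtain rfl | rfl := hτ
  · refine ⟨k, k', hk, id, .inl rfl, ⟨s, s.2, hz, hw⟩, fun s hs => ?_⟩
    rw [polarQuot_one, polarQuot_one]
    exact Quot.sound (hall ⟨s, hs⟩)
  · refine ⟨k, k', hk, fun s => 1 - s, .inr rfl, ⟨s, s.2, hz, hw⟩, fun s hs => ?_⟩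
    rw [polarQuot_one, polarQuot_one]
    exact Quot.sound (hall ⟨s, hs⟩)

lemma isOpen_pos_and_forall_add_ne_intCast (c : ℝ) :
    IsOpen {p : I × ℝ | 0 < p.1 ∧ ∀ m : ℤ, p.2 + c ≠ m} :=
  (isOpen_lt (by fun_prop) (by fun_prop)).inter
    (isOpen_forall_ne_intCast.preimage (f := fun p : I × ℝ => p.2 + c) (by fun_prop))

/-- With the centre and the rays to the vertices removed, points move outward and slide to the
midpoint of their side, which the label of the side determines. -/
theorem deformsToDiscrete_sides (hn : n ≠ 0) {L : ℤ → ℤ} (hL : IsPolygonGluing n R L) :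
    let A : Set (I × ℝ) := {p | 0 < p.1 ∧ ∀ m : ℤ, p.2 ≠ m}
    IsOpen (polarQuot n R '' A) ∧ (∀ p, polarQuot n R p ∈ polarQuot n R '' A ↔ p ∈ A) ∧
      DeformsToDiscrete (polarQuot n R '' A) := by
  intro A
  have hπ := (isQuotientMap_polarQuot (R := R) hn).continuous
  have hfl : ContinuousOn (fun p : I × ℝ => ⌊p.2⌋) A := fun p hp =>
    ((continuousAt_floor_of_ne hp.2).comp (f := fun p : I × ℝ => p.2)
      continuous_snd.continuousAt).continuousWithinAt
  have hA : IsOpen A := by simpa using isOpen_pos_and_forall_add_ne_intCast 0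
  refine deformsToDiscrete_image_polarQuot hn hA
    (fun p u => polarQuot n R (max p.1 u, (1 - u) * p.2 + u * (⌊p.2⌋ + 1 / 2))) ?_ ?_
    (fun p => L ⌊p.2⌋) (continuous_of_discreteTopology.comp_continuousOn hfl) ?_ ?_ ?_ ?_
  · refine hπ.comp_continuousOn ?_
    have h1 : ContinuousOn (fun q : (I × ℝ) × I => (⌊q.1.2⌋ : ℝ)) (A ×ˢ Set.univ) :=
      (continuous_of_discreteTopology (f := fun k : ℤ => (k : ℝ))).comp_continuousOn
        (hfl.comp continuousOn_fst fun q hq => hq.1)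
    fun_prop
  · rintro ⟨r, x⟩ -
    simp
  · intro x y
    exact ⟨⟨fun h => absurd h.1 (lt_irrefl _), fun h => absurd h.1 (lt_irrefl _)⟩,
      fun h => absurd h.1 (lt_irrefl _)⟩
  · intro r x
    refine ⟨⟨fun h => ⟨h.1, fun m hm => h.2 (m + n) (by push_cast; linarith [hm])⟩,
      fun h => ⟨h.1, fun m hm => h.2 (m - n) (by push_cast; linarith [hm])⟩⟩, fun _ => ⟨funext fun u => ?_, ?_⟩⟩
    · simp only [Int.floor_add_natCast]
      rw [← polarQuot_add_natCast hn _ ((1 - u) * x + u * (⌊x⌋ + 1 / 2))]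
      congr 2
      push_cast
      ring
    · simp only [Int.floor_add_natCast]
      exact hL.periodic _
  · intro z w hzw
    obtain ⟨k, k', hk, τ, hτ, ⟨s, hs, hz, hw⟩, hall⟩ := polarQuot_one_glue hL hzw
    have hmem : ∀ (j : ℤ) (s : ℝ), s ∈ Set.Icc (0 : ℝ) 1 →
        (((1, j + s) : I × ℝ) ∈ A ↔ s ≠ 0 ∧ s ≠ 1) := by
      intro j s hs
      constructor
      · rintro ⟨-, h⟩
        exact ⟨fun h0 => h j (by simp [h0]), fun h1 => h (j + 1) (by simp [h1])⟩
      · rintro ⟨h0, h1⟩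
        refine ⟨zero_lt_one, fun m hm => ?_⟩
        have h2 : (0 : ℝ) < ((m - j : ℤ) : ℝ) := by
          push_cast; linarith [lt_of_le_of_ne hs.1 h0.symm, show (j : ℝ) + s = m from hm]
        have h3 : ((m - j : ℤ) : ℝ) < 1 := by
          push_cast; linarith [lt_of_le_of_ne hs.2 h1, show (j : ℝ) + s = m from hm]
        have h4 : 0 < m - j := by exact_mod_cast h2
        have h5 : m - j < 1 := by exact_mod_cast h3
        omega
    have hfloor : ∀ (j : ℤ) (s : ℝ), s ∈ Set.Icc (0 : ℝ) 1 → s ≠ 1 → ⌊(j : ℝ) + s⌋ = j :=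
      fun j s hs h1 => Int.floor_eq_iff.2 ⟨by linarith [hs.1],
        by linarith [lt_of_le_of_ne hs.2 h1]⟩
    have hτs : τ s ∈ Set.Icc (0 : ℝ) 1 := by
      obtain rfl | rfl := hτ
      · exact hs
      · exact ⟨by linarith [hs.2], by linarith [hs.1]⟩
    have hτ01 : (s ≠ 0 ∧ s ≠ 1) ↔ (τ s ≠ 0 ∧ τ s ≠ 1) := by
      obtain rfl | rfl := hτ
      · rfl
      · simp only [ne_eq, sub_eq_zero, sub_eq_self]
        rw [and_comm, eq_comm (a := (1 : ℝ))]
    refine ⟨_, _, hz, hw, ?_, fun h => ?_⟩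
    · rw [hmem k s hs, hmem k' _ hτs, hτ01]
    · have h1 := (hmem k s hs).1 h
      have h2 := hτ01.1 h1
      simp only [hfloor k s hs h1.2, hfloor k' _ hτs h2.2]
      refine ⟨funext fun u => ?_, hk⟩
      rw [max_eq_left (unitInterval.le_one' : u ≤ 1)]
      have h3 := hall ((1 - u) * s + u * (1 / 2)) ⟨by nlinarith [hs.1, hs.2, u.2.1, u.2.2],
        by nlinarith [hs.1, hs.2, u.2.1, u.2.2]⟩
      -- Both possible gluings are affine and fix `1 / 2`, so they commute with the sliding.
      have h4 : τ ((1 - u) * s + u * (1 / 2)) = (1 - u) * τ s + u * (1 / 2) := by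
        obtain rfl | rfl := hτ
        · rfl
        · simp only; ring
      rw [h4] at h3
      convert h3 using 3 <;> ring
  · rintro ⟨r, x⟩ - ⟨r', x'⟩ - h
    simp only [max_eq_right (unitInterval.le_one' : r ≤ 1),
      max_eq_right (unitInterval.le_one' : r' ≤ 1), Set.Icc.coe_one, sub_self, zero_mul, one_mul,
      zero_add, polarQuot_one]
    exact hL.midpoint _ _ h

/-- With the centre and the rays to the midpoints of sides removed, points slide to the nearest
vertex. All vertices are one point, so a constant label suffices. -/
theorem deformsToDiscrete_vertices (hn : n ≠ 0) {L : ℤ → ℤ} (hL : IsPolygonGluing n R L) :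
    let A : Set (I × ℝ) := {p | 0 < p.1 ∧ ∀ m : ℤ, p.2 + 1 / 2 ≠ m}
    IsOpen (polarQuot n R '' A) ∧ (∀ p, polarQuot n R p ∈ polarQuot n R '' A ↔ p ∈ A) ∧
      DeformsToDiscrete (polarQuot n R '' A) := by
  intro A
  have hπ := (isQuotientMap_polarQuot (R := R) hn).continuous
  have hfl : ContinuousOn (fun p : I × ℝ => ⌊p.2 + 1 / 2⌋) A := fun p hp =>
    ((continuousAt_floor_of_ne hp.2).comp (f := fun p : I × ℝ => p.2 + 1 / 2)
      (by fun_prop)).continuousWithinAt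
  have hA : IsOpen A := isOpen_pos_and_forall_add_ne_intCast (1 / 2)
  refine deformsToDiscrete_image_polarQuot hn hA
    (fun p u => polarQuot n R (max p.1 u, (1 - u) * p.2 + u * ⌊p.2 + 1 / 2⌋)) ?_ ?_
    (fun _ => 0) continuousOn_const ?_ ?_ ?_ ?_
  · refine hπ.comp_continuousOn ?_
    have h1 : ContinuousOn (fun q : (I × ℝ) × I => (⌊q.1.2 + 1 / 2⌋ : ℝ)) (A ×ˢ Set.univ) :=
      (continuous_of_discreteTopology (f := fun k : ℤ => (k : ℝ))).comp_continuousOn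
        (hfl.comp continuousOn_fst fun q hq => hq.1)
    fun_prop
  · rintro ⟨r, x⟩ -
    simp
  · intro x y
    exact ⟨⟨fun h => absurd h.1 (lt_irrefl _), fun h => absurd h.1 (lt_irrefl _)⟩,
      fun h => absurd h.1 (lt_irrefl _)⟩
  · intro r x
    refine ⟨⟨fun h => ⟨h.1, fun m hm => h.2 (m + n) (by push_cast; linarith [hm])⟩,
      fun h => ⟨h.1, fun m hm => h.2 (m - n) (by push_cast; linarith [hm])⟩⟩, fun _ => ⟨funext fun u => ?_, rfl⟩⟩
    have h1 : ⌊x + n + 1 / 2⌋ = ⌊x + 1 / 2⌋ + n := by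
      rw [← Int.floor_add_natCast]; congr 1; ring
    simp only [h1]
    rw [← polarQuot_add_natCast hn _ ((1 - u) * x + u * ⌊x + 1 / 2⌋)]
    congr 2
    push_cast
    ring
  · intro z w hzw
    obtain ⟨k, k', hk, τ, hτ, ⟨s, hs, hz, hw⟩, hall⟩ := polarQuot_one_glue hL hzw
    have hcase : ∀ (j : ℤ) (s : ℝ), s ∈ Set.Icc (0 : ℝ) 1 →
        (((1, j + s) : I × ℝ) ∈ A ↔ s ≠ 1 / 2) := by
      intro j s hs
      constructor
      · rintro ⟨-, h⟩ h0
        exact h (j + 1) (by push_cast; rw [h0]; ring)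
      · rintro h0
        refine ⟨zero_lt_one, fun m hm => h0 ?_⟩
        replace hm : (j : ℝ) + s + 1 / 2 = m := hm
        have h2 : (0 : ℝ) < ((m - j : ℤ) : ℝ) := by push_cast; linarith [hs.1]
        have h3 : ((m - j : ℤ) : ℝ) < 2 := by push_cast; linarith [hs.2]
        have h4 : 0 < m - j := by exact_mod_cast h2
        have h5 : m - j < 2 := by exact_mod_cast h3
        have h6 : m = j + 1 := by omega
        rw [h6] at hm
        push_cast at hm
        linarith
    have hfloor : ∀ (j : ℤ) (s : ℝ), s ∈ Set.Icc (0 : ℝ) 1 →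
        ⌊(j : ℝ) + s + 1 / 2⌋ = j + if s < 1 / 2 then 0 else 1 := by
      intro j s hs
      split_ifs with h
      · exact Int.floor_eq_iff.2 ⟨by push_cast; linarith [hs.1], by push_cast; linarith⟩
      · exact Int.floor_eq_iff.2 ⟨by push_cast; linarith [hs.1], by push_cast; linarith [hs.2]⟩
    have hτs : τ s ∈ Set.Icc (0 : ℝ) 1 := by
      obtain rfl | rfl := hτ
      · exact hs
      · exact ⟨by linarith [hs.2], by linarith [hs.1]⟩
    have hτ2 : s ≠ 1 / 2 ↔ τ s ≠ 1 / 2 := by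
      obtain rfl | rfl := hτ
      · rfl
      · exact not_congr ⟨fun h => by linarith, fun h => by linarith⟩
    refine ⟨_, _, hz, hw, ?_, fun h => ⟨funext fun u => ?_, rfl⟩⟩
    · rw [hcase k s hs, hcase k' _ hτs, hτ2]
    · have h1 := (hcase k s hs).1 h
      simp only [hfloor k s hs, hfloor k' _ hτs]
      rw [max_eq_left (unitInterval.le_one' : u ≤ 1)]
      -- The end of the side nearer to `s`; a reversing gluing exchanges the two ends together with
      -- the two halves.
      let e : ℝ := if s < 1 / 2 then 0 else 1
      have he : e ∈ Set.Icc (0 : ℝ) 1 := by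
        simp only [e]; split_ifs <;> norm_num
      have h3 := hall ((1 - u) * s + u * e) ⟨by nlinarith [hs.1, hs.2, u.2.1, u.2.2, he.1, he.2],
        by nlinarith [hs.1, hs.2, u.2.1, u.2.2, he.1, he.2]⟩
      have h4 : τ ((1 - u) * s + u * e) =
          (1 - u) * τ s + u * (if τ s < 1 / 2 then 0 else 1) := by
        obtain rfl | rfl := hτ
        · rfl
        · simp only [e]
          rcases lt_or_gt_of_ne h1 with h | h
          · rw [if_pos h, if_neg (by linarith)]; ring
          · rw [if_neg (by linarith), if_pos (by linarith)]; ring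
      rw [h4] at h3
      simp only [e] at h3
      convert h3 using 3 <;> push_cast <;> ring
  · rintro ⟨r, x⟩ - ⟨r', x'⟩ - h
    simp only [max_eq_right (unitInterval.le_one' : r ≤ 1),
      max_eq_right (unitInterval.le_one' : r' ≤ 1), Set.Icc.coe_one, sub_self, zero_mul, one_mul,
      zero_add, polarQuot_one]
    rw [hL.vertex, hL.vertex]

end PolygonGluing

end

/-! ### Finite generation for glued polygons, and the standard surfaces -/

noncomputable section

section PolygonGluing

variable {n : ℕ} {R : ClosedDisc → ClosedDisc → Prop}

/-- The point `j / 4` is `x` itself if `2 * x` is an integer, and otherwise the centre of the open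
cell of half-integers containing `x`. The segment thus never runs into an excluded ray. -/
lemma exists_quarter_int_segment (x : ℝ) : ∃ j : ℤ, ∀ t ∈ Set.Icc (0 : ℝ) 1, ∀ m : ℤ,
    2 * ((1 - t) * x + t * (j / 4)) = m → 2 * x = m := by
  by_cases hx : ∃ k : ℤ, 2 * x = k
  · obtain ⟨k, hk⟩ := hx
    refine ⟨2 * k, fun t _ m hm => ?_⟩
    push_cast at hm
    rw [← hk] at hm
    linarith
  · push Not at hx
    refine ⟨2 * ⌊2 * x⌋ + 1, fun t ht m hm => ?_⟩
    push_cast at hm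
    have h1 : (⌊2 * x⌋ : ℝ) < 2 * x := lt_of_le_of_ne (Int.floor_le _) (hx _).symm
    have h2 := Int.lt_floor_add_one (2 * x)
    have h3 : (⌊2 * x⌋ : ℝ) < m := by
      rw [← hm]
      rcases lt_or_eq_of_le ht.2 with h | h
      · nlinarith [ht.1, mul_pos (sub_pos.2 h) (sub_pos.2 h1)]
      · rw [h]; linarith
    have h4 : (m : ℝ) < ⌊2 * x⌋ + 1 := by
      rw [← hm]
      rcases lt_or_eq_of_le ht.2 with h | h
      · nlinarith [ht.1, mul_pos (sub_pos.2 h) (sub_pos.2 h2)]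
      · rw [h]; linarith
    have h5 : ⌊2 * x⌋ < m := by exact_mod_cast h3
    have h6 : m < ⌊2 * x⌋ + 1 := by exact_mod_cast h4
    omega

instance : PathConnectedSpace ClosedDisc :=
  isPathConnected_iff_pathConnectedSpace.1
    ((convex_closedBall (0 : ℂ) 1).isPathConnected ⟨0, by simp⟩)

instance (R : ClosedDisc → ClosedDisc → Prop) : PathConnectedSpace (Quot R) :=
  Quot.mk_surjective.pathConnectedSpace continuous_quot_mk

/-- A straight segment in polar coordinates. -/
def polarSegment (r : I) (x y : ℝ) : C(I, I × ℝ) where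
  toFun t := (⟨(1 - t) * r + t * (1 / 2), by
    constructor <;> nlinarith [t.2.1, t.2.2, r.2.1, r.2.2]⟩, (1 - t) * x + t * y)
  continuous_toFun := by fun_prop

theorem IsPolygonGluing.fundamentalGroup_fg (hn : n ≠ 0) {L : ℤ → ℤ}
    (hL : IsPolygonGluing n R L) (x₀ : Quot R) : Group.FG (FundamentalGroup (Quot R) x₀) := by
  have hπ := isQuotientMap_polarQuot (R := R) hn
  let A : Fin 3 → Set (I × ℝ) := ![{p | p.1 < 1}, {p | 0 < p.1 ∧ ∀ m : ℤ, p.2 ≠ m},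
    {p | 0 < p.1 ∧ ∀ m : ℤ, p.2 + 1 / 2 ≠ m}]
  have hA : ∀ i, IsOpen (polarQuot n R '' A i) ∧
      (∀ p, polarQuot n R p ∈ polarQuot n R '' A i ↔ p ∈ A i) ∧
      DeformsToDiscrete (polarQuot n R '' A i) := by
    intro i
    fin_cases i
    · exact deformsToDiscrete_openDisc hn hL
    · exact deformsToDiscrete_sides hn hL
    · exact deformsToDiscrete_vertices hn hL
  have hseg : ∀ (r : I) (x y : ℝ), (∀ t ∈ Set.Icc (0 : ℝ) 1, ∀ m : ℤ,
      2 * ((1 - t) * x + t * y) = m → 2 * x = m) → ∀ i, (r, x) ∈ A i →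
      ∀ t : I, polarSegment r x y t ∈ A i := by
    intro r x y h i hi t
    have hpos : 0 < r → 0 < (polarSegment r x y t).1 := by
      intro hr
      have hr' : (0 : ℝ) < r := hr
      change (0 : ℝ) < (1 - t) * r + t * (1 / 2)
      rcases eq_or_lt_of_le t.2.1 with h | h
      · rw [← h]; linarith
      · nlinarith [t.2.2]
    fin_cases i
    · have hr : (r : ℝ) < 1 := hi
      change (1 - t : ℝ) * r + t * (1 / 2) < 1
      rcases eq_or_lt_of_le t.2.1 with h | h
      · rw [← h]; linarith
      · nlinarith [t.2.2]
    · refine ⟨hpos hi.1, fun m hm => hi.2 m ?_⟩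
      have := h t t.2 (2 * m) (by
        push_cast; rw [show (1 - t : ℝ) * x + t * y = m from hm])
      push_cast at this
      change x = m
      linarith
    · refine ⟨hpos hi.1, fun m hm => hi.2 m ?_⟩
      have := h t t.2 (2 * m - 1) (by
        push_cast; linarith [show (1 - t : ℝ) * x + t * y + 1 / 2 = m from hm])
      push_cast at this
      change x + 1 / 2 = m
      linarith
  -- Every overlap point is joined, in polar coordinates, to one of `4 * n` points at radius `1 / 2`
  -- and quarter-integer angle, without leaving any of the three sets that contain it.
  let half : I := ⟨1 / 2, by norm_num, by norm_num⟩
  refine fundamentalGroup_fg_of_cover x₀ (fun i => polarQuot n R '' A i) (fun i => (hA i).1) ?_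
    (fun i => (hA i).2.2)
    (Set.range fun j : Fin (4 * n) => polarQuot n R (half, (j : ℕ) / 4)) (Set.finite_range _) ?_
  · intro z
    obtain ⟨⟨r, x⟩, rfl⟩ := hπ.surjective z
    rcases eq_or_lt_of_le (unitInterval.nonneg' : 0 ≤ r) with h | h
    · exact ⟨0, _, show r < 1 by rw [← h]; exact zero_lt_one, rfl⟩
    · by_cases hx : ∀ m : ℤ, x ≠ m
      · exact ⟨1, _, ⟨h, hx⟩, rfl⟩
      · push Not at hx
        obtain ⟨m, hm⟩ := hx
        refine ⟨2, _, ⟨h, fun k hk => ?_⟩, rfl⟩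
        rw [hm] at hk
        have h1 : ((2 * m + 1 : ℤ) : ℝ) = ((2 * k : ℤ) : ℝ) := by push_cast; linarith
        have h2 : 2 * m + 1 = 2 * k := by exact_mod_cast h1
        omega
  · intro i i' z hi hi'
    obtain ⟨⟨r, x⟩, rfl⟩ := hπ.surjective z
    obtain ⟨j, hj⟩ := exists_quarter_int_segment x
    have h4 : (0 : ℤ) < 4 * n := by positivity
    refine ⟨polarQuot n R (half, j / 4), ⟨⟨(j % (4 * n)).toNat, ?_⟩, ?_⟩, ?_⟩
    · have := Int.emod_lt_of_pos j h4
      have := Int.emod_nonneg j h4.ne'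
      omega
    · have h5 : (((j % (4 * n)).toNat : ℕ) : ℝ) = ((j % (4 * n) : ℤ) : ℝ) := by
        exact_mod_cast congrArg (Int.cast (R := ℝ)) (Int.toNat_of_nonneg (Int.emod_nonneg j h4.ne'))
      have h6 : (j : ℝ) = ((j % (4 * n) : ℤ) : ℝ) + (4 * n) * ((j / (4 * n) : ℤ) : ℝ) := by
        exact_mod_cast congrArg (Int.cast (R := ℝ)) (Int.emod_add_mul_ediv j (4 * n)).symm
      simp only [h5]
      rw [← polarQuot_add_int_mul hn _ _ (j / (4 * n))]
      congr 2
      rw [h6]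
      ring
    · let γ : Path (polarQuot n R (r, x)) (polarQuot n R (half, j / 4)) :=
        { toFun := fun t => polarQuot n R (polarSegment r x (j / 4) t)
          continuous_toFun := hπ.continuous.comp (map_continuous _)
          source' := by
            congr 1
            refine Prod.ext (Subtype.ext ?_) ?_ <;> simp [polarSegment]
          target' := by
            congr 1
            refine Prod.ext (Subtype.ext ?_) ?_ <;> simp [polarSegment, half] }
      exact ⟨γ, fun t => ⟨⟨_, hseg r x _ hj i (((hA i).2.1 _).1 hi) t, rfl⟩,
        ⟨_, hseg r x _ hj i' (((hA i').2.1 _).1 hi') t, rfl⟩⟩⟩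

lemma boundaryPoint_add_int_mul (hn : n ≠ 0) (x : ℝ) (k : ℤ) :
    boundaryPoint n (x + k * n) = boundaryPoint n x := by
  simpa only [polarPoint_one] using polarPoint_add_int_mul hn 1 x k

lemma quot_mk_boundaryPoint_eq_zero
    (h : ∀ k : ℤ, Quot.mk R (boundaryPoint n (k + 1)) = Quot.mk R (boundaryPoint n k)) (k : ℤ) :
    Quot.mk R (boundaryPoint n k) = Quot.mk R (boundaryPoint n 0) := by
  induction k with
  | zero => simp
  | succ k ih => rw [← ih]; exact_mod_cast h k
  | pred k ih =>
    rw [← ih]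
    have := h (-k - 1)
    push_cast at this
    rw [sub_add_cancel] at this
    push_cast
    exact this.symm

theorem isPolygonGluing_nonorientable {g : ℕ} (hg : g ≠ 0) :
    IsPolygonGluing (2 * g) (NonorientableGluing g) (fun k => k % (2 * g : ℕ) / 2) := by
  have hn : 2 * g ≠ 0 := by omega
  have hdec : ∀ k : ℤ, ∃ (i : Fin g) (q : ℤ), k % (2 * g : ℕ) / 2 = i ∧
      (k = 2 * (i : ℕ) + q * (2 * g : ℕ) ∨ k = 2 * (i : ℕ) + 1 + q * (2 * g : ℕ)) := by
    intro k
    have h1 := Int.emod_nonneg k (b := (2 * g : ℕ)) (by omega)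
    have h2 := Int.emod_lt_of_pos k (b := (2 * g : ℕ)) (by omega)
    have h3 := Int.emod_add_ediv_mul k (2 * g : ℕ)
    generalize k % (2 * g : ℕ) = e at *
    refine ⟨⟨(e / 2).toNat, by omega⟩, k / (2 * g : ℕ), by simp only; omega, ?_⟩
    simp only
    omega
  have hglue : ∀ (i : Fin g) (s : I),
      Quot.mk (NonorientableGluing g) (boundaryPoint (2 * g) (2 * (i : ℕ) + s)) =
        Quot.mk (NonorientableGluing g) (boundaryPoint (2 * g) (2 * (i : ℕ) + 1 + s)) :=
    fun i s => Quot.sound (.c i s)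
  refine ⟨?_, fun k => by simp only [Int.add_emod_right], ?_, ?_⟩
  · rintro _ _ ⟨i, s⟩
    refine ⟨2 * (i : ℕ), 2 * (i : ℕ) + 1, ?_, id, .inl rfl, ⟨s, by push_cast; rfl,
      by push_cast; rfl⟩, fun s => by push_cast; exact .c i s⟩
    have := i.2
    rw [Int.emod_eq_of_lt (by omega) (by omega), Int.emod_eq_of_lt (by omega) (by omega)]
    omega
  · have h : ∀ k : ℤ, ∀ i : Fin g, k % (2 * g : ℕ) / 2 = i →
        Quot.mk (NonorientableGluing g) (boundaryPoint (2 * g) (k + 1 / 2)) =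
        Quot.mk (NonorientableGluing g) (boundaryPoint (2 * g) (2 * (i : ℕ) + 1 / 2)) := by
      intro k i hk
      obtain ⟨i', q, h1, h2⟩ := hdec k
      obtain rfl : i' = i := Fin.ext (by omega)
      have h3 := hglue i' ⟨1 / 2, by norm_num, by norm_num⟩
      obtain h2 | h2 := h2
      · rw [h2, ← boundaryPoint_add_int_mul hn (2 * (i' : ℕ) + 1 / 2) q]
        congr 2; push_cast; ring
      · rw [h3, h2, ← boundaryPoint_add_int_mul hn (2 * (i' : ℕ) + 1 + 1 / 2) q]
        congr 2; push_cast; ring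
    intro k k' hk
    obtain ⟨i, q, h1, -⟩ := hdec k
    rw [h k i h1, h k' i (by rw [← h1]; exact hk.symm)]
  -- The ends `s = 0` and `s = 1` of the gluing `c i` identify vertex `2i` with `2i + 1`, and `2i +
  -- 1` with `2i + 2`.
  · refine quot_mk_boundaryPoint_eq_zero fun k => ?_
    obtain ⟨i, q, -, h2 | h2⟩ := hdec k
    · have h3 := hglue i 0
      rw [← boundaryPoint_add_int_mul hn _ q,
        ← boundaryPoint_add_int_mul hn (2 * (i : ℕ) + 1 + (0 : I)) q] at h3
      rw [h2]
      convert h3.symm using 3 <;> (push_cast; simp; try ring)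
    · have h3 := hglue i 1
      rw [← boundaryPoint_add_int_mul hn _ q,
        ← boundaryPoint_add_int_mul hn (2 * (i : ℕ) + 1 + (1 : I)) q] at h3
      rw [h2]
      convert h3.symm using 3
      · push_cast; ring
      · push_cast; ring

/-- The label is `2i` on both sides `a i` and `2i + 1` on both sides `b i`. -/
theorem isPolygonGluing_orientable {g : ℕ} (hg : g ≠ 0) :
    IsPolygonGluing (4 * g) (OrientableGluing g)
      (fun k => 2 * (k % (4 * g : ℕ) / 4) + k % (4 * g : ℕ) % 2) := by
  have hn : 4 * g ≠ 0 := by omega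
  have hdec : ∀ k : ℤ, ∃ (i : Fin g) (q : ℤ) (c : ℕ), c < 4 ∧
      2 * (k % (4 * g : ℕ) / 4) + k % (4 * g : ℕ) % 2 = 2 * i + (c % 2 : ℕ) ∧
      k = 4 * (i : ℕ) + c + q * (4 * g : ℕ) := by
    intro k
    have h1 := Int.emod_nonneg k (b := (4 * g : ℕ)) (by omega)
    have h2 := Int.emod_lt_of_pos k (b := (4 * g : ℕ)) (by omega)
    have h3 := Int.emod_add_ediv_mul k (4 * g : ℕ)
    generalize k % (4 * g : ℕ) = e at *
    exact ⟨⟨(e / 4).toNat, by omega⟩, k / (4 * g : ℕ), (e % 4).toNat, by omega,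
      by simp only; omega, by simp only; omega⟩
  have hglue : ∀ (i : Fin g) (c : ℕ), c < 2 → ∀ s : I,
      Quot.mk (OrientableGluing g) (boundaryPoint (4 * g) (4 * (i : ℕ) + c + s)) =
        Quot.mk (OrientableGluing g) (boundaryPoint (4 * g) (4 * (i : ℕ) + c + 2 + (1 - s))) := by
    intro i c hc s
    interval_cases c
    · simpa using Quot.sound (OrientableGluing.a i s)
    · have := Quot.sound (OrientableGluing.b i s)
      convert this using 3 <;> push_cast <;> ring
  have hglue' : ∀ (i : Fin g) (q : ℤ) (c : ℕ), c < 2 → ∀ s : I,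
      Quot.mk (OrientableGluing g)
        (boundaryPoint (4 * g) (4 * (i : ℕ) + c + s + q * (4 * g : ℕ))) =
      Quot.mk (OrientableGluing g)
        (boundaryPoint (4 * g) (4 * (i : ℕ) + c + 2 + (1 - s) + q * (4 * g : ℕ))) := by
    intro i q c hc s
    rw [boundaryPoint_add_int_mul hn, boundaryPoint_add_int_mul hn, hglue i c hc s]
  refine ⟨?_, fun k => by simp only [Int.add_emod_right], ?_, ?_⟩
  · rintro _ _ (⟨i, s⟩ | ⟨i, s⟩)
    · refine ⟨4 * (i : ℕ), 4 * (i : ℕ) + 2, ?_, σ, .inr rfl, ⟨s, by push_cast; rfl,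
        by push_cast; rfl⟩, fun s => by push_cast; exact .a i s⟩
      have := i.2
      rw [Int.emod_eq_of_lt (a := 4 * (i : ℕ)) (by omega) (by omega),
        Int.emod_eq_of_lt (a := 4 * (i : ℕ) + 2) (by omega) (by omega)]
      omega
    · refine ⟨4 * (i : ℕ) + 1, 4 * (i : ℕ) + 3, ?_, σ, .inr rfl, ⟨s, by push_cast; rfl,
        by push_cast; rfl⟩, fun s => by push_cast; exact .b i s⟩
      have := i.2
      rw [Int.emod_eq_of_lt (a := 4 * (i : ℕ) + 1) (by omega) (by omega),
        Int.emod_eq_of_lt (a := 4 * (i : ℕ) + 3) (by omega) (by omega)]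
      omega
  · have h : ∀ k : ℤ, ∀ (i : Fin g) (c : ℕ), c < 2 →
        2 * (k % (4 * g : ℕ) / 4) + k % (4 * g : ℕ) % 2 = 2 * i + c →
        Quot.mk (OrientableGluing g) (boundaryPoint (4 * g) (k + 1 / 2)) =
        Quot.mk (OrientableGluing g) (boundaryPoint (4 * g) (4 * (i : ℕ) + c + 1 / 2)) := by
      intro k i c hc hk
      obtain ⟨i', q, c', hc', h1, h2⟩ := hdec k
      obtain rfl : i' = i := Fin.ext (by omega)
      have h3 := hglue i' c hc ⟨1 / 2, by norm_num, by norm_num⟩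
      have h4 : c' = c ∨ c' = c + 2 := by omega
      obtain rfl | rfl := h4
      · rw [h2, ← boundaryPoint_add_int_mul hn (4 * (i' : ℕ) + c' + 1 / 2) q]
        congr 2; push_cast; ring
      · rw [h3, h2, ← boundaryPoint_add_int_mul hn (4 * (i' : ℕ) + c + 2 + (1 - 1 / 2)) q]
        congr 2; push_cast; ring
    intro k k' hk
    obtain ⟨i, q, c, -, h1, -⟩ := hdec k
    rw [h k i (c % 2) (by omega) h1, h k' i (c % 2) (by omega) (by rw [← h1]; exact hk.symm)]
  · refine quot_mk_boundaryPoint_eq_zero fun k => ?_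
    obtain ⟨i, q, c, hc, -, rfl⟩ := hdec k
    let V : ℝ → Quot (OrientableGluing g) := fun y =>
      Quot.mk _ (boundaryPoint (4 * g) (4 * (i : ℕ) + y + q * (4 * g : ℕ)))
    have hV : ∀ c : ℕ, c < 2 → ∀ s : I, V (c + s) = V (c + 2 + (1 - s)) := by
      intro c hc s
      have := hglue' i q c hc s
      convert this using 3 <;> ring
    -- Within a block the four ends give `V 0 = V 3`, `V 1 = V 2`, `V 1 = V 4` and `V 2 = V 3`, so
    -- all five vertices agree.
    have h00 := hV 0 (by omega) 0
    have h01 := hV 0 (by omega) 1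
    have h10 := hV 1 (by omega) 0
    have h11 := hV 1 (by omega) 1
    norm_num at h00 h01 h10 h11
    have hgoal : V (c + 1) = V c := by
      interval_cases c
      · norm_num [h01, h11, h00]
      · norm_num [h01]
      · norm_num [h11]
      · norm_num [← h10, h01, h11]
    convert hgoal using 3
    · push_cast; ring
    · push_cast; ring

end PolygonGluing

end

/-! ### Noncommuting loops detected in a covering -/

noncomputable section

section Monodromy

variable {E X Y G : Type*} [TopologicalSpace E] [TopologicalSpace X] [TopologicalSpace Y]
  [Group G] [MulAction G E]

lemma IsQuotientCoveringMap.fundamentalGroupToMulOpposite_eq_of_lift {p : E → X}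
    (hp : IsQuotientCoveringMap p G) {x : X} (e : p ⁻¹' {x}) (γ : Path x x) (g : G)
    (γ' : Path (e : E) (g • (e : E))) (h : ∀ t, p (γ' t) = γ t) :
    hp.fundamentalGroupToMulOpposite e (Path.Homotopic.Quotient.mk γ) = MulOpposite.op g := by
  rw [hp.fundamentalGroupToMulOpposite_apply_eq_Iff]
  have he' : p (g • (e : E)) = x := (hp.map_smul g).trans e.2
  change ((⟨g • (e : E), he'⟩ : p ⁻¹' {x}) : E) = _
  rw [← hp.isCoveringMap.monodromy_eq_of_map_eq (ex := e) (ey := ⟨g • (e : E), he'⟩)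
    (γ := Path.Homotopic.Quotient.mk γ) (Γ := Path.Homotopic.Quotient.mk γ')]
  refine congrArg Path.Homotopic.Quotient.mk (Path.ext (funext fun t => ?_))
  exact h t

/-- Pushing loops forward by `f` and taking their deck transformations is a homomorphism to the
opposite of `G`, with values `a` and `b`. -/
lemma fundamentalGroup_mul_ne_of_lifts {p : E → X} (hp : IsQuotientCoveringMap p G) (f : C(Y, X))
    {y : Y} {e : E} (he : p e = f y) (α β : Path y y) {a b : G} (α' : Path e (a • e))
    (β' : Path e (b • e)) (hα : ∀ t, p (α' t) = f (α t)) (hβ : ∀ t, p (β' t) = f (β t))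
    (hab : a * b ≠ b * a) :
    ∃ A B : FundamentalGroup Y y, A * B ≠ B * A := by
  refine ⟨Path.Homotopic.Quotient.mk α, Path.Homotopic.Quotient.mk β, fun h => hab ?_⟩
  let e' : p ⁻¹' {f y} := ⟨e, he⟩
  let χ := (hp.fundamentalGroupToMulOpposite e').comp (FundamentalGroup.map f y)
  have h1 : χ (Path.Homotopic.Quotient.mk α) = MulOpposite.op a :=
    hp.fundamentalGroupToMulOpposite_eq_of_lift e' (α.map f.continuous) a α' hα
  have h2 : χ (Path.Homotopic.Quotient.mk β) = MulOpposite.op b :=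
    hp.fundamentalGroupToMulOpposite_eq_of_lift e' (β.map f.continuous) b β' hβ
  have h3 := congrArg χ h
  rw [map_mul, map_mul, h1, h2, ← MulOpposite.op_mul, ← MulOpposite.op_mul] at h3
  exact (MulOpposite.op_injective h3).symm

end Monodromy

section PolygonGluing

variable {n : ℕ} {R : ClosedDisc → ClosedDisc → Prop}

/-- A closed loop `F` in the covering space `E`, compatible with the gluing up to `G`, extends over
the polygon as a cone with apex `0` and so defines a map `Quot R → X`. Two sides of the polygon
become loops with deck transformations `a` and `b`. -/
theorem IsPolygonGluing.exists_mul_ne {E X G : Type*} [TopologicalSpace E] [AddCommGroup E]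
    [Module ℝ E] [ContinuousSMul ℝ E] [TopologicalSpace X] [Group G] [MulAction G E] (hn : n ≠ 0)
    {L : ℤ → ℤ} (hL : IsPolygonGluing n R L) {p : E → X} (hp : IsQuotientCoveringMap p G)
    {F : ℝ → E} (hF : Continuous F) (hF0 : F 0 = 0) (hFn : F n = 0)
    (hFR : ∀ z w, R z w → ∃ x ∈ Set.Icc (0 : ℝ) n, ∃ y ∈ Set.Icc (0 : ℝ) n,
      z = boundaryPoint n x ∧ w = boundaryPoint n y ∧ ∃ g : G, F x = g • F y)
    {k l : ℕ} (hk : k < n) (hl : l < n) {c d a b : G} (hc : F k = c • (0 : E))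
    (ha : F (k + 1) = (c * a) • (0 : E)) (hd : F l = d • (0 : E))
    (hb : F (l + 1) = (d * b) • (0 : E)) (hab : a * b ≠ b * a) :
    ∃ A B : FundamentalGroup (Quot R) (Quot.mk R (boundaryPoint n 0)), A * B ≠ B * A := by
  have hn' : (n : ℝ) ≠ 0 := by exact_mod_cast hn
  have hn0 : (0 : ℝ) < n := by positivity
  have hcs := hp.toContinuousConstSMul
  -- The `n`-periodic extension of `F` from `[0, n]`.
  let F' : ℝ → E := fun x => F (n * Int.fract (x / n))
  have hF' : Continuous F' := by
    have : Continuous ((fun t : ℝ => F (n * t)) ∘ Int.fract) :=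
      ContinuousOn.comp_fract'' (by fun_prop) (by simp [hF0, hFn])
    exact this.comp (continuous_id.div_const (n : ℝ))
  have hF'per : ∀ x, F' (x + n) = F' x := by
    intro x
    simp only [F']
    rw [add_div, div_self hn', Int.fract_add_one]
  have hF'eq : ∀ x ∈ Set.Icc (0 : ℝ) n, F' x = F x := by
    intro x hx
    rcases eq_or_lt_of_le hx.2 with h | h
    · simp only [F']
      rw [h, div_self hn', Int.fract_one, mul_zero, hF0, hFn]
    · simp only [F']
      rw [Int.fract_eq_self.2 ⟨div_nonneg hx.1 hn0.le, (div_lt_one hn0).2 h⟩,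
        mul_div_cancel₀ _ hn']
  let Φ : C(I × ℝ, X) := ⟨fun q => p ((q.1 : ℝ) • F' q.2), hp.continuous.comp (by fun_prop)⟩
  have hπ := isQuotientMap_polarQuot (R := R) hn
  have hΦ : ∀ q q', polarQuot n R q = polarQuot n R q' → Φ q = Φ q' := by
    intro q q' hq
    refine eq_of_polarQuot_eq hn Φ ?_ ?_ ?_ hq
    · intro x y
      simp [Φ]
    · intro r x
      simp [Φ, hF'per]
    · intro z w hzw
      obtain ⟨x, hx, y, hy, hz, hw, g, hg⟩ := hFR z w hzw
      refine ⟨x, y, hz, hw, ?_⟩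
      simp only [Φ, ContinuousMap.coe_mk, Set.Icc.coe_one, one_smul, hF'eq x hx, hF'eq y hy, hg]
      exact hp.map_smul g
  let π' : C(I × ℝ, Quot R) := ⟨polarQuot n R, hπ.continuous⟩
  let f : C(Quot R, X) := Topology.IsQuotientMap.lift (f := π') hπ Φ fun q q' h => hΦ q q' h
  have hf : ∀ x ∈ Set.Icc (0 : ℝ) n, f (Quot.mk R (boundaryPoint n x)) = p (F x) := by
    intro x hx
    rw [← polarQuot_one]
    refine (DFunLike.congr_fun (Topology.IsQuotientMap.lift_comp (f := π') hπ Φ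
      fun q q' h => hΦ q q' h) ((1 : I), x)).trans ?_
    simp only [Φ, ContinuousMap.coe_mk, Set.Icc.coe_one, one_smul, hF'eq x hx]
  have hside : ∀ k : ℕ, k < n → ∀ t : I, (k : ℝ) + t ∈ Set.Icc (0 : ℝ) n := by
    intro k hk t
    have : (k : ℝ) + 1 ≤ n := by exact_mod_cast hk
    exact ⟨add_nonneg (Nat.cast_nonneg k) t.2.1, by linarith [t.2.2]⟩
  have hloop : ∀ k : ℕ, k < n → ∃ γ : Path (Quot.mk R (boundaryPoint n 0))
      (Quot.mk R (boundaryPoint n 0)), ∀ t, γ t = Quot.mk R (boundaryPoint n (k + t)) := by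
    intro k hk
    refine ⟨⟨⟨fun t => Quot.mk R (boundaryPoint n (k + t)), ?_⟩, ?_, ?_⟩, fun t => rfl⟩
    · simp only [← polarQuot_one]
      exact hπ.continuous.comp (by fun_prop)
    · simpa using hL.vertex k
    · simpa using hL.vertex (k + 1)
  -- Side `k` lifts to a path starting at `c • 0`; translating by `c⁻¹` makes it start at `0` and
  -- end at `a • 0`.
  have hlift : ∀ (k : ℕ) (c a : G), F k = c • (0 : E) → F (k + 1) = (c * a) • (0 : E) →
      ∃ γ : Path (0 : E) (a • (0 : E)), ∀ t, γ t = c⁻¹ • F (k + t) := by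
    intro k c a hc ha
    refine ⟨⟨⟨fun t => c⁻¹ • F (k + t), ?_⟩, ?_, ?_⟩, fun t => rfl⟩
    · exact Continuous.const_smul (by fun_prop) _
    · simp [hc]
    · simp [ha, mul_smul]
  obtain ⟨α, hα⟩ := hloop k hk
  obtain ⟨β, hβ⟩ := hloop l hl
  obtain ⟨α', hα'⟩ := hlift k c a hc ha
  obtain ⟨β', hβ'⟩ := hlift l d b hd hb
  refine fundamentalGroup_mul_ne_of_lifts hp f (e := (0 : E)) ?_ α β α' β' ?_ ?_ hab
  · rw [hf 0 ⟨le_rfl, hn0.le⟩, hF0]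
  · intro t
    rw [hα, hα', hf _ (hside k hk t)]
    exact hp.map_smul _
  · intro t
    rw [hβ, hβ', hf _ (hside l hl t)]
    exact hp.map_smul _

end PolygonGluing

section KleinBottleGroup

/-- The group of isometries `(x, y) ↦ (x + m, (-1) ^ m * y + n)` of the plane, whose quotient is
the Klein bottle. -/
def kleinBottleGroup : Subgroup (Equiv.Perm (ℝ × ℝ)) where
  carrier := {e | ∃ m n ε : ℤ, (ε = 1 ∧ Even m ∨ ε = -1 ∧ Odd m) ∧
    ∀ p, e p = (p.1 + m, ε * p.2 + n)}
  one_mem' := ⟨0, 0, 1, .inl ⟨rfl, Even.zero⟩, fun p => by simp⟩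
  mul_mem' := by
    rintro e e' ⟨m, n, ε, h, he⟩ ⟨m', n', ε', h', he'⟩
    refine ⟨m' + m, ε * n' + n, ε * ε', ?_, fun p => ?_⟩
    · obtain ⟨rfl, h⟩ | ⟨rfl, h⟩ := h <;> obtain ⟨rfl, h'⟩ | ⟨rfl, h'⟩ := h'
      · exact .inl ⟨rfl, h'.add h⟩
      · exact .inr ⟨rfl, h'.add_even h⟩
      · exact .inr ⟨rfl, h'.add_odd h⟩
      · exact .inl ⟨rfl, h'.add_odd h⟩
    · rw [Equiv.Perm.mul_apply, he', he]
      refine Prod.ext ?_ ?_ <;> push_cast <;> ring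
  inv_mem' := by
    rintro e ⟨m, n, ε, h, he⟩
    refine ⟨-m, -(ε * n), ε, ?_, fun p => ?_⟩
    · simpa using h
    · rw [Equiv.Perm.inv_eq_iff_eq, he]
      have h2 : (ε : ℝ) * ε = 1 := by
        obtain ⟨rfl, -⟩ | ⟨rfl, -⟩ := h <;> norm_num
      refine Prod.ext ?_ ?_
      · push_cast; ring
      · push_cast
        linear_combination (n - p.2) * h2

/-- The isometry `(x, y) ↦ (x + m, ε * y + n)`, where `ε = (-1) ^ m`. -/
def kleinBottleGroup.mk (m n ε : ℤ) (h : ε = 1 ∧ Even m ∨ ε = -1 ∧ Odd m) : kleinBottleGroup :=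
  have h2 : (ε : ℝ) * ε = 1 := by
    obtain ⟨rfl, -⟩ | ⟨rfl, -⟩ := h <;> norm_num
  ⟨{  toFun := fun p => (p.1 + m, ε * p.2 + n)
      invFun := fun p => (p.1 - m, ε * (p.2 - n))
      left_inv := fun p => Prod.ext (by simp) (by simp only; linear_combination p.2 * h2)
      right_inv := fun p => Prod.ext (by simp) (by
        simp only; linear_combination (p.2 - n) * h2) }, m, n, ε, h, fun _ => rfl⟩

lemma kleinBottleGroup.mk_smul (m n ε : ℤ) (h : ε = 1 ∧ Even m ∨ ε = -1 ∧ Odd m) (p : ℝ × ℝ) :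
    kleinBottleGroup.mk m n ε h • p = (p.1 + m, ε * p.2 + n) := rfl

theorem kleinBottleGroup.isQuotientCoveringMap :
    IsQuotientCoveringMap (Quotient.mk (MulAction.orbitRel kleinBottleGroup (ℝ × ℝ)))
      kleinBottleGroup where
  toIsQuotientMap := isQuotientMap_quotient_mk'
  continuous_const_smul := by
    rintro ⟨e, m, n, ε, h, he⟩
    have : Continuous fun p : ℝ × ℝ => (p.1 + (m : ℝ), (ε : ℝ) * p.2 + n) := by fun_prop
    exact this.congr fun p => (he p).symm
  apply_eq_iff_mem_orbit := Quotient.eq''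
  disjoint e := by
    -- Two points of this ball differ by less than one in each coordinate: first `m = 0`, hence `ε =
    -- 1`, and then `n = 0`.
    refine ⟨Metric.ball e (1 / 2), Metric.ball_mem_nhds e (by norm_num), ?_⟩
    rintro ⟨g, m, n, ε, h, hg⟩ ⟨_, ⟨p, hp, rfl⟩, hgp⟩
    have hsmul : ∀ q : ℝ × ℝ, (⟨g, m, n, ε, h, hg⟩ : kleinBottleGroup) • q =
        (q.1 + m, ε * q.2 + n) := hg
    have hzero : ∀ k : ℤ, |(k : ℝ)| < 1 → k = 0 := by
      intro k hk
      have : |k| < 1 := by exact_mod_cast hk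
      exact Int.abs_lt_one_iff.1 this
    simp only [hsmul] at hgp
    rw [Metric.mem_ball, Prod.dist_eq, max_lt_iff, Real.dist_eq, Real.dist_eq, abs_lt,
      abs_lt] at hp hgp
    obtain ⟨⟨h1, h2⟩, h3, h4⟩ := hp
    obtain ⟨⟨h5, h6⟩, h7, h8⟩ := hgp
    simp only at h5 h6 h7 h8
    obtain rfl := hzero m (abs_lt.2 ⟨by linarith, by linarith⟩)
    obtain ⟨rfl, -⟩ | ⟨-, h⟩ := h
    · push_cast at h7 h8
      obtain rfl := hzero n (abs_lt.2 ⟨by linarith, by linarith⟩)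
      refine Subtype.ext (Equiv.ext fun q => ?_)
      rw [hg]
      simp
    · exact absurd h (by decide)

end KleinBottleGroup

end

/-! ### Explicit polygon loops over the Klein bottle -/

noncomputable section

section Ramp

/-- The truncation of a real number to `[0, 1]`. -/
def ramp (x : ℝ) : ℝ := max 0 (min 1 x)

lemma continuous_ramp : Continuous ramp := by unfold ramp; fun_prop

end Ramp

/-- A piecewise linear loop in the plane of which the first four sides of unit length are glued
to each other by the Klein bottle group. -/
def nonorientableBoundary (x : ℝ) : ℝ × ℝ :=
  (ramp x + ramp (x - 1) - ramp (x - 2) - ramp (x - 3), ramp (x - 2) - ramp (x - 3))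

/-- A piecewise linear loop in the plane of which the first eight sides of unit length are glued
to each other by the Klein bottle group. -/
def orientableBoundary (x : ℝ) : ℝ × ℝ :=
  (ramp x - ramp (x - 2) + ramp (x - 5) - ramp (x - 7),
    -ramp (x - 1) - ramp (x - 3) + ramp (x - 4) + ramp (x - 6))

lemma nonorientableBoundary_apply (x : ℝ) (h : 0 ≤ x) :
    (x ≤ 1 → nonorientableBoundary x = (x, 0)) ∧
    (1 ≤ x → x ≤ 2 → nonorientableBoundary x = (x, 0)) ∧
    (2 ≤ x → x ≤ 3 → nonorientableBoundary x = (4 - x, x - 2)) ∧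
    (3 ≤ x → x ≤ 4 → nonorientableBoundary x = (4 - x, 4 - x)) ∧
    (4 ≤ x → nonorientableBoundary x = 0) := by
  unfold nonorientableBoundary
  refine ⟨fun h1 => ?_, fun h1 h2 => ?_, fun h1 h2 => ?_, fun h1 h2 => ?_, fun h1 => ?_⟩ <;>
    refine Prod.ext ?_ ?_ <;>
    simp only [Prod.fst_zero, Prod.snd_zero] <;> grind [ramp]

lemma orientableBoundary_apply (x : ℝ) (h : 0 ≤ x) :
    (x ≤ 1 → orientableBoundary x = (x, 0)) ∧
    (1 ≤ x → x ≤ 2 → orientableBoundary x = (1, 1 - x)) ∧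
    (2 ≤ x → x ≤ 3 → orientableBoundary x = (3 - x, -1)) ∧
    (3 ≤ x → x ≤ 4 → orientableBoundary x = (0, 2 - x)) ∧
    (4 ≤ x → x ≤ 5 → orientableBoundary x = (0, x - 6)) ∧
    (5 ≤ x → x ≤ 6 → orientableBoundary x = (x - 5, -1)) ∧
    (6 ≤ x → x ≤ 7 → orientableBoundary x = (1, x - 7)) ∧
    (7 ≤ x → x ≤ 8 → orientableBoundary x = (8 - x, 0)) ∧
    (8 ≤ x → orientableBoundary x = 0) := by
  unfold orientableBoundary
  refine ⟨fun h1 => ?_, fun h1 h2 => ?_, fun h1 h2 => ?_, fun h1 h2 => ?_, fun h1 h2 => ?_,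
    fun h1 h2 => ?_, fun h1 h2 => ?_, fun h1 h2 => ?_, fun h1 => ?_⟩ <;>
    refine Prod.ext ?_ ?_ <;>
    simp only [Prod.fst_zero, Prod.snd_zero] <;> grind [ramp]

/-- The first two letters go to glide reflections `u`, `v` with `u² v² = 1`, so the word `c₀ c₀ c₁
c₁` closes up through the corners `0`, `u 0`, `u² 0`, `u² v 0`. All further sides are collapsed to
the origin. -/
theorem nonorientable_exists_mul_ne {g : ℕ} (hg : 2 ≤ g) :
    ∃ A B : FundamentalGroup (Quot (NonorientableGluing g))
      (Quot.mk _ (boundaryPoint (2 * g) 0)), A * B ≠ B * A := by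
  have hg' : (2 : ℝ) ≤ g := by exact_mod_cast hg
  let u := kleinBottleGroup.mk 1 0 (-1) (by decide)
  let v := kleinBottleGroup.mk (-1) 1 (-1) (by decide)
  have h0 : nonorientableBoundary 0 = 0 := by
    rw [(nonorientableBoundary_apply 0 le_rfl).1 zero_le_one]; rfl
  refine (isPolygonGluing_nonorientable (by omega)).exists_mul_ne (by omega)
    kleinBottleGroup.isQuotientCoveringMap (F := nonorientableBoundary) ?_ h0 ?_ ?_
    (k := 0) (l := 2) (by omega) (by omega) (c := 1) (d := u * u) (a := u) (b := v) ?_ ?_ ?_ ?_ ?_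
  · have := continuous_ramp
    unfold nonorientableBoundary
    fun_prop
  · exact (nonorientableBoundary_apply _ (by positivity)).2.2.2.2 (by push_cast; linarith)
  · rintro _ _ ⟨i, s⟩
    have hs := s.2.1
    have hs' := s.2.2
    have hi : ((i : ℕ) : ℝ) + 1 ≤ g := by exact_mod_cast i.2
    have hi0 : (0 : ℝ) ≤ (i : ℕ) := Nat.cast_nonneg _
    refine ⟨_, ⟨by positivity, by push_cast; linarith⟩, _, ⟨by positivity, by push_cast; linarith⟩,
      rfl, rfl, ?_⟩
    obtain hi2 | hi2 | hi2 : (i : ℕ) = 0 ∨ (i : ℕ) = 1 ∨ 2 ≤ (i : ℕ) := by omega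
    · refine ⟨kleinBottleGroup.mk (-1) 0 (-1) (by decide), ?_⟩
      rw [hi2, (nonorientableBoundary_apply _ (by positivity)).1 (by norm_num [hs']),
        (nonorientableBoundary_apply _ (by positivity)).2.1 (by norm_num [hs])
          (by norm_num; linarith), kleinBottleGroup.mk_smul]
      refine Prod.ext ?_ ?_ <;> push_cast <;> ring
    · refine ⟨kleinBottleGroup.mk 1 1 (-1) (by decide), ?_⟩
      rw [hi2, (nonorientableBoundary_apply _ (by positivity)).2.2.1 (by norm_num [hs])
          (by norm_num; linarith),
        (nonorientableBoundary_apply _ (by positivity)).2.2.2.1 (by norm_num; linarith)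
          (by norm_num; linarith), kleinBottleGroup.mk_smul]
      refine Prod.ext ?_ ?_ <;> push_cast <;> ring
    · have hi3 : (2 : ℝ) ≤ (i : ℕ) := by exact_mod_cast hi2
      refine ⟨1, ?_⟩
      rw [(nonorientableBoundary_apply _ (by positivity)).2.2.2.2 (by linarith),
        (nonorientableBoundary_apply _ (by positivity)).2.2.2.2 (by linarith), one_smul]
  · simp [h0]
  · rw [(nonorientableBoundary_apply _ (by positivity)).1 (by norm_num), mul_smul, one_smul,
      kleinBottleGroup.mk_smul]
    norm_num
  · rw [(nonorientableBoundary_apply _ (by positivity)).2.2.1 (by norm_num) (by norm_num),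
      mul_smul, kleinBottleGroup.mk_smul, kleinBottleGroup.mk_smul]
    norm_num
  · rw [(nonorientableBoundary_apply _ (by positivity)).2.2.1 (by norm_num) (by norm_num),
      mul_smul, mul_smul, kleinBottleGroup.mk_smul, kleinBottleGroup.mk_smul,
      kleinBottleGroup.mk_smul]
    norm_num
  · intro h
    have h1 := congrArg (fun e : kleinBottleGroup => (e • (0 : ℝ × ℝ)).2) h
    simp only [mul_smul, u, v, kleinBottleGroup.mk_smul] at h1
    norm_num at h1

/-- The first two handles go to `(u, v)` and `(v, u)`, whose commutators cancel: `[u, v] [v, u] =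
1`. The remaining handles are collapsed. As `u` reflects the direction of the translation `v`, these
two do not commute. -/
theorem orientable_exists_mul_ne {g : ℕ} (hg : 2 ≤ g) :
    ∃ A B : FundamentalGroup (Quot (OrientableGluing g))
      (Quot.mk _ (boundaryPoint (4 * g) 0)), A * B ≠ B * A := by
  have hg' : (2 : ℝ) ≤ g := by exact_mod_cast hg
  let u := kleinBottleGroup.mk 1 0 (-1) (by decide)
  let v := kleinBottleGroup.mk 0 1 1 (by decide)
  have h0 : orientableBoundary 0 = 0 := by
    rw [(orientableBoundary_apply 0 le_rfl).1 zero_le_one]; rfl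
  refine (isPolygonGluing_orientable (by omega)).exists_mul_ne (by omega)
    kleinBottleGroup.isQuotientCoveringMap (F := orientableBoundary) ?_ h0 ?_ ?_
    (k := 0) (l := 1) (by omega) (by omega) (c := 1) (d := u) (a := u) (b := v) ?_ ?_ ?_ ?_ ?_
  · have := continuous_ramp
    unfold orientableBoundary
    fun_prop
  · exact (orientableBoundary_apply _ (by positivity)).2.2.2.2.2.2.2.2 (by push_cast; linarith)
  · rintro _ _ (⟨i, s⟩ | ⟨i, s⟩)
    all_goals
      have hs := s.2.1
      have hs' := s.2.2
      have hi : ((i : ℕ) : ℝ) + 1 ≤ g := by exact_mod_cast i.2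
      have hi0 : (0 : ℝ) ≤ (i : ℕ) := Nat.cast_nonneg _
      refine ⟨_, ⟨by linarith, by push_cast; linarith⟩, _, ⟨by linarith, by push_cast; linarith⟩,
        rfl, rfl, ?_⟩
      obtain hi2 | hi2 | hi2 : (i : ℕ) = 0 ∨ (i : ℕ) = 1 ∨ 2 ≤ (i : ℕ) := by omega
    · refine ⟨kleinBottleGroup.mk 0 1 1 (by decide), ?_⟩
      rw [hi2, (orientableBoundary_apply _ (by norm_num; linarith)).1 (by norm_num [hs']),
        (orientableBoundary_apply _ (by norm_num; linarith)).2.2.1 (by norm_num; linarith)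
          (by norm_num; linarith), kleinBottleGroup.mk_smul]
      refine Prod.ext ?_ ?_ <;> push_cast <;> ring
    · refine ⟨kleinBottleGroup.mk (-1) (-2) (-1) (by decide), ?_⟩
      rw [hi2, (orientableBoundary_apply _ (by norm_num; linarith)).2.2.2.2.1
          (by norm_num; linarith) (by norm_num; linarith),
        (orientableBoundary_apply _ (by norm_num; linarith)).2.2.2.2.2.2.1 (by norm_num; linarith)
          (by norm_num; linarith), kleinBottleGroup.mk_smul]
      refine Prod.ext ?_ ?_ <;> push_cast <;> ring
    · have hi3 : (2 : ℝ) ≤ (i : ℕ) := by exact_mod_cast hi2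
      refine ⟨1, ?_⟩
      rw [(orientableBoundary_apply _ (by linarith)).2.2.2.2.2.2.2.2 (by linarith),
        (orientableBoundary_apply _ (by linarith)).2.2.2.2.2.2.2.2 (by linarith), one_smul]
    · refine ⟨kleinBottleGroup.mk 1 (-2) (-1) (by decide), ?_⟩
      rw [hi2, (orientableBoundary_apply _ (by norm_num; linarith)).2.1 (by norm_num; linarith)
          (by norm_num; linarith),
        (orientableBoundary_apply _ (by norm_num; linarith)).2.2.2.1 (by norm_num; linarith)
          (by norm_num; linarith), kleinBottleGroup.mk_smul]
      refine Prod.ext ?_ ?_ <;> push_cast <;> ring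
    · refine ⟨kleinBottleGroup.mk 0 (-1) 1 (by decide), ?_⟩
      rw [hi2, (orientableBoundary_apply _ (by norm_num; linarith)).2.2.2.2.2.1
          (by norm_num; linarith) (by norm_num; linarith),
        (orientableBoundary_apply _ (by norm_num; linarith)).2.2.2.2.2.2.2.1
          (by norm_num; linarith) (by norm_num; linarith), kleinBottleGroup.mk_smul]
      refine Prod.ext ?_ ?_ <;> push_cast <;> ring
    · have hi3 : (2 : ℝ) ≤ (i : ℕ) := by exact_mod_cast hi2
      refine ⟨1, ?_⟩
      rw [(orientableBoundary_apply _ (by linarith)).2.2.2.2.2.2.2.2 (by linarith),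
        (orientableBoundary_apply _ (by linarith)).2.2.2.2.2.2.2.2 (by linarith), one_smul]
  · simp [h0]
  · rw [(orientableBoundary_apply _ (by positivity)).1 (by norm_num), mul_smul, one_smul,
      kleinBottleGroup.mk_smul]
    norm_num
  · rw [(orientableBoundary_apply _ (by positivity)).1 (by norm_num),
      kleinBottleGroup.mk_smul]
    norm_num
  · rw [(orientableBoundary_apply _ (by positivity)).2.1 (by norm_num) (by norm_num),
      mul_smul, kleinBottleGroup.mk_smul, kleinBottleGroup.mk_smul]
    norm_num
  · intro h
    have h1 := congrArg (fun e : kleinBottleGroup => (e • (0 : ℝ × ℝ)).2) h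
    simp only [mul_smul, u, v, kleinBottleGroup.mk_smul] at h1
    norm_num at h1

end

/-! ### Fundamental groups of closed surfaces -/

noncomputable section

section ClosedSurface

lemma Homeomorph.fundamentalGroup_mapOfEq_surjective {X Y : Type*} [TopologicalSpace X]
    [TopologicalSpace Y] (h : X ≃ₜ Y) {x : X} {y : Y} (hxy : h x = y) :
    Function.Surjective (FundamentalGroup.mapOfEq ⟨h, h.continuous⟩ hxy) := by
  subst hxy
  intro a
  obtain ⟨α, rfl⟩ := Path.Homotopic.Quotient.mk_surjective a
  refine ⟨Path.Homotopic.Quotient.mk ((α.map h.symm.continuous).cast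
    (h.symm_apply_apply x).symm (h.symm_apply_apply x).symm), ?_⟩
  rw [FundamentalGroup.mapOfEq_apply]
  refine congrArg Path.Homotopic.Quotient.mk (Path.ext (funext fun t => ?_))
  exact h.apply_symm_apply _

variable {S : Type*} [TopologicalSpace S] {g : ℕ}

theorem IsClosedSurfaceOfGenus.exists_polygonGluing (hS : IsClosedSurfaceOfGenus g S)
    (hg : 2 ≤ g) : ∃ (n : ℕ) (R : ClosedDisc → ClosedDisc → Prop) (L : ℤ → ℤ), n ≠ 0 ∧
      IsPolygonGluing n R L ∧ (∃ A B : FundamentalGroup (Quot R) (Quot.mk R (boundaryPoint n 0)),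
        A * B ≠ B * A) ∧ Nonempty (S ≃ₜ Quot R) := by
  obtain h | h := hS
  · exact ⟨4 * g, _, _, by omega, isPolygonGluing_orientable (by omega),
      by exact_mod_cast orientable_exists_mul_ne hg, h⟩
  · exact ⟨2 * g, _, _, by omega, isPolygonGluing_nonorientable (by omega),
      by exact_mod_cast nonorientable_exists_mul_ne hg, h⟩

theorem IsClosedSurfaceOfGenus.pathConnectedSpace (hS : IsClosedSurfaceOfGenus g S)
    (hg : 2 ≤ g) : PathConnectedSpace S := by
  obtain ⟨n, R, L, -, -, -, ⟨h⟩⟩ := hS.exists_polygonGluing hg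
  exact h.symm.surjective.pathConnectedSpace h.symm.continuous

theorem IsClosedSurfaceOfGenus.fundamentalGroup_fg (hS : IsClosedSurfaceOfGenus g S)
    (hg : 2 ≤ g) (x₀ : S) : Group.FG (FundamentalGroup S x₀) := by
  obtain ⟨n, R, L, hn, hL, -, ⟨h⟩⟩ := hS.exists_polygonGluing hg
  have := hL.fundamentalGroup_fg hn (h x₀)
  exact Group.fg_of_surjective
    (h.symm.fundamentalGroup_mapOfEq_surjective (h.symm_apply_apply x₀))

theorem IsClosedSurfaceOfGenus.fundamentalGroup_exists_mul_ne (hS : IsClosedSurfaceOfGenus g S)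
    (hg : 2 ≤ g) (x₀ : S) : ∃ A B : FundamentalGroup S x₀, A * B ≠ B * A := by
  obtain ⟨n, R, L, hn, hL, ⟨A, B, hAB⟩, ⟨h⟩⟩ := hS.exists_polygonGluing hg
  let e := FundamentalGroup.fundamentalGroupMulEquivOfPathConnected
    (h x₀) (Quot.mk R (boundaryPoint n 0))
  have hsurj := h.fundamentalGroup_mapOfEq_surjective (rfl : h x₀ = h x₀)
  obtain ⟨a, ha⟩ := hsurj (e.symm A)
  obtain ⟨b, hb⟩ := hsurj (e.symm B)
  refine ⟨a, b, fun hab => hAB (e.symm.injective ?_)⟩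
  rw [map_mul, map_mul, ← ha, ← hb, ← map_mul, ← map_mul, hab]

end ClosedSurface

end

/-! ### Conclusion -/

theorem mainTheorem10 {S : Type*} [TopologicalSpace S] (g : ℕ) (hg : 2 ≤ g)
    (hS : IsClosedSurfaceOfGenus g S) (φ : S ≃ₜ S) (x₀ : S)
    (htf : ∀ γ : FundamentalGroup (MappingTorus φ) (MappingTorus.fiber φ x₀),
      γ ≠ 1 → ¬ IsOfFinOrder γ)
    (ρ : FundamentalGroup (MappingTorus φ) (MappingTorus.fiber φ x₀) →* PSL(2, ℝ))
    (hρ : Function.Injective ρ) :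
    ¬ IsDiscreteRep (MappingTorus.restrictToFiber φ x₀ ρ) := by
  intro hdisc
  have := hS.pathConnectedSpace hg
  have := hS.fundamentalGroup_fg hg x₀
  obtain ⟨δ, hδ, hker⟩ := MappingTorus.exists_degree φ x₀
  -- An element of degree one; it normalizes the image of the fibre group, which is the kernel of
  -- `δ`.
  obtain ⟨t, ht⟩ := hδ (MulOpposite.op (Multiplicative.ofAdd 1))
  let r := MappingTorus.restrictToFiber φ x₀ ρ
  have hdisc' : DiscreteTopology r.range := hdisc
  have hmem : ∀ γ, ρ γ ∈ r.range ↔ δ γ = 1 := by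
    intro γ
    rw [← MonoidHom.mem_ker, hker]
    constructor
    · rintro ⟨a, ha⟩
      exact ⟨a, hρ ha⟩
    · rintro ⟨a, rfl⟩
      exact ⟨a, rfl⟩
  have hr : ∀ h ∈ r.range, ∃ γ, ρ γ = h := by
    rintro _ ⟨a, rfl⟩
    exact ⟨_, rfl⟩
  have htf' : ∀ h ∈ r.range, h ≠ 1 → ¬ IsOfFinOrder h := by
    intro h hh h1 hfin
    obtain ⟨γ, rfl⟩ := hr h hh
    exact htf γ (fun h2 => h1 (by rw [h2, map_one])) (hρ.isOfFinOrder_iff.1 hfin)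
  have hnc : ∃ B ∈ r.range, ∃ C ∈ r.range, B * C ≠ C * B := by
    obtain ⟨a, b, hab⟩ := hS.fundamentalGroup_exists_mul_ne hg x₀
    refine ⟨r a, ⟨a, rfl⟩, r b, ⟨b, rfl⟩, fun h => hab ?_⟩
    have hinj : Function.Injective r := hρ.comp (MappingTorus.fiber_map_injective φ x₀)
    exact hinj (by rw [map_mul, map_mul, h])
  have hnorm : ∀ h, h ∈ r.range ↔ ρ t * h * (ρ t)⁻¹ ∈ r.range := by
    intro h
    constructor
    · intro hh
      obtain ⟨γ, rfl⟩ := hr h hh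
      rw [hmem] at hh
      rw [← map_inv, ← map_mul, ← map_mul, hmem]
      rw [map_mul, map_mul, map_inv, hh, mul_one, mul_inv_cancel]
    · intro hh
      obtain ⟨γ, hγ⟩ := hr _ hh
      have h1 : h = ρ (t⁻¹ * γ * t) := by
        rw [map_mul, map_mul, hγ, map_inv]; group
      rw [h1, hmem]
      rw [← hγ, hmem] at hh
      rw [map_mul, map_mul, map_inv, hh, mul_one, inv_mul_cancel]
  obtain ⟨n, hn, hpow⟩ := PSL2_exists_pow_mem_of_normalizes r.range
    ((Group.fg_iff_subgroup_fg _).1 (Group.fg_range r)) htf' hnc hnorm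
  -- Membership of a power of `ρ t` forces `δ (t ^ n) = 1`, that is `n = 0`, against `1 ≤ n`.
  rw [← map_pow, hmem, map_pow, ht] at hpow
  have h1 := congrArg (fun x : (Multiplicative ℤ)ᵐᵒᵖ => x.unop.toAdd) hpow
  simp at h1
  omega
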